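/- **Theorem.** Let $q\ge 2$, let $A_i\in\mathbb R^{n_i\times d_i}$ with $d_i\ge 1$ for $i=1,\dots,q$, and put $A=A_1\otimes\cdots\otimes A_q\in\mathbb R^{n\times d}$ with $n=\prod_i n_i$, $d=\prod_i d_i$. For $1\le k\le d$ let $\mathrm{OPT}_k=\min_{\mathrm{rank}(A')\le k}\|A'-A\|_F$, and let $0<\varepsilon<1$. A *count-sketch* matrix $S\in\mathbb R^{m\times n}$ has exactly one nonzero entry in each column; independently for each column, this entry lies in a uniformly random row and is $+1$ or $-1$ with equal probability. (1) There is an absolute constant $C>0$ such that the following holds for every integer $m\ge C\,q\,k^2/\varepsilon^2$. Let $S_i\in\mathbb R^{m\times n_i}$ $(i=1,\dots,q)$ be independent count-sketch matrices and $M=(S_1\otimes\cdots\otimes S_q)A$. With probability at least $9/10$, for every $U\in\mathbb R^{k\times d}$ whose rows are orthonormal right singular vectors of $M$ for its $k$ largest singular values, the matrix $B=AU^\top U$ has rank at most $k$ and satisfies $$\|B-A\|_F\le(1+\varepsilon)\,\mathrm{OPT}_k .$$ (2) For every constant $q\ge2$ there is a randomized algorithm with the following property. Given $k$, $\varepsilon$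 and, for each $i$, the numbers $n_i,d_i,\mathrm{nnz}(A_i)$ and the list of the nonzero entries of $A_i$ with their positions (in any order), it always outputs a matrix $U\in\mathbb R^{k\times d}$ with orthonormal rows, that is, the matrix $B=AU^\top U$ of rank at most $k$ in the factored form $(A_1,\dots,A_q,U)$; with probability at least $9/10$, $$\|B-A\|_F\le(1+\varepsilon)\,\mathrm{OPT}_k ;$$ and its running time is always at most $$C_q\Big(\sum_{i=1}^q \mathrm{nnz}(A_i)+d\,(k/\varepsilon)^{c_q}\Big)$$ with constants $C_q,c_q$ that depend only on $q$. Here $\mathrm{nnz}$ is the number of nonzero entries. Running time counts the operations of a randomized real RAM: registers and zero-initialized arrays of natural numbers and of reals; unit-cost addition, truncated subtraction and comparison of natural numbers; unit-cost $+,-,\times,/,\sqrt{\ }$ and comparison of reals; unit-cost conversion of a natural number to a real, array access, and uniform random choice from $\{0,\dots,N\}$; branches and while loops. There is no singular value decomposition among the operations. -/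

import Mathlib

open scoped ENNReal

noncomputable section

namespace KronLRA

/-! ### Kronecker products, low rank approximation and count-sketch -/

/-- The Kronecker product `A₁ ⊗ ⋯ ⊗ A_q`; its rows and columns are indexed by multi-indices. -/
def kron {q : ℕ} {n d : Fin q → ℕ} (A : ∀ i, Matrix (Fin (n i)) (Fin (d i)) ℝ) :
    Matrix (∀ i, Fin (n i)) (∀ i, Fin (d i)) ℝ :=
  Matrix.of fun x y => ∏ i, A i (x i) (y i)

/-- The Frobenius norm. -/
def frob {I J : Type*} [Fintype I] [Fintype J] (A : Matrix I J ℝ) : ℝ :=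
  Real.sqrt (∑ i, ∑ j, A i j ^ 2)

/-- `OPT_k`: the least Frobenius error of an approximation of `A` by a matrix of rank at most `k`. -/
def OPT {I J : Type*} [Fintype I] [Fintype J] (k : ℕ) (A : Matrix I J ℝ) : ℝ :=
  ⨅ A' : {A' : Matrix I J ℝ // A'.rank ≤ k}, frob (A'.1 - A)

/-- The number of nonzero entries. -/
def nnz {a b : ℕ} (A : Matrix (Fin a) (Fin b) ℝ) : ℕ :=
  Nat.card {p : Fin a × Fin b // A p.1 p.2 ≠ 0}

/-- The rows of `U` are right singular vectors of `M` for its `k` largest singular values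
(with multiplicity). -/
def IsTopRightSingular {I J : Type*} [Fintype I] [Fintype J] [DecidableEq J] {k : ℕ}
    (M : Matrix I J ℝ) (U : Matrix (Fin k) J ℝ) : Prop :=
  U * U.transpose = 1 ∧
    ∀ r : Fin k, (M.transpose * M).mulVec (U r)
      = (Matrix.toEuclideanLin M).singularValues (r : ℕ) ^ 2 • U r

/-- The random choices behind a count-sketch matrix with `m` rows and `n` columns:
for each column, the row of its nonzero entry and the sign of that entry. -/
abbrev Seed (m n : ℕ) : Type := Fin n → Fin m × Bool

/-- The count-sketch matrix of a seed; a uniformly random seed gives a random count-sketch. -/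
def countSketch {m n : ℕ} (s : Seed m n) : Matrix (Fin m) (Fin n) ℝ :=
  Matrix.of fun r c => if r = (s c).1 then (if (s c).2 then 1 else -1) else 0

/-! ### A randomized real RAM

Memory consists of natural-number and real registers, and of natural-number and real arrays that
are addressed by natural numbers. There is no unit-cost multiplication of natural numbers and no
conversion of reals to natural numbers. The constants in a program are natural numbers. -/

/-- Memory, together with the number of steps performed so far. -/
structure State where
  /-- natural-number registers -/
  nv : ℕ → ℕ
  /-- real registers -/
  rv : ℕ → ℝ
  /-- natural-number arrays -/
  na : ℕ → ℕ → ℕ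
  /-- real arrays -/
  ra : ℕ → ℕ → ℝ
  /-- elapsed time -/
  time : ℕ

/-- Natural-number expressions. -/
inductive NExp where
  | lit (c : ℕ)
  | var (x : ℕ)
  | get (a : ℕ) (i : NExp)
  | add (e f : NExp)
  | sub (e f : NExp)

def NExp.eval (s : State) : NExp → ℕ
  | .lit c => c
  | .var x => s.nv x
  | .get a i => s.na a (i.eval s)
  | .add e f => e.eval s + f.eval s
  | .sub e f => e.eval s - f.eval s

/-- The cost of an expression is its number of operations. -/
def NExp.cost : NExp → ℕ
  | .lit _ => 1
  | .var _ => 1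
  | .get _ i => i.cost + 1
  | .add e f => e.cost + f.cost + 1
  | .sub e f => e.cost + f.cost + 1

/-- Real expressions. -/
inductive RExp where
  | ofNat (e : NExp)
  | var (x : ℕ)
  | get (a : ℕ) (i : NExp)
  | add (e f : RExp)
  | sub (e f : RExp)
  | mul (e f : RExp)
  | div (e f : RExp)
  | sqrt (e : RExp)

def RExp.eval (s : State) : RExp → ℝ
  | .ofNat e => (e.eval s : ℝ)
  | .var x => s.rv x
  | .get a i => s.ra a (i.eval s)
  | .add e f => e.eval s + f.eval s
  | .sub e f => e.eval s - f.eval s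
  | .mul e f => e.eval s * f.eval s
  | .div e f => e.eval s / f.eval s
  | .sqrt e => Real.sqrt (e.eval s)

def RExp.cost : RExp → ℕ
  | .ofNat e => e.cost + 1
  | .var _ => 1
  | .get _ i => i.cost + 1
  | .add e f => e.cost + f.cost + 1
  | .sub e f => e.cost + f.cost + 1
  | .mul e f => e.cost + f.cost + 1
  | .div e f => e.cost + f.cost + 1
  | .sqrt e => e.cost + 1

/-- Tests for branches and loops. -/
inductive Test where
  | ltN (e f : NExp)
  | ltR (e f : RExp)
  | not (t : Test)
  | and (t u : Test)

open Classical in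
def Test.eval (s : State) : Test → Bool
  | .ltN e f => decide (e.eval s < f.eval s)
  | .ltR e f => decide (e.eval s < f.eval s)
  | .not t => !(t.eval s)
  | .and t u => t.eval s && u.eval s

def Test.cost : Test → ℕ
  | .ltN e f => e.cost + f.cost + 1
  | .ltR e f => e.cost + f.cost + 1
  | .not t => t.cost + 1
  | .and t u => t.cost + u.cost + 1

/-- Programs. -/
inductive Prog where
  | skip
  | setN (x : ℕ) (e : NExp)
  | setR (x : ℕ) (e : RExp)
  | putN (a : ℕ) (i e : NExp)
  | putR (a : ℕ) (i : NExp) (e : RExp)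
  /-- store in `x` a fresh uniformly random element of `{0, …, e}` -/
  | rand (x : ℕ) (e : NExp)
  | seq (p r : Prog)
  | ite (t : Test) (p r : Prog)
  | loop (t : Test) (p : Prog)

/-- Let `c` time units pass. -/
def State.tick (s : State) (c : ℕ) : State := { s with time := s.time + c }

/-- Run `g` after `f`; `none` stands for a run that was cut off. -/
def andThen (f : PMF (Option State)) (g : State → PMF (Option State)) : PMF (Option State) :=
  f.bind fun o => o.elim (PMF.pure none) g

/-- `while t do body`, cut off if it is not finished after fewer than `N` rounds. -/
def loopEval (t : Test) (body : State → PMF (Option State)) : ℕ → State → PMF (Option State)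
  | 0, _ => PMF.pure none
  | N + 1, s =>
    if t.eval s then andThen (body (s.tick (t.cost + 1))) (loopEval t body N)
    else PMF.pure (some (s.tick (t.cost + 1)))

/-- The law of the final state of a program started in a given state. A run in which some `while`
loop is not finished after fewer than `N` rounds is cut off and reported as `none`. -/
def Prog.eval (N : ℕ) : Prog → State → PMF (Option State)
  | .skip, s => PMF.pure (some (s.tick 1))
  | .setN x e, s =>
    PMF.pure (some ({ s with nv := Function.update s.nv x (e.eval s) }.tick (e.cost + 1)))
  | .setR x e, s =>
    PMF.pure (some ({ s with rv := Function.update s.rv x (e.eval s) }.tick (e.cost + 1)))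
  | .putN a i e, s =>
    PMF.pure (some ({ s with
      na := Function.update s.na a (Function.update (s.na a) (i.eval s) (e.eval s)) }.tick
        (i.cost + e.cost + 1)))
  | .putR a i e, s =>
    PMF.pure (some ({ s with
      ra := Function.update s.ra a (Function.update (s.ra a) (i.eval s) (e.eval s)) }.tick
        (i.cost + e.cost + 1)))
  | .rand x e, s =>
    (PMF.uniformOfFintype (Fin (e.eval s + 1))).map fun v =>
      some ({ s with nv := Function.update s.nv x (v : ℕ) }.tick (e.cost + 1))
  | .seq p r, s => andThen (p.eval N s) (r.eval N)
  | .ite t p r, s =>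
    if t.eval s then p.eval N (s.tick (t.cost + 1)) else r.eval N (s.tick (t.cost + 1))
  | .loop t p, s => loopEval t (p.eval N) N s

/-! ### Input and output -/

/-- A finite list as an array that is zero beyond its length. -/
def toArr {α : Type*} [Zero α] {l : ℕ} (f : Fin l → α) : ℕ → α :=
  fun t => if h : t < l then f ⟨t, h⟩ else 0

/-- An enumeration, in any order, of the positions of the nonzero entries of a matrix. -/
abbrev Enum {a b : ℕ} (A : Matrix (Fin a) (Fin b) ℝ) : Type :=
  Fin (nnz A) ≃ {p : Fin a × Fin b // A p.1 p.2 ≠ 0}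

/-- The initial state: register `0` holds `k`, real register `0` holds `ε`, and for `i < q`
registers `3i+1`, `3i+2`, `3i+3` hold `n i`, `d i` and `nnz (A i)`, natural-number arrays `2i`,
`2i+1` hold the row and column indices of the nonzero entries of `A i`, and real array `i` holds
their values. All other memory is zero. -/
def initial {q : ℕ} {n d : Fin q → ℕ} (k : ℕ) (ε : ℝ)
    (A : ∀ i, Matrix (Fin (n i)) (Fin (d i)) ℝ) (e : ∀ i, Enum (A i)) : State where
  nv x := match x with
    | 0 => k
    | x + 1 =>
      if x % 3 = 0 then toArr n (x / 3)
      else if x % 3 = 1 then toArr d (x / 3)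
      else toArr (fun i => nnz (A i)) (x / 3)
  rv x := if x = 0 then ε else 0
  na a :=
    if a % 2 = 0 then toArr (fun i => toArr fun t => ((e i t).1.1 : ℕ)) (a / 2)
    else toArr (fun i => toArr fun t => ((e i t).1.2 : ℕ)) (a / 2)
  ra a := toArr (fun i => toArr fun t => A i (e i t).1.1 (e i t).1.2) a
  time := 0

/-- The position of a multi-index in lexicographic order. -/
def flat {q : ℕ} {d : Fin q → ℕ} (j : ∀ i, Fin (d i)) : ℕ :=
  ∑ i, (j i : ℕ) * ∏ l ∈ Finset.Ioi i, d l

/-- The matrix `U` with `k` rows and `∏ d i` columns that is stored row by row in real array `q`;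
this is the output of a program. -/
def output {q : ℕ} (d : Fin q → ℕ) (k : ℕ) (s : State) : Matrix (Fin k) (∀ i, Fin (d i)) ℝ :=
  Matrix.of fun r j => s.ra q ((r : ℕ) * (∏ i, d i) + flat j)

end KronLRA

end

set_option linter.unusedSectionVars false
set_option linter.unusedSimpArgs false


/-! Write `S` for the Kronecker product of the count-sketches and `D = Sᵀ S - 1`. The cost of a
coisometry `V` with `k` rows is `‖A - A Vᵀ V‖²`. The sketch works because, for most seeds, it
preserves the costs of all such `V` at once up to a factor `1 ± ε/4` (`PreservesCost`); a nearly
optimal projection for `S A` is then nearly optimal for `A` (`frob_le_of_cost_preserved`).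

No net or union bound over `V` is needed. Let the columns of `U` be an orthonormal basis of the
column space of a best approximation of rank `k`, and let `R = A - U Uᵀ A`, so that `‖R‖ ≤ OPT_k`.
The error in the cost of `V` is `tr(Bᵀ D B)` with `B = A (1 - Vᵀ V)`. Splitting `B` along `U` bounds
it by four quantities that do not involve `V`: the norms of `Uᵀ D U`, `Uᵀ D R`, `Rᵀ D R` and the
trace of the last (`abs_trace_cost_le`). Each is controlled by its second moment and Markov's
inequality (`card_not_preservesCost_le`).

The second moments come from the covariances of the entries of `D`. For one count-sketch, the
covariance kernel is carried by the two nontrivial pairings of the four indices and has norm at most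
`2/m`. Expanding the product of the `q` kernels by telescoping gives `(1 + 2/m)^q - 1 ≤ 4q/m`, which
is linear in `q` (`kerBound_pi`, `momentBound_le`).

The algorithm replaces the singular value decomposition of `M = S A` by repeated squaring and
Gram–Schmidt. It forms `W = (M Mᵀ)^(2^σ) M` and orthogonalizes the rows of `W`, always taking a row
with the largest residual. Such pivoting finds the dominant eigenspace of `Wᵀ W` only up to a factor
`F` exponential in `k`. But the eigenvalues of `Wᵀ W` are the `T`-th powers of those of `Mᵀ M`, and
for these the factor `F` shrinks to a relative error of order `F/T` (`mul_sub_le_of_power`,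
`IsGreedy.frobSq_le`). Since `T` is exponential in `σ`, a `σ` that is linear in the dimensions, `k`
and `m` suffices. The squared matrices have size `m^q`, independent of `d`, so the time stays linear
in `d`.

For the machine, `Exec` is a triple with a time bound for deterministic programs, and `Law` one for
programs driven by a uniform tape. The tape has one cell per nonzero entry, and a nonzero row uses
the cell of its last occurrence (`exists_last_write`). So the input dimensions `n i` never enter the
running time, and the rows that matter are still hashed independently. Greedy runs produce
orthonormal rows on every tape; only cost preservation is random (`kronProgram_correct`). -/

namespace KronLRA

/-! ### Frobenius norms and orthogonal projections. -/

section LinearAlgebra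

open Matrix

variable {I J K L : Type*} [Fintype I] [Fintype J] [Fintype K] [Fintype L]

/-- The square of the Frobenius norm. -/
def frobSq (A : Matrix I J ℝ) : ℝ := ∑ i, ∑ j, A i j ^ 2

theorem frobSq_nonneg (A : Matrix I J ℝ) : 0 ≤ frobSq A :=
  Finset.sum_nonneg fun _ _ => Finset.sum_nonneg fun _ _ => sq_nonneg _

theorem frob_nonneg (A : Matrix I J ℝ) : 0 ≤ frob A := Real.sqrt_nonneg _

theorem frob_eq_sqrt (A : Matrix I J ℝ) : frob A = Real.sqrt (frobSq A) := rfl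

theorem frob_sq (A : Matrix I J ℝ) : frob A ^ 2 = frobSq A :=
  Real.sq_sqrt (frobSq_nonneg A)

theorem frobSq_eq_trace (A : Matrix I J ℝ) : frobSq A = trace (Aᵀ * A) := by
  simp only [frobSq, trace, diag, mul_apply, transpose_apply]
  rw [Finset.sum_comm]
  simp [sq]

theorem frobSq_transpose (A : Matrix I J ℝ) : frobSq Aᵀ = frobSq A := by
  simp only [frobSq, transpose_apply]
  rw [Finset.sum_comm]

theorem frob_transpose (A : Matrix I J ℝ) : frob Aᵀ = frob A := by
  rw [frob_eq_sqrt, frobSq_transpose, frob_eq_sqrt]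

theorem frobSq_neg (A : Matrix I J ℝ) : frobSq (-A) = frobSq A := by
  simp [frobSq]

theorem frob_sub_comm (A B : Matrix I J ℝ) : frob (A - B) = frob (B - A) := by
  rw [frob_eq_sqrt, ← neg_sub, frobSq_neg, frob_eq_sqrt]

theorem frobSq_eq_zero {A : Matrix I J ℝ} (h : frobSq A = 0) : A = 0 := by
  ext i j
  have h1 := (Finset.sum_eq_zero_iff_of_nonneg
    (fun i _ => Finset.sum_nonneg fun j _ => sq_nonneg (A i j))).1 h i (Finset.mem_univ _)
  have h2 := (Finset.sum_eq_zero_iff_of_nonneg (fun j _ => sq_nonneg (A i j))).1 h1 j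
    (Finset.mem_univ _)
  simpa using h2

theorem frobSq_mul_le (A : Matrix I J ℝ) (B : Matrix J K ℝ) :
    frobSq (A * B) ≤ frobSq A * frobSq B := by
  have h : ∀ i k, (A * B) i k ^ 2 ≤ (∑ j, A i j ^ 2) * ∑ j, B j k ^ 2 := fun i k => by
    rw [mul_apply]; exact Finset.sum_mul_sq_le_sq_mul_sq _ _ _
  calc frobSq (A * B) ≤ ∑ i, ∑ k, (∑ j, A i j ^ 2) * ∑ j, B j k ^ 2 :=
        Finset.sum_le_sum fun i _ => Finset.sum_le_sum fun k _ => h i k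
    _ = frobSq A * frobSq B := by
        rw [← frobSq_transpose B]
        simp only [frobSq, transpose_apply]
        rw [Finset.sum_mul_sum]

theorem frob_mul_le (A : Matrix I J ℝ) (B : Matrix J K ℝ) : frob (A * B) ≤ frob A * frob B := by
  rw [frob_eq_sqrt, frob_eq_sqrt, frob_eq_sqrt, ← Real.sqrt_mul (frobSq_nonneg A)]
  exact Real.sqrt_le_sqrt (frobSq_mul_le A B)

theorem abs_trace_mul_le (A B : Matrix I J ℝ) : |trace (Aᵀ * B)| ≤ frob A * frob B := by
  have h : trace (Aᵀ * B) = ∑ p : I × J, A p.1 p.2 * B p.1 p.2 := by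
    rw [Fintype.sum_prod_type_right]
    simp [trace, mul_apply]
  have h2 := Finset.sum_mul_sq_le_sq_mul_sq Finset.univ
    (fun p : I × J => A p.1 p.2) (fun p : I × J => B p.1 p.2)
  rw [Fintype.sum_prod_type, Fintype.sum_prod_type, Fintype.sum_prod_type] at h2
  rw [Fintype.sum_prod_type] at h
  rw [← h] at h2
  apply abs_le_of_sq_le_sq _ (mul_nonneg (frob_nonneg _) (frob_nonneg _))
  rw [mul_pow, frob_sq, frob_sq]
  exact h2

/-- Pythagoras for the projection onto the row space of `V`. -/
theorem frobSq_sub_proj [DecidableEq K] (A : Matrix I J ℝ) {V : Matrix K J ℝ} (hV : V * Vᵀ = 1) :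
    frobSq (A - A * Vᵀ * V) = frobSq A - frobSq (A * Vᵀ) := by
  have h1 : (A - A * Vᵀ * V)ᵀ * (A - A * Vᵀ * V)
      = Aᵀ * A - Aᵀ * A * Vᵀ * V - Vᵀ * (V * Aᵀ * A) + Vᵀ * (V * Aᵀ * A * Vᵀ * V) := by
    simp only [transpose_sub, transpose_mul, transpose_transpose, Matrix.sub_mul, Matrix.mul_sub,
      Matrix.mul_assoc]
    abel
  have h2 : trace (Vᵀ * (V * Aᵀ * A * Vᵀ * V)) = trace (Vᵀ * (V * Aᵀ * A)) := by
    rw [trace_mul_comm, trace_mul_comm Vᵀ, Matrix.mul_assoc _ V, hV, Matrix.mul_one]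
  have h3 : frobSq (A * Vᵀ) = trace (Aᵀ * A * Vᵀ * V) := by
    rw [frobSq_eq_trace, transpose_mul, transpose_transpose, trace_mul_comm (Aᵀ * A * Vᵀ)]
    simp only [Matrix.mul_assoc]
  rw [frobSq_eq_trace, h1, h3, trace_add, trace_sub, trace_sub, h2, frobSq_eq_trace]
  ring

theorem frobSq_mul_coisometry_le [DecidableEq K] (A : Matrix I J ℝ) {V : Matrix K J ℝ}
    (hV : V * Vᵀ = 1) : frobSq (A * Vᵀ) ≤ frobSq A := by
  linarith [frobSq_sub_proj A hV, frobSq_nonneg (A - A * Vᵀ * V)]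

theorem frobSq_coisometry [DecidableEq K] {V : Matrix K J ℝ} (hV : V * Vᵀ = 1) :
    frobSq V = Fintype.card K := by
  rw [← frobSq_transpose, frobSq_eq_trace, transpose_transpose, hV, trace_one]

/-- The matrix `P = Vᵀ V` is a symmetric idempotent, so `P j j = ∑ l, P j l ^ 2 ≥ P j j ^ 2`. This
makes the weights in Ky Fan's principle at most `1`. -/
theorem sum_sq_col_le_one [DecidableEq K] {V : Matrix K J ℝ} (hV : V * Vᵀ = 1) (j : J) :
    ∑ r, V r j ^ 2 ≤ 1 := by
  set P := Vᵀ * V with hP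
  have hPP : P * P = P := by
    rw [hP, Matrix.mul_assoc, ← Matrix.mul_assoc V, hV, Matrix.one_mul]
  have hPT : Pᵀ = P := by simp [hP]
  have hjj : P j j = ∑ r, V r j ^ 2 := by simp [hP, mul_apply, sq]
  have h1 : P j j = ∑ l, P j l ^ 2 := by
    conv_lhs => rw [← hPP, mul_apply]
    refine Finset.sum_congr rfl fun l _ => ?_
    rw [sq]; congr 1
    conv_lhs => rw [← hPT, transpose_apply]
  have h2 : P j j ^ 2 ≤ P j j := by
    conv_rhs => rw [h1]
    exact Finset.single_le_sum (f := fun l => P j l ^ 2) (fun l _ => sq_nonneg _)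
      (Finset.mem_univ j)
  rw [← hjj]
  nlinarith

end LinearAlgebra

/-! ### Singular values, Ky Fan's principle and the Eckart–Young theorem. -/

section Spectral

open Matrix

variable {I J K : Type*} [Fintype I] [Fintype J] [Fintype K] [DecidableEq J]

/-- The singular values of a matrix, in decreasing order. -/
noncomputable def sval (M : Matrix I J ℝ) (i : ℕ) : ℝ := (toEuclideanLin M).singularValues i

theorem sval_antitone (M : Matrix I J ℝ) : Antitone (sval M) :=
  LinearMap.singularValues_antitone _

theorem sval_nonneg (M : Matrix I J ℝ) (i : ℕ) : 0 ≤ sval M i :=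
  LinearMap.singularValues_nonneg _ _

theorem sq_sval_antitone (M : Matrix I J ℝ) : Antitone fun i => sval M i ^ 2 := fun _ _ h =>
  pow_le_pow_left₀ (sval_nonneg _ _) (sval_antitone M h) 2

theorem sval_eq_zero_of_card_le (M : Matrix I J ℝ) {i : ℕ} (h : Fintype.card J ≤ i) :
    sval M i = 0 :=
  LinearMap.singularValues_of_finrank_le _ (by simpa using h)

theorem sval_eq_zero_of_rank_le (M : Matrix I J ℝ) {i : ℕ} (h : M.rank ≤ i) : sval M i = 0 := by
  classical
  rw [sval, LinearMap.singularValues_eq_zero_iff_le_finrank_range]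
  rwa [M.rank_eq_finrank_range_toLin (EuclideanSpace.basisFun I ℝ).toBasis
    (EuclideanSpace.basisFun J ℝ).toBasis, ← toEuclideanLin_eq_toLin_orthonormal] at h

/-- The spectral theorem for `Mᵀ M`, with the eigenvectors as the rows of an orthogonal matrix. -/
theorem exists_spectral (M : Matrix I J ℝ) :
    ∃ X : Matrix (Fin (Fintype.card J)) J ℝ, X * Xᵀ = 1 ∧ Xᵀ * X = 1 ∧
      Mᵀ * M = Xᵀ * diagonal (fun i : Fin (Fintype.card J) => sval M i ^ 2) * X := by
  classical
  set T := toEuclideanLin M with hT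
  have hn : Module.finrank ℝ (EuclideanSpace ℝ J) = Fintype.card J := by simp
  set b := T.isSymmetric_adjoint_comp_self.eigenvectorBasis hn with hb
  set X : Matrix (Fin (Fintype.card J)) J ℝ := Matrix.of fun i j => b i j with hX
  have h1 : X * Xᵀ = 1 := by
    ext i j
    have := orthonormal_iff_ite.1 b.orthonormal j i
    rw [PiLp.inner_apply] at this
    simp only [RCLike.inner_apply, conj_trivial] at this
    rw [mul_apply]
    simp only [hX, of_apply, transpose_apply]
    rw [this, one_apply]
    simp [eq_comm]
  have hcard : Fintype.card (Fin (Fintype.card J)) = Fintype.card J := by simp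
  -- A one-sided inverse is two-sided only for square matrices over one index type, so the rows of
  -- `X` are first relabelled by `J`.
  have h2 : Xᵀ * X = 1 := by
    have e : Fin (Fintype.card J) ≃ J := (Fintype.equivFin J).symm
    have h3 : (X.submatrix e.symm id) * (X.submatrix e.symm id)ᵀ = 1 := by
      have h5 := submatrix_mul_equiv X Xᵀ e.symm (Equiv.refl J) e.symm
      rw [h1, submatrix_one_equiv] at h5
      exact h5
    have h4 := mul_eq_one_comm.1 h3
    rw [transpose_submatrix, submatrix_mul_equiv] at h4
    simpa using h4
  refine ⟨X, h1, h2, ?_⟩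
  have h5 : ∀ i, (Mᵀ * M) *ᵥ (X i) = sval M i ^ 2 • X i := fun i => by
    have := T.isSymmetric_adjoint_comp_self.apply_eigenvectorBasis hn i
    rw [← T.sq_singularValues_fin hn i, ← hb] at this
    have h6 : LinearMap.adjoint T = toEuclideanLin Mᵀ := by
      rw [hT, ← Matrix.toEuclideanLin_conjTranspose_eq_adjoint, conjTranspose_eq_transpose_of_trivial]
    rw [LinearMap.comp_apply, h6] at this
    have h7 := congrArg WithLp.ofLp this
    rw [ofLp_toLpLin, toLin'_apply, hT, ofLp_toLpLin, toLin'_apply, mulVec_mulVec] at h7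
    have h8 : X i = (b i).ofLp := rfl
    rw [h8]
    simpa [sval] using h7
  have h8 : Mᵀ * M * Xᵀ = Xᵀ * diagonal (fun i : Fin (Fintype.card J) => sval M i ^ 2) := by
    ext j i
    have := congrFun (h5 i) j
    rw [mul_diagonal, transpose_apply]
    rw [Pi.smul_apply, smul_eq_mul, mul_comm] at this
    rw [← this]
    rfl
  rw [← h8, Matrix.mul_assoc, h2, Matrix.mul_one]

/-- In eigencoordinates the captured mass is a weighted sum of eigenvalues, the weights being the
squared components of the rows of `V`. The eigenvalues are an arbitrary sequence so that the formula
also serves powers of the Gram matrix. -/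
theorem frobSq_mul_transpose_eq (M : Matrix I J ℝ) {n : ℕ} {l : ℕ → ℝ} {X : Matrix (Fin n) J ℝ}
    (hX : Mᵀ * M = Xᵀ * diagonal (fun i : Fin n => l i) * X) (V : Matrix K J ℝ) :
    frobSq (M * Vᵀ) = ∑ i : Fin n, l i * ∑ r, (V * Xᵀ) r i ^ 2 := by
  have h : (M * Vᵀ)ᵀ * (M * Vᵀ)
      = (V * Xᵀ) * diagonal (fun i : Fin n => l i) * (V * Xᵀ)ᵀ := by
    rw [transpose_mul, transpose_transpose, Matrix.mul_assoc, ← Matrix.mul_assoc Mᵀ, hX]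
    simp only [transpose_mul, transpose_transpose, Matrix.mul_assoc]
  rw [frobSq_eq_trace, h]
  have h' : ∀ r, ((V * Xᵀ) * diagonal (fun i : Fin n => l i)
      * (V * Xᵀ)ᵀ) r r = ∑ i : Fin n, l i * (V * Xᵀ) r i ^ 2 := fun r => by
    rw [mul_apply]
    refine Finset.sum_congr rfl fun i _ => ?_
    rw [mul_diagonal, transpose_apply]; ring
  simp only [trace, diag, h']
  rw [Finset.sum_comm]
  refine Finset.sum_congr rfl fun i _ => ?_
  rw [Finset.mul_sum]

/-- A weighted sum of a decreasing sequence with weights in `[0, 1]` of total at most `k`. -/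
theorem sum_mul_le_sum_range {n k : ℕ} {l : ℕ → ℝ} (hl : Antitone l) (h0 : ∀ i, 0 ≤ l i)
    {c : Fin n → ℝ} (hc0 : ∀ i, 0 ≤ c i) (hc1 : ∀ i, c i ≤ 1) (hc : ∑ i, c i ≤ k) :
    ∑ i : Fin n, l i * c i ≤ ∑ i ∈ Finset.range k, l i := by
  -- Extending by zero to `range (n + k)` treats `k ≤ n` and `k > n` together.
  set c' : ℕ → ℝ := fun i => if h : i < n then c ⟨i, h⟩ else 0 with hc'
  have e1 : ∑ i : Fin n, l i * c i = ∑ i ∈ Finset.range (n + k), l i * c' i := by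
    have : ∑ i ∈ Finset.range n, l i * c' i = ∑ i ∈ Finset.range (n + k), l i * c' i := by
      apply Finset.sum_subset (Finset.range_mono (by omega))
      intro i _ hi
      simp only [Finset.mem_range] at hi
      simp [hc', hi]
    rw [← this, Finset.sum_range]
    exact Finset.sum_congr rfl fun i _ => by simp [hc']
  have e2 : ∑ i : Fin n, c i = ∑ i ∈ Finset.range (n + k), c' i := by
    have : ∑ i ∈ Finset.range n, c' i = ∑ i ∈ Finset.range (n + k), c' i := by
      apply Finset.sum_subset (Finset.range_mono (by omega))
      intro i _ hi
      simp only [Finset.mem_range] at hi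
      simp [hc', hi]
    rw [← this, Finset.sum_range]
    exact Finset.sum_congr rfl fun i _ => by simp [hc']
  have e3 : ∀ f : ℕ → ℝ, ∑ i ∈ Finset.range k, f i
      = ∑ i ∈ Finset.range (n + k), f i * (if i < k then 1 else 0) := fun f => by
    have : ∑ i ∈ Finset.range k, f i * (if i < k then 1 else 0)
        = ∑ i ∈ Finset.range (n + k), f i * (if i < k then 1 else 0) := by
      apply Finset.sum_subset (Finset.range_mono (by omega))
      intro i _ hi
      simp only [Finset.mem_range] at hi
      simp [hi]
    rw [← this]
    exact Finset.sum_congr rfl fun i hi => by simp [Finset.mem_range.1 hi]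
  -- After subtracting `l k` the factors are nonnegative before `k` and nonpositive from `k` on, so
  -- replacing the weights by the indicator of `i < k` increases every term. The subtracted part
  -- only helps, since the total weight is at most `k`.
  have h1 : ∑ i ∈ Finset.range (n + k), (l i - l k) * c' i
      ≤ ∑ i ∈ Finset.range (n + k), (l i - l k) * (if i < k then 1 else 0) := by
    refine Finset.sum_le_sum fun i _ => ?_
    have hi0 : 0 ≤ c' i := by simp only [hc']; split_ifs; exacts [hc0 _, le_rfl]
    have hi1 : c' i ≤ 1 := by simp only [hc']; split_ifs; exacts [hc1 _, zero_le_one]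
    split_ifs with h
    · exact mul_le_mul_of_nonneg_left hi1 (sub_nonneg.2 (hl h.le))
    · have := hl (not_lt.1 h)
      nlinarith
  have h2 : l k * ∑ i : Fin n, c i ≤ l k * k := mul_le_mul_of_nonneg_left hc (h0 k)
  have h3 : (k : ℝ) = ∑ i ∈ Finset.range (n + k), (if i < k then 1 else 0 : ℝ) := by
    have := e3 (fun _ => 1)
    simpa using this
  rw [e1, e3]
  rw [e2, h3, Finset.mul_sum, Finset.mul_sum] at h2
  simp only [sub_mul, Finset.sum_sub_distrib] at h1
  linarith

theorem mul_transpose_coisometry {n : ℕ} [DecidableEq K] {X : Matrix (Fin n) J ℝ}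
    (hX : Xᵀ * X = 1) {V : Matrix K J ℝ} (hV : V * Vᵀ = 1) :
    (V * Xᵀ) * (V * Xᵀ)ᵀ = 1 := by
  rw [transpose_mul, transpose_transpose, Matrix.mul_assoc, ← Matrix.mul_assoc Xᵀ, hX,
    Matrix.one_mul, hV]

theorem sum_sum_sq_eq_card {n : ℕ} [DecidableEq K] {X : Matrix (Fin n) J ℝ}
    (hX : Xᵀ * X = 1) {V : Matrix K J ℝ} (hV : V * Vᵀ = 1) :
    ∑ i, ∑ r, (V * Xᵀ) r i ^ 2 = Fintype.card K := by
  rw [← frobSq_coisometry (mul_transpose_coisometry hX hV), frobSq, Finset.sum_comm]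

/-- Ky Fan's maximum principle, for a given spectral decomposition. -/
theorem frobSq_mul_le_sum [DecidableEq K] (M : Matrix I J ℝ) {n : ℕ} {l : ℕ → ℝ}
    {X : Matrix (Fin n) J ℝ} (hX : Mᵀ * M = Xᵀ * diagonal (fun i : Fin n => l i) * X)
    (hX1 : Xᵀ * X = 1) (hl : Antitone l) (hl0 : ∀ i, 0 ≤ l i) {k : ℕ} {V : Matrix K J ℝ}
    (hV : V * Vᵀ = 1) (hk : Fintype.card K ≤ k) :
    frobSq (M * Vᵀ) ≤ ∑ i ∈ Finset.range k, l i := by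
  rw [frobSq_mul_transpose_eq M hX V]
  refine sum_mul_le_sum_range hl hl0 (fun i => Finset.sum_nonneg fun _ _ => sq_nonneg _)
    (sum_sq_col_le_one (mul_transpose_coisometry hX1 hV)) ?_
  rw [sum_sum_sq_eq_card hX1 hV]
  exact_mod_cast hk

/-- Ky Fan's maximum principle. -/
theorem frobSq_mul_le_sum_sval [DecidableEq K] (M : Matrix I J ℝ) {k : ℕ} {V : Matrix K J ℝ}
    (hV : V * Vᵀ = 1) (hk : Fintype.card K ≤ k) :
    frobSq (M * Vᵀ) ≤ ∑ i ∈ Finset.range k, sval M i ^ 2 := by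
  obtain ⟨X, h1, h2, h3⟩ := exists_spectral M
  exact frobSq_mul_le_sum M (l := fun i => sval M i ^ 2) h3 h2 (sq_sval_antitone M)
    (fun i => sq_nonneg _) hV hk

theorem frobSq_eq_sum (M : Matrix I J ℝ) {n : ℕ} {l : ℕ → ℝ}
    {X : Matrix (Fin n) J ℝ} (hX : Mᵀ * M = Xᵀ * diagonal (fun i : Fin n => l i) * X)
    (hX1 : X * Xᵀ = 1) : frobSq M = ∑ i ∈ Finset.range n, l i := by
  have := frobSq_mul_transpose_eq M hX (1 : Matrix J J ℝ)
  rw [transpose_one, Matrix.mul_one, Matrix.one_mul] at this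
  rw [this, Finset.sum_range]
  refine Finset.sum_congr rfl fun i _ => ?_
  have h4 : ∑ r, Xᵀ r i ^ 2 = (X * Xᵀ) i i := by
    rw [mul_apply]
    exact Finset.sum_congr rfl fun r _ => by simp [sq]
  rw [h4, hX1, one_apply_eq, mul_one]

theorem frobSq_eq_sum_sval (M : Matrix I J ℝ) :
    frobSq M = ∑ i ∈ Finset.range (Fintype.card J), sval M i ^ 2 := by
  obtain ⟨X, h1, h2, h3⟩ := exists_spectral M
  exact frobSq_eq_sum M (l := fun i => sval M i ^ 2) h3 h1

theorem frobSq_mul_of_isTop {k : ℕ} {M : Matrix I J ℝ} {U : Matrix (Fin k) J ℝ}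
    (hU : IsTopRightSingular M U) :
    frobSq (M * Uᵀ) = ∑ i ∈ Finset.range k, sval M i ^ 2 := by
  rw [frobSq_eq_trace, Finset.sum_range, transpose_mul, transpose_transpose, Matrix.mul_assoc,
    ← Matrix.mul_assoc Mᵀ]
  refine Finset.sum_congr rfl fun r _ => ?_
  have h1 : (Mᵀ * M * Uᵀ).col r = sval M r ^ 2 • U r := hU.2 r
  have h2 : (U * (Mᵀ * M * Uᵀ)) r r = U r ⬝ᵥ ((Mᵀ * M * Uᵀ).col r) := rfl
  have h3 : U r ⬝ᵥ U r = 1 := by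
    have : (U * Uᵀ) r r = 1 := by rw [hU.1, one_apply_eq]
    exact this
  rw [diag_apply, h2, h1, dotProduct_smul, h3, smul_eq_mul, mul_one]

theorem exists_isTop (M : Matrix I J ℝ) {k : ℕ} (hk : k ≤ Fintype.card J) :
    ∃ U : Matrix (Fin k) J ℝ, IsTopRightSingular M U := by
  obtain ⟨X, h1, h2, h3⟩ := exists_spectral M
  refine ⟨X.submatrix (Fin.castLE hk) id, ?_, fun r => ?_⟩
  · ext a b
    have := congrFun (congrFun h1 (Fin.castLE hk a)) (Fin.castLE hk b)
    simp only [mul_apply, transpose_apply, submatrix_apply, id] at this ⊢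
    rw [this]
    simp [one_apply]
  · have h4 : Mᵀ * M * Xᵀ = Xᵀ * diagonal (fun i : Fin (Fintype.card J) => sval M i ^ 2) := by
      rw [h3, Matrix.mul_assoc, h1, Matrix.mul_one]
    ext j
    have := congrFun (congrFun h4 j) (Fin.castLE hk r)
    rw [mul_diagonal, transpose_apply, mul_comm] at this
    exact this

/-- No relation between `k` and the dimension is assumed: for larger `k` the extra singular values
are zero and the tail is empty. -/
theorem tail_eq (M : Matrix I J ℝ) (k : ℕ) :
    frobSq M - ∑ i ∈ Finset.range k, sval M i ^ 2
      = ∑ i ∈ Finset.Ico k (Fintype.card J), sval M i ^ 2 := by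
  rw [frobSq_eq_sum_sval]
  rcases le_total k (Fintype.card J) with h | h
  · rw [← Finset.sum_range_add_sum_Ico _ h]; ring
  · rw [Finset.Ico_eq_empty_of_le h, Finset.sum_empty, ← Finset.sum_range_add_sum_Ico _ h,
      Finset.sum_eq_zero (s := Finset.Ico _ _)]
    · ring
    · intro i hi
      rw [sval_eq_zero_of_card_le M (Finset.mem_Ico.1 hi).1]; norm_num

/-- An orthonormal basis of the row space. -/
theorem exists_row_basis (M : Matrix I J ℝ) :
    ∃ V : Matrix (Fin M.rank) J ℝ, V * Vᵀ = 1 ∧ M * Vᵀ * V = M := by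
  classical
  have hr : M.rank ≤ Fintype.card J := by
    simpa using M.rank_le_card_width
  obtain ⟨V, hV⟩ := exists_isTop M hr
  refine ⟨V, hV.1, ?_⟩
  -- Singular values beyond the rank vanish, so projecting onto the top right singular vectors, as
  -- many as the rank, loses nothing.
  have h1 := frobSq_sub_proj M hV.1
  rw [frobSq_mul_of_isTop hV, tail_eq, Finset.sum_eq_zero] at h1
  · exact (sub_eq_zero.1 (frobSq_eq_zero h1)).symm
  · intro i hi
    rw [sval_eq_zero_of_rank_le M (Finset.mem_Ico.1 hi).1]; norm_num

/-- The Eckart–Young theorem. -/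
theorem tail_le_frobSq_sub (M A' : Matrix I J ℝ) {k : ℕ} (hA : A'.rank ≤ k) :
    frobSq M - ∑ i ∈ Finset.range k, sval M i ^ 2 ≤ frobSq (A' - M) := by
  obtain ⟨V, h1, h2⟩ := exists_row_basis A'
  have h3 := frobSq_mul_le_sum_sval M h1 (k := k) (by simpa using hA)
  have h4 := frobSq_sub_proj M h1
  have h5 := frobSq_sub_proj (A' - M) h1
  -- Projecting away from the row space of `A'` kills `A'`. Hence the error of `A'` is at least the
  -- error of the projection of `M` onto that space, which Ky Fan bounds below.
  have h6 : (A' - M) - (A' - M) * Vᵀ * V = -(M - M * Vᵀ * V) := by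
    rw [Matrix.sub_mul, Matrix.sub_mul, h2]; abel
  rw [h6, frobSq_neg] at h5
  linarith [frobSq_nonneg ((A' - M) * Vᵀ)]

theorem rank_mul_mul_le {I' J' : Type*} [Fintype J'] {k : ℕ} (A : Matrix I' J' ℝ)
    (U : Matrix (Fin k) J' ℝ) :
    (A * Uᵀ * U).rank ≤ k :=
  (rank_mul_le_right _ _).trans (by simpa using U.rank_le_card_height)

/-- The truncated singular value decomposition attains the Eckart–Young bound, so the infimum is a
minimum. -/
theorem OPT_eq (A : Matrix I J ℝ) {k : ℕ} {V : Matrix (Fin k) J ℝ} (hV : IsTopRightSingular A V) :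
    OPT k A = frob (A - A * Vᵀ * V) := by
  have h1 := frobSq_sub_proj A hV.1
  rw [frobSq_mul_of_isTop hV] at h1
  apply le_antisymm
  · rw [frob_sub_comm]
    exact ciInf_le (f := fun A' : {A' : Matrix I J ℝ // A'.rank ≤ k} => frob (A'.1 - A))
      ⟨0, by rintro _ ⟨a, rfl⟩; exact frob_nonneg _⟩ ⟨_, rank_mul_mul_le A V⟩
  · have : Nonempty {A' : Matrix I J ℝ // A'.rank ≤ k} := ⟨⟨0, by simp⟩⟩
    refine le_ciInf fun A' => ?_
    rw [frob_eq_sqrt, frob_eq_sqrt, h1]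
    exact Real.sqrt_le_sqrt (tail_le_frobSq_sub A A'.1 A'.2)

end Spectral

/-! ### Projection costs under a sketch: deterministic estimates. -/

section CostPreservation

open Matrix

variable {I J K L : Type*} [Fintype I] [Fintype J] [Fintype K] [Fintype L]

/-- If `D = Sᵀ S - 1` is small on the pieces of `A = U Uᵀ A + R`, then `S` preserves the cost of
the projection onto the row space of `V`, up to a factor `1 ± 5 η`. -/
theorem abs_trace_cost_le [DecidableEq K] [DecidableEq L] (D : Matrix I I ℝ) (hD : Dᵀ = D) (A : Matrix I J ℝ)
    {U : Matrix I L ℝ} (hU : Uᵀ * U = 1) {V : Matrix K J ℝ} (hV : V * Vᵀ = 1)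
    {η f g κ : ℝ} (hη : 0 ≤ η) (hf : 0 ≤ f) (hfg : f ≤ g) (hκ : Real.sqrt (Fintype.card K) ≤ κ)
    (hg : frob (A - A * Vᵀ * V) = g)
    (h1 : frob (Uᵀ * D * U) ≤ η) (h2 : frob (Uᵀ * D * (A - U * (Uᵀ * A))) ≤ η * f)
    (h3 : frob ((A - U * (Uᵀ * A))ᵀ * D * (A - U * (Uᵀ * A))) * κ ≤ η * f ^ 2)
    (h4 : |trace ((A - U * (Uᵀ * A))ᵀ * D * (A - U * (Uᵀ * A)))| ≤ η * f ^ 2) :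
    |trace ((A - A * Vᵀ * V)ᵀ * D * (A - A * Vᵀ * V))| ≤ 5 * η * g ^ 2 := by
  set R := A - U * (Uᵀ * A) with hR
  set Z := Rᵀ * D * R with hZ
  set B := A - A * Vᵀ * V with hB
  set X := Uᵀ * B with hX
  set Q := R - R * Vᵀ * V with hQ
  have hg0 : 0 ≤ g := hf.trans hfg
  -- The part of `B` orthogonal to the columns of `U` is `Q = R (1 - Vᵀ V)`. The quadratic form in
  -- `D` thus splits into a `U`-`U` term, twice a mixed term and a `Q`-`Q` term, which contribute
  -- `1`, `2` and `2` to the constant `5`.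
  have eB : B = U * X + Q := by
    rw [hX, hQ, hB, hR]
    simp only [Matrix.mul_sub, Matrix.sub_mul, Matrix.mul_assoc]
    abel
  have hXg : frob X ≤ g := by
    rw [← hg, ← frob_transpose X, hX, transpose_mul, transpose_transpose, frob_eq_sqrt,
      frob_eq_sqrt]
    apply Real.sqrt_le_sqrt
    have := frobSq_mul_coisometry_le Bᵀ (V := Uᵀ) (by rwa [transpose_transpose])
    rwa [transpose_transpose, frobSq_transpose] at this
  have e1 : trace (Bᵀ * D * B) = trace (Xᵀ * (Uᵀ * D * U * X)) + 2 * trace (Xᵀ * (Uᵀ * D * Q))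
      + trace (Qᵀ * D * Q) := by
    have e2 : trace (Qᵀ * D * U * X) = trace (Xᵀ * (Uᵀ * D * Q)) := by
      rw [← trace_transpose]
      simp only [transpose_mul, transpose_transpose, hD, Matrix.mul_assoc]
    rw [eB]
    have e3 : (U * X + Q)ᵀ * D * (U * X + Q) = Xᵀ * (Uᵀ * D * U * X) + Xᵀ * (Uᵀ * D * Q)
        + Qᵀ * D * U * X + Qᵀ * D * Q := by
      simp only [transpose_add, transpose_mul, Matrix.add_mul, Matrix.mul_add, Matrix.mul_assoc]
      abel
    rw [e3, trace_add, trace_add, trace_add, e2]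
    ring
  have b1 : |trace (Xᵀ * (Uᵀ * D * U * X))| ≤ η * g ^ 2 := by
    calc _ ≤ frob X * frob (Uᵀ * D * U * X) := abs_trace_mul_le _ _
      _ ≤ g * (η * g) := by
        refine mul_le_mul hXg ((frob_mul_le _ _).trans ?_) (frob_nonneg _) hg0
        exact mul_le_mul h1 hXg (frob_nonneg _) hη
      _ = η * g ^ 2 := by ring
  have b2 : |trace (Xᵀ * (Uᵀ * D * Q))| ≤ η * g ^ 2 := by
    have e4 : Uᵀ * D * Q = Uᵀ * D * R - Uᵀ * D * R * Vᵀ * V := by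
      rw [hQ]; simp only [Matrix.mul_sub, Matrix.mul_assoc]
    have e5 : frob (Uᵀ * D * Q) ≤ frob (Uᵀ * D * R) := by
      rw [e4, frob_eq_sqrt, frob_eq_sqrt]
      apply Real.sqrt_le_sqrt
      rw [frobSq_sub_proj _ hV]
      linarith [frobSq_nonneg (Uᵀ * D * R * Vᵀ)]
    calc _ ≤ frob X * frob (Uᵀ * D * Q) := abs_trace_mul_le _ _
      _ ≤ g * (η * f) := mul_le_mul hXg (e5.trans h2) (frob_nonneg _) hg0
      _ ≤ g * (η * g) := by gcongr
      _ = η * g ^ 2 := by ring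
  have b3 : |trace (Qᵀ * D * Q)| ≤ 2 * (η * g ^ 2) := by
    -- The unprojected trace is controlled by its own hypothesis. Only the correction involves `V`,
    -- and Cauchy–Schwarz bounds it by `‖Z‖ ‖V‖` with `‖V‖ = √(card K)`; this is the reason for the
    -- factor `κ` in `h3`.
    have e6 : trace (Qᵀ * D * Q) = trace Z - trace ((Z * Vᵀ)ᵀ * Vᵀ) := by
      have e7 : Qᵀ * D * Q = Z - Z * Vᵀ * V - Vᵀ * (V * Z) + Vᵀ * (V * Z * Vᵀ * V) := by
        rw [hQ, hZ]
        simp only [transpose_sub, transpose_mul, transpose_transpose, Matrix.sub_mul,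
          Matrix.mul_sub, Matrix.mul_assoc]
        abel
      have e8 : trace (Vᵀ * (V * Z * Vᵀ * V)) = trace (Vᵀ * (V * Z)) := by
        rw [trace_mul_comm, trace_mul_comm Vᵀ, Matrix.mul_assoc _ V, hV, Matrix.mul_one]
      have e9 : trace ((Z * Vᵀ)ᵀ * Vᵀ) = trace (Z * Vᵀ * V) := by
        rw [← trace_transpose, transpose_mul, transpose_transpose, transpose_transpose,
          trace_mul_comm]
      rw [e7, trace_add, trace_sub, trace_sub, e8, e9]
      ring
    have e10 : |trace ((Z * Vᵀ)ᵀ * Vᵀ)| ≤ η * f ^ 2 := by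
      have hVf : frob V ≤ κ := by
        rw [frob_eq_sqrt, frobSq_coisometry hV]; exact hκ
      calc _ ≤ frob (Z * Vᵀ) * frob Vᵀ := abs_trace_mul_le _ _
        _ ≤ frob Z * κ := by
          rw [frob_transpose]
          refine mul_le_mul ?_ hVf (frob_nonneg _) (frob_nonneg _)
          rw [frob_eq_sqrt, frob_eq_sqrt]
          exact Real.sqrt_le_sqrt (frobSq_mul_coisometry_le Z hV)
        _ ≤ _ := h3
    have hfg2 : η * f ^ 2 ≤ η * g ^ 2 := by gcongr
    rw [e6]
    calc _ ≤ |trace Z| + |trace ((Z * Vᵀ)ᵀ * Vᵀ)| := abs_sub _ _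
      _ ≤ _ := by linarith
  rw [e1]
  have t1 := abs_add_le (trace (Xᵀ * (Uᵀ * D * U * X)) + 2 * trace (Xᵀ * (Uᵀ * D * Q)))
    (trace (Qᵀ * D * Q))
  have t2 := abs_add_le (trace (Xᵀ * (Uᵀ * D * U * X))) (2 * trace (Xᵀ * (Uᵀ * D * Q)))
  rw [abs_mul, abs_two] at t2
  linarith

/-- An approximately optimal projection for a cost preserving sketch is approximately optimal. -/
theorem frob_le_of_cost_preserved [DecidableEq J] {A : Matrix I J ℝ} {M : Matrix K J ℝ} {k : ℕ}
    {x : ℝ} (hx0 : 0 < x) (hx1 : x < 1 / 4) {U V : Matrix (Fin k) J ℝ}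
    (hV : IsTopRightSingular A V) (hU : U * Uᵀ = 1)
    (hc : ∀ W : Matrix (Fin k) J ℝ, W * Wᵀ = 1 →
      |frobSq (M - M * Wᵀ * W) - frobSq (A - A * Wᵀ * W)| ≤ x * frobSq (A - A * Wᵀ * W))
    (hM : frobSq (M - M * Uᵀ * U)
      ≤ (1 + x) * (frobSq M - ∑ i ∈ Finset.range k, sval M i ^ 2)) :
    frob (A * Uᵀ * U - A) ≤ (1 + 4 * x) * OPT k A := by
  rw [OPT_eq A hV, frob_sub_comm]
  have h1 := (abs_le.1 (hc U hU)).1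
  have h2 := (abs_le.1 (hc V hV.1)).2
  have h3 := frobSq_sub_proj M hV.1
  have h4 := frobSq_mul_le_sum_sval M hV.1 (k := k) (by simp)
  have h5 : frobSq (A - A * Uᵀ * U) ≤ (1 + 4 * x) ^ 2 * frobSq (A - A * Vᵀ * V) := by
    have hb := frobSq_nonneg (A - A * Vᵀ * V)
    -- One factor `1 + x` is the inexact optimality of `U` for `M`; the other, together with `1 -
    -- x`, is the passage between the costs for `A` and for `M`.
    have h6 : (1 - x) * frobSq (A - A * Uᵀ * U) ≤ (1 + x) ^ 2 * frobSq (A - A * Vᵀ * V) := by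
      have : (1 + x) * (frobSq M - ∑ i ∈ Finset.range k, sval M i ^ 2)
          ≤ (1 + x) * ((1 + x) * frobSq (A - A * Vᵀ * V)) := by
        apply mul_le_mul_of_nonneg_left _ (by linarith)
        linarith
      linarith
    -- The constant `4` is what makes this hold on `0 < x < 1/4`; it explains the choice `x = ε/4`
    -- later.
    have h7 : (1 + x) ^ 2 ≤ (1 - x) * (1 + 4 * x) ^ 2 := by nlinarith [mul_pos hx0 hx0]
    have h8 := mul_le_mul_of_nonneg_right h7 hb
    have h9 : (1 - x) * frobSq (A - A * Uᵀ * U)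
        ≤ (1 - x) * ((1 + 4 * x) ^ 2 * frobSq (A - A * Vᵀ * V)) := by linarith
    exact le_of_mul_le_mul_left h9 (by linarith)
  rw [frob_eq_sqrt, frob_eq_sqrt, ← Real.sqrt_sq (show 0 ≤ 1 + 4 * x by linarith),
    ← Real.sqrt_mul (sq_nonneg _)]
  exact Real.sqrt_le_sqrt h5

end CostPreservation

end KronLRA


namespace KronLRA

/-! ### Averages over finite types and Markov's inequality. -/

section Averages

/-- The average of a function on a finite type. -/
noncomputable def avg {Ω : Type*} [Fintype Ω] (f : Ω → ℝ) : ℝ := (∑ ω, f ω) / Fintype.card Ω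

variable {Ω : Type*} [Fintype Ω]

theorem avg_sum {ι : Type*} (s : Finset ι) (f : ι → Ω → ℝ) :
    avg (fun ω => ∑ i ∈ s, f i ω) = ∑ i ∈ s, avg (f i) := by
  simp only [avg]
  rw [Finset.sum_comm, Finset.sum_div]

theorem avg_mul_left (c : ℝ) (f : Ω → ℝ) : avg (fun ω => c * f ω) = c * avg f := by
  simp only [avg]
  rw [← Finset.mul_sum, mul_div_assoc]

theorem avg_sub (f g : Ω → ℝ) : avg (fun ω => f ω - g ω) = avg f - avg g := by
  simp only [avg]
  rw [Finset.sum_sub_distrib, sub_div]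

theorem avg_add (f g : Ω → ℝ) : avg (fun ω => f ω + g ω) = avg f + avg g := by
  simp only [avg]
  rw [Finset.sum_add_distrib, add_div]

theorem avg_const [Nonempty Ω] (c : ℝ) : avg (fun _ : Ω => c) = c := by
  simp [avg]

theorem avg_mono {f g : Ω → ℝ} (h : ∀ ω, f ω ≤ g ω) : avg f ≤ avg g :=
  div_le_div_of_nonneg_right (Finset.sum_le_sum fun ω _ => h ω) (Nat.cast_nonneg _)

theorem avg_comp_equiv (e : Ω ≃ Ω) (f : Ω → ℝ) : avg (fun ω => f (e ω)) = avg f := by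
  simp only [avg]
  rw [Equiv.sum_comp e f]

/-- This is the independence of the factors' sketches. -/
theorem avg_prod {q : ℕ} {S : Fin q → Type*} [∀ i, Fintype (S i)] (f : ∀ i, S i → ℝ) :
    avg (fun s : ∀ i, S i => ∏ i, f i (s i)) = ∏ i, avg (f i) := by
  simp only [avg]
  rw [Finset.prod_div_distrib, Fintype.card_pi, Nat.cast_prod]
  congr 1
  rw [Finset.prod_univ_sum, Fintype.piFinset_univ]

/-- Markov's inequality. -/
theorem card_gt_le [Nonempty Ω] {X : Ω → ℝ} (hX : ∀ ω, 0 ≤ X ω) {b c : ℝ} (hc : 0 < c)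
    (h : avg X ≤ b) :
    (Nat.card {ω // c * b < X ω} : ℝ) ≤ Fintype.card Ω / c := by
  classical
  have hn : (0 : ℝ) < Fintype.card Ω := by exact_mod_cast Fintype.card_pos
  have hsum : ∑ ω, X ω ≤ b * Fintype.card Ω := by
    rwa [avg, div_le_iff₀ hn] at h
  have hcard : Nat.card {ω // c * b < X ω} = (Finset.univ.filter fun ω => c * b < X ω).card := by
    rw [Nat.card_eq_fintype_card, Fintype.card_subtype]
  rw [hcard]
  have h1 : ∑ ω ∈ Finset.univ.filter (fun ω => c * b < X ω), X ω ≤ ∑ ω, X ω :=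
    Finset.sum_le_sum_of_subset_of_nonneg (Finset.filter_subset _ _) fun ω _ _ => hX ω
  have h2 : ((Finset.univ.filter fun ω => c * b < X ω).card : ℝ) * (c * b)
      ≤ ∑ ω ∈ Finset.univ.filter (fun ω => c * b < X ω), X ω := by
    rw [← nsmul_eq_mul]
    exact Finset.card_nsmul_le_sum _ _ _ fun ω hω => (Finset.mem_filter.1 hω).2.le
  have hb : 0 ≤ b := by
    have : 0 ≤ avg X := div_nonneg (Finset.sum_nonneg fun ω _ => hX ω) hn.le
    linarith
  -- If the bound is zero, `X` vanishes identically and the strict inequality never holds. This case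
  -- occurs, for instance, when the residual `R` is zero.
  rcases hb.eq_or_lt with hb | hb
  · have h3 : ∑ ω, X ω = 0 := le_antisymm (by rw [← hb] at hsum; linarith)
      (Finset.sum_nonneg fun ω _ => hX ω)
    rw [Finset.sum_eq_zero_iff_of_nonneg fun ω _ => hX ω] at h3
    have : (Finset.univ.filter fun ω => c * b < X ω) = ∅ := by
      ext ω
      simp [← hb, h3 ω]
    rw [this]
    simp only [Finset.card_empty, Nat.cast_zero]
    positivity
  · rw [le_div_iff₀ hc]
    have : ((Finset.univ.filter fun ω => c * b < X ω).card : ℝ) * c * b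
      ≤ Fintype.card Ω * b := by linarith
    exact le_of_mul_le_mul_right this hb

theorem toOuterMeasure_uniform_ge [Nonempty Ω] {S : Set Ω}
    (h : (Nat.card {ω // ω ∉ S} : ℝ) ≤ Fintype.card Ω / 10) :
    9 / 10 ≤ (PMF.uniformOfFintype Ω).toOuterMeasure S := by
  classical
  rw [PMF.toOuterMeasure_uniformOfFintype_apply]
  have hn : 0 < Fintype.card Ω := Fintype.card_pos
  have h1 : Fintype.card S + Nat.card {ω // ω ∉ S} = Fintype.card Ω := by
    rw [Nat.card_eq_fintype_card, ← Fintype.card_sum]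
    exact Fintype.card_congr (Equiv.sumCompl (· ∈ S))
  have h2 : 9 * Fintype.card Ω ≤ 10 * Fintype.card S := by
    have : (9 * Fintype.card Ω : ℝ) ≤ 10 * Fintype.card S := by
      have : (Fintype.card S : ℝ) + Nat.card {ω // ω ∉ S} = Fintype.card Ω := by exact_mod_cast h1
      linarith
    exact_mod_cast this
  rw [ENNReal.le_div_iff_mul_le (Or.inl (by exact_mod_cast hn.ne')) (Or.inl (by simp)),
    mul_comm, ← mul_div_assoc, ENNReal.div_le_iff_le_mul (Or.inl (by simp)) (Or.inl (by simp)),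
    mul_comm, mul_comm (Fintype.card S : ℝ≥0∞)]
  exact_mod_cast h2

end Averages

/-! ### First moments and collisions of one count-sketch. -/

section SingleSketch

open Matrix

variable {m n : ℕ}

/-- The Gram matrix of a count-sketch. -/
def gram (s : Seed m n) : Matrix (Fin n) (Fin n) ℝ := (countSketch s)ᵀ * countSketch s

/-- The sign of a column of a count-sketch. -/
def sgn (b : Bool) : ℝ := if b then 1 else -1

theorem sgn_mul_self (b : Bool) : sgn b * sgn b = 1 := by cases b <;> simp [sgn]

theorem sgn_not (b : Bool) : sgn (!b) = -sgn b := by cases b <;> simp [sgn]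

theorem gram_apply (s : Seed m n) (a b : Fin n) :
    gram s a b = sgn (s a).2 * sgn (s b).2 * if (s a).1 = (s b).1 then 1 else 0 := by
  simp only [gram, mul_apply, transpose_apply, countSketch, of_apply, sgn]
  rw [Finset.sum_eq_single (s a).1]
  · by_cases h : (s a).1 = (s b).1 <;> simp [h]
  · intro r _ hr
    simp [hr]
  · simp

theorem gram_self (s : Seed m n) (a : Fin n) : gram s a a = 1 := by
  simp [gram_apply, sgn_mul_self]

/-- Flip the sign of one column. -/
def flipSign (c : Fin n) : Seed m n ≃ Seed m n :=
  Function.Involutive.toPerm (fun s => Function.update s c ((s c).1, !(s c).2)) fun s => by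
    funext i
    by_cases h : i = c
    · subst h; simp
    · simp [h]

theorem flipSign_same (c : Fin n) (s : Seed m n) : flipSign c s c = ((s c).1, !(s c).2) :=
  Function.update_self _ _ _

theorem flipSign_of_ne {c i : Fin n} (h : i ≠ c) (s : Seed m n) : flipSign c s i = s i :=
  Function.update_of_ne h _ _

theorem gram_flipSign_left {a b : Fin n} (h : a ≠ b) (s : Seed m n) :
    gram (flipSign a s) a b = -gram s a b := by
  rw [gram_apply, gram_apply, flipSign_same, flipSign_of_ne h.symm, sgn_not]
  ring

theorem gram_comm (s : Seed m n) (a b : Fin n) : gram s a b = gram s b a := by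
  rw [gram_apply, gram_apply, mul_comm (sgn (s a).2)]
  simp [eq_comm]

theorem gram_flipSign_of_ne {c a b : Fin n} (ha : a ≠ c) (hb : b ≠ c) (s : Seed m n) :
    gram (flipSign c s) a b = gram s a b := by
  rw [gram_apply, gram_apply, flipSign_of_ne ha, flipSign_of_ne hb]

/-- Flipping one sign permutes the seeds, so the average equals its own negative. All vanishing
moments are obtained in this way. -/
theorem avg_eq_zero_of_flip (c : Fin n) {f : Seed m n → ℝ} (h : ∀ s, f (flipSign c s) = -f s) :
    avg f = 0 := by
  have h1 := avg_comp_equiv (flipSign c) f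
  simp only [h] at h1
  have h2 : avg (fun s => -f s) = -avg f := by
    have := avg_mul_left (-1) f
    simpa using this
  linarith

variable [NeZero m]

theorem avg_gram (a b : Fin n) : avg (fun s : Seed m n => gram s a b) = if a = b then 1 else 0 := by
  split_ifs with h
  · subst h
    simp only [gram_self]
    exact avg_const _
  · exact avg_eq_zero_of_flip a fun s => gram_flipSign_left h s

/-- Shift the row of one column. -/
def shiftRow (c : Fin n) (r : Fin m) : Seed m n ≃ Seed m n where
  toFun s := Function.update s c ((s c).1 + r, (s c).2)
  invFun s := Function.update s c ((s c).1 - r, (s c).2)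
  left_inv s := by
    funext i
    by_cases h : i = c
    · subst h; simp
    · simp [h]
  right_inv s := by
    funext i
    by_cases h : i = c
    · subst h; simp
    · simp [h]

/-- Cyclic shifts of the row of column `a` preserve the uniform law, and for each seed exactly one
of the `m` shifts makes the rows agree. -/
theorem avg_collision {a b : Fin n} (h : a ≠ b) :
    avg (fun s : Seed m n => if (s a).1 = (s b).1 then (1 : ℝ) else 0) = 1 / m := by
  have h1 : ∀ r : Fin m, avg (fun s : Seed m n => if (s a).1 + r = (s b).1 then (1 : ℝ) else 0)
      = avg (fun s : Seed m n => if (s a).1 = (s b).1 then (1 : ℝ) else 0) := fun r => by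
    rw [← avg_comp_equiv (shiftRow a r) (fun s => if (s a).1 = (s b).1 then (1 : ℝ) else 0)]
    simp [shiftRow, h.symm]
  have h2 : ∑ r : Fin m, avg (fun s : Seed m n => if (s a).1 + r = (s b).1 then (1 : ℝ) else 0)
      = 1 := by
    rw [← avg_sum]
    have : ∀ s : Seed m n, ∑ r : Fin m, (if (s a).1 + r = (s b).1 then (1 : ℝ) else 0) = 1 :=
      fun s => by
        rw [Finset.sum_eq_single ((s b).1 - (s a).1)]
        · simp
        · intro r _ hr
          rw [if_neg]
          intro h3
          exact hr (by rw [← h3]; simp)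
        · simp
    simp only [this]
    exact avg_const _
  rw [Finset.sum_congr rfl fun r _ => h1 r, Finset.sum_const, Finset.card_univ, Fintype.card_fin,
    nsmul_eq_mul] at h2
  rw [eq_div_iff (by exact_mod_cast NeZero.ne m), mul_comm]
  exact h2

end SingleSketch

/-! ### Covariance kernels and their norms under tensor products. -/

section Kernels

/-- The kernel of the square of the expectation. -/
def diagKer {I : Type*} [DecidableEq I] (a b a' b' : I) : ℝ :=
  if a = b ∧ a' = b' then 1 else 0

/-- The indicator of the two nontrivial pairings, divided by `m`. -/
noncomputable def crossKer {I : Type*} [DecidableEq I] (m : ℕ) (a b a' b' : I) : ℝ :=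
  1 / m * ((if a = a' ∧ b = b' then 1 else 0) + (if a = b' ∧ b = a' then 1 else 0))

theorem diagKer_nonneg {I : Type*} [DecidableEq I] (a b a' b' : I) : 0 ≤ diagKer a b a' b' := by
  rw [diagKer]; split_ifs <;> norm_num

theorem crossKer_nonneg {I : Type*} [DecidableEq I] (m : ℕ) (a b a' b' : I) :
    0 ≤ crossKer m a b a' b' := by
  rw [crossKer]
  have : (0 : ℝ) ≤ 1 / m := by positivity
  refine mul_nonneg this (add_nonneg ?_ ?_) <;> split_ifs <;> norm_num

/-- An off-diagonal product survives averaging only if its signs cancel in pairs, and it is then a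
collision indicator of mean `1/m`. The lower bound is needed as well: it makes the covariance of a
tensor product nonnegative. -/
theorem avg_gram_mul_gram {m n : ℕ} [NeZero m] (a b a' b' : Fin n) :
    diagKer a b a' b' ≤ avg (fun s : Seed m n => gram s a b * gram s a' b') ∧
    avg (fun s : Seed m n => gram s a b * gram s a' b')
      ≤ diagKer a b a' b' + crossKer m a b a' b' := by
  have hm : (0 : ℝ) ≤ 1 / m := by positivity
  have key : ∀ e : ℝ, e = diagKer a b a' b' → diagKer a b a' b' ≤ e ∧
      e ≤ diagKer a b a' b' + crossKer m a b a' b' := fun e he =>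
    ⟨he.ge, by rw [he]; linarith [crossKer_nonneg m a b a' b']⟩
  by_cases h1 : a = b
  · apply key
    subst h1
    simp only [gram_self, one_mul, avg_gram, diagKer, true_and]
  by_cases h2 : a' = b'
  · apply key
    subst h2
    simp only [gram_self, mul_one, avg_gram, diagKer, and_true]
  have hd : diagKer a b a' b' = 0 := by simp [diagKer, h1]
  by_cases h3 : (a = a' ∧ b = b') ∨ (a = b' ∧ b = a')
  · have h4 : ∀ s : Seed m n, gram s a b * gram s a' b'
        = if (s a).1 = (s b).1 then (1 : ℝ) else 0 := fun s => by
      have h5 : gram s a' b' = gram s a b := by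
        rcases h3 with ⟨rfl, rfl⟩ | ⟨rfl, rfl⟩
        · rfl
        · exact gram_comm _ _ _
      rw [h5, gram_apply]
      split_ifs
      · have e1 := sgn_mul_self (s a).2
        have e2 := sgn_mul_self (s b).2
        linear_combination (sgn (s b).2 * sgn (s b).2) * e1 + e2
      · simp
    simp only [h4, avg_collision h1, hd, zero_add]
    refine ⟨hm, ?_⟩
    rw [crossKer]
    have : (1 : ℝ) ≤ (if a = a' ∧ b = b' then 1 else 0) + (if a = b' ∧ b = a' then 1 else 0) := by
      rcases h3 with h | h
      · rw [if_pos h]; split_ifs <;> norm_num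
      · rw [if_pos h]; split_ifs <;> norm_num
    nlinarith
  · apply key
    rw [hd]
    -- If `a` meets one of `a'`, `b'` but the pairs are different, then `b` occurs only once and its
    -- sign is flipped; otherwise `a` occurs only once.
    by_cases h5 : a = a' ∨ a = b'
    · have hb : a' ≠ b ∧ b' ≠ b := by
        constructor <;> rintro rfl <;> rcases h5 with rfl | rfl <;> simp_all
      refine avg_eq_zero_of_flip b fun s => ?_
      rw [gram_flipSign_of_ne hb.1 hb.2, gram_comm, gram_flipSign_left (Ne.symm h1), gram_comm s b]
      ring
    · push Not at h5
      refine avg_eq_zero_of_flip a fun s => ?_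
      rw [gram_flipSign_of_ne (Ne.symm h5.1) (Ne.symm h5.2), gram_flipSign_left h1]
      ring

/-- The Euclidean norm. -/
noncomputable def nrm {I : Type*} [Fintype I] (f : I → ℝ) : ℝ := Real.sqrt (∑ a, f a ^ 2)

theorem nrm_nonneg {I : Type*} [Fintype I] (f : I → ℝ) : 0 ≤ nrm f := Real.sqrt_nonneg _

theorem nrm_sq {I : Type*} [Fintype I] (f : I → ℝ) : nrm f ^ 2 = ∑ a, f a ^ 2 :=
  Real.sq_sqrt (Finset.sum_nonneg fun _ _ => sq_nonneg _)

theorem sum_mul_le_nrm {I : Type*} [Fintype I] (f g : I → ℝ) :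
    ∑ a, f a * g a ≤ nrm f * nrm g :=
  Real.sum_mul_le_sqrt_mul_sqrt _ _ _

/-- The kernel `κ` defines a form in four variables of norm at most `C` on nonnegative functions. -/
def KerBound {I : Type*} [Fintype I] (κ : I → I → I → I → ℝ) (C : ℝ) : Prop :=
  ∀ f g f' g' : I → ℝ, (∀ a, 0 ≤ f a) → (∀ a, 0 ≤ g a) → (∀ a, 0 ≤ f' a) → (∀ a, 0 ≤ g' a) →
    ∑ a, ∑ b, ∑ a', ∑ b', κ a b a' b' * (f a * g b * f' a' * g' b')
      ≤ C * (nrm f * nrm g * nrm f' * nrm g')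

variable {I J : Type*} [Fintype I] [Fintype J]

theorem KerBound.add {κ₁ κ₂ : I → I → I → I → ℝ} {C₁ C₂ : ℝ} (h₁ : KerBound κ₁ C₁)
    (h₂ : KerBound κ₂ C₂) :
    KerBound (fun a b a' b' => κ₁ a b a' b' + κ₂ a b a' b') (C₁ + C₂) := by
  intro f g f' g' hf hg hf' hg'
  simp only [add_mul, Finset.sum_add_distrib]
  exact add_le_add (h₁ f g f' g' hf hg hf' hg') (h₂ f g f' g' hf hg hf' hg')

theorem KerBound.smul {κ : I → I → I → I → ℝ} {C c : ℝ} (h : KerBound κ C) (hc : 0 ≤ c) :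
    KerBound (fun a b a' b' => c * κ a b a' b') (c * C) := by
  intro f g f' g' hf hg hf' hg'
  simp only [mul_assoc c, ← Finset.mul_sum]
  exact mul_le_mul_of_nonneg_left (h f g f' g' hf hg hf' hg') hc

theorem kerBound_diag [DecidableEq I] : KerBound (diagKer (I := I)) 1 := by
  intro f g f' g' hf hg hf' hg'
  have e : ∑ a, ∑ b, ∑ a', ∑ b', diagKer a b a' b' * (f a * g b * f' a' * g' b')
      = (∑ a, f a * g a) * ∑ a', f' a' * g' a' := by
    simp only [diagKer, ite_and, ite_mul, one_mul, zero_mul]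
    simp [Finset.sum_mul_sum, mul_assoc]
  rw [e, one_mul, mul_assoc (nrm f * nrm g)]
  refine mul_le_mul (sum_mul_le_nrm f g) (sum_mul_le_nrm f' g') ?_
    (mul_nonneg (nrm_nonneg _) (nrm_nonneg _))
  exact Finset.sum_nonneg fun a _ => mul_nonneg (hf' a) (hg' a)

theorem kerBound_pair₁ [DecidableEq I] :
    KerBound (fun a b a' b' : I => if a = a' ∧ b = b' then (1 : ℝ) else 0) 1 := by
  intro f g f' g' hf hg hf' hg'
  have e : ∑ a, ∑ b, ∑ a', ∑ b', (if a = a' ∧ b = b' then (1 : ℝ) else 0)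
      * (f a * g b * f' a' * g' b') = (∑ a, f a * f' a) * ∑ b, g b * g' b := by
    simp only [ite_and, ite_mul, one_mul, zero_mul]
    simp only [Finset.sum_ite_eq, Finset.mem_univ, if_true, Finset.sum_ite_irrel,
      Finset.sum_const_zero]
    rw [Finset.sum_mul_sum]
    exact Finset.sum_congr rfl fun a _ => Finset.sum_congr rfl fun b _ => by ring
  rw [e, one_mul]
  calc _ ≤ (nrm f * nrm f') * (nrm g * nrm g') :=
        mul_le_mul (sum_mul_le_nrm f f') (sum_mul_le_nrm g g')
          (Finset.sum_nonneg fun a _ => mul_nonneg (hg a) (hg' a))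
          (mul_nonneg (nrm_nonneg _) (nrm_nonneg _))
    _ = _ := by ring

theorem kerBound_pair₂ [DecidableEq I] :
    KerBound (fun a b a' b' : I => if a = b' ∧ b = a' then (1 : ℝ) else 0) 1 := by
  intro f g f' g' hf hg hf' hg'
  have h := kerBound_pair₁ f g g' f' hf hg hg' hf'
  calc _ = ∑ a, ∑ b, ∑ a', ∑ b', (if a = a' ∧ b = b' then (1 : ℝ) else 0)
      * (f a * g b * g' a' * f' b') := by
        refine Finset.sum_congr rfl fun a _ => Finset.sum_congr rfl fun b _ => ?_
        rw [Finset.sum_comm]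
        exact Finset.sum_congr rfl fun a' _ => Finset.sum_congr rfl fun b' _ => by ring
    _ ≤ _ := h
    _ = _ := by ring

theorem kerBound_cross [DecidableEq I] (m : ℕ) : KerBound (crossKer (I := I) m) (2 / m) := by
  have h := (kerBound_pair₁.add (kerBound_pair₂ (I := I))).smul (c := 1 / m) (by positivity)
  have e : (1 / m : ℝ) * (1 + 1) = 2 / m := by ring
  rw [e] at h
  exact h

theorem nrm_nrm (F : I × J → ℝ) : nrm (fun a => nrm fun b => F (a, b)) = nrm F := by
  rw [nrm, nrm]
  congr 1
  rw [Fintype.sum_prod_type]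
  exact Finset.sum_congr rfl fun a _ => nrm_sq _

/-- For fixed outer indices the bound for `κ₂` applies to slices and leaves their norms. These are
nonnegative functions of the outer indices, to which the bound for `κ₁` applies. Nonnegativity of
`κ₁` allows the inner estimate to be inserted termwise. -/
theorem KerBound.prod {κ₁ : I → I → I → I → ℝ} {κ₂ : J → J → J → J → ℝ} {C₁ C₂ : ℝ}
    (h₁ : KerBound κ₁ C₁) (h₂ : KerBound κ₂ C₂) (hκ : ∀ a b a' b', 0 ≤ κ₁ a b a' b')
    (hC : 0 ≤ C₂) :
    KerBound (fun a b a' b' : I × J => κ₁ a.1 b.1 a'.1 b'.1 * κ₂ a.2 b.2 a'.2 b'.2) (C₁ * C₂) := by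
  intro f g f' g' hf hg hf' hg'
  have e : ∑ a, ∑ b, ∑ a', ∑ b', (κ₁ a.1 b.1 a'.1 b'.1 * κ₂ a.2 b.2 a'.2 b'.2)
        * (f a * g b * f' a' * g' b')
      = ∑ a, ∑ b, ∑ a', ∑ b', κ₁ a b a' b' * ∑ c, ∑ d, ∑ c', ∑ d', κ₂ c d c' d'
        * (f (a, c) * g (b, d) * f' (a', c') * g' (b', d')) := by
    simp only [Fintype.sum_prod_type]
    refine Finset.sum_congr rfl fun a _ => ?_
    rw [Finset.sum_comm]
    refine Finset.sum_congr rfl fun b _ => ?_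
    simp only [Finset.mul_sum]
    have r1 : ∀ (G : J → J → I → J → I → J → ℝ),
        ∑ c, ∑ d, ∑ a', ∑ c', ∑ b', ∑ d', G c d a' c' b' d'
          = ∑ a', ∑ b', ∑ c, ∑ d, ∑ c', ∑ d', G c d a' c' b' d' := fun G => by
      calc _ = ∑ c, ∑ a', ∑ d, ∑ c', ∑ b', ∑ d', G c d a' c' b' d' :=
            Finset.sum_congr rfl fun c _ => Finset.sum_comm
        _ = ∑ a', ∑ c, ∑ d, ∑ c', ∑ b', ∑ d', G c d a' c' b' d' := Finset.sum_comm
        _ = ∑ a', ∑ c, ∑ d, ∑ b', ∑ c', ∑ d', G c d a' c' b' d' :=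
            Finset.sum_congr rfl fun a' _ => Finset.sum_congr rfl fun c _ =>
              Finset.sum_congr rfl fun d _ => Finset.sum_comm
        _ = ∑ a', ∑ c, ∑ b', ∑ d, ∑ c', ∑ d', G c d a' c' b' d' :=
            Finset.sum_congr rfl fun a' _ => Finset.sum_congr rfl fun c _ => Finset.sum_comm
        _ = _ := Finset.sum_congr rfl fun a' _ => Finset.sum_comm
    rw [r1]
    simp only [mul_assoc]
  rw [e]
  calc _ ≤ ∑ a, ∑ b, ∑ a', ∑ b', κ₁ a b a' b' * (C₂ * (nrm (fun c => f (a, c))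
        * nrm (fun c => g (b, c)) * nrm (fun c => f' (a', c)) * nrm (fun c => g' (b', c)))) := by
        refine Finset.sum_le_sum fun a _ => Finset.sum_le_sum fun b _ =>
          Finset.sum_le_sum fun a' _ => Finset.sum_le_sum fun b' _ => ?_
        exact mul_le_mul_of_nonneg_left (h₂ _ _ _ _ (fun _ => hf _) (fun _ => hg _)
          (fun _ => hf' _) (fun _ => hg' _)) (hκ _ _ _ _)
    _ = C₂ * ∑ a, ∑ b, ∑ a', ∑ b', κ₁ a b a' b' * (nrm (fun c => f (a, c))
        * nrm (fun c => g (b, c)) * nrm (fun c => f' (a', c)) * nrm (fun c => g' (b', c))) := by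
        simp only [Finset.mul_sum]
        refine Finset.sum_congr rfl fun a _ => Finset.sum_congr rfl fun b _ =>
          Finset.sum_congr rfl fun a' _ => Finset.sum_congr rfl fun b' _ => ?_
        ring
    _ ≤ C₂ * (C₁ * (nrm f * nrm g * nrm f' * nrm g')) := by
        refine mul_le_mul_of_nonneg_left ?_ hC
        have := h₁ (fun a => nrm fun c => f (a, c)) (fun a => nrm fun c => g (a, c))
          (fun a => nrm fun c => f' (a, c)) (fun a => nrm fun c => g' (a, c))
          (fun _ => nrm_nonneg _) (fun _ => nrm_nonneg _) (fun _ => nrm_nonneg _)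
          (fun _ => nrm_nonneg _)
        rwa [nrm_nrm, nrm_nrm, nrm_nrm, nrm_nrm] at this
    _ = _ := by ring

theorem KerBound.of_equiv {κ : J → J → J → J → ℝ} {C : ℝ} (e : I ≃ J)
    (h : KerBound (fun a b a' b' => κ (e a) (e b) (e a') (e b')) C) : KerBound κ C := by
  intro f g f' g' hf hg hf' hg'
  have h1 := h (f ∘ e) (g ∘ e) (f' ∘ e) (g' ∘ e) (fun _ => hf _) (fun _ => hg _) (fun _ => hf' _)
    (fun _ => hg' _)
  have hn : ∀ f : J → ℝ, nrm (f ∘ e) = nrm f := fun f => by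
    rw [nrm, nrm]; congr 1; exact e.sum_comp fun a => f a ^ 2
  rw [hn, hn, hn, hn] at h1
  refine le_trans (le_of_eq ?_) h1
  rw [← e.sum_comp]
  refine Finset.sum_congr rfl fun a _ => ?_
  rw [← e.sum_comp]
  refine Finset.sum_congr rfl fun b _ => ?_
  rw [← e.sum_comp]
  refine Finset.sum_congr rfl fun a' _ => ?_
  rw [← e.sum_comp]
  rfl

theorem prod_diagKer {q : ℕ} {I : Fin q → Type*} [∀ i, DecidableEq (I i)] (a b a' b' : ∀ i, I i) :
    ∏ i, diagKer (a i) (b i) (a' i) (b' i) = diagKer a b a' b' := by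
  simp only [diagKer]
  split_ifs with h
  · exact Finset.prod_eq_one fun i _ => by simp [h.1, h.2]
  · rw [Finset.prod_eq_zero_iff]
    by_contra hc
    apply h
    constructor <;> funext i <;> by_contra hi <;> exact hc ⟨i, Finset.mem_univ _, by simp [hi]⟩

/-- Splitting off one factor, with `E` and `C` its diagonal and cross kernels, `(E + C) Π - E E' =
(E + C) (Π - E') + C E'`, where `Π` and `E'` are the full and diagonal products over the remaining
factors. Keeping the difference from the diagonal, rather than bounding every pairing, yields a
constant that tends to `0` as `m` grows. -/
theorem kerBound_pi (m : ℕ) : ∀ (q : ℕ) (n : Fin q → ℕ),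
    KerBound (fun a b a' b' : ∀ i, Fin (n i) =>
      ∏ i, (diagKer (a i) (b i) (a' i) (b' i) + crossKer m (a i) (b i) (a' i) (b' i))
        - diagKer a b a' b') ((1 + 2 / m) ^ q - 1)
  | 0, n => by
    intro f g f' g' _ _ _ _
    have : ∀ a b a' b' : ∀ i : Fin 0, Fin (n i), diagKer a b a' b' = 1 := fun a b a' b' => by
      rw [diagKer, if_pos ⟨Subsingleton.elim _ _, Subsingleton.elim _ _⟩]
    simp [this]
  | q + 1, n => by
    have ih := kerBound_pi m q fun i => n i.succ
    have hm : (0 : ℝ) ≤ 2 / m := by positivity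
    have h1 : (0 : ℝ) ≤ (1 + 2 / m) ^ q - 1 := sub_nonneg.2 (one_le_pow₀ (by linarith))
    have hA := KerBound.prod ((kerBound_diag (I := Fin (n 0))).add (kerBound_cross m)) ih
      (fun a b a' b' => add_nonneg (diagKer_nonneg _ _ _ _) (crossKer_nonneg _ _ _ _ _)) h1
    have hB := KerBound.prod (kerBound_cross (I := Fin (n 0)) m)
      (kerBound_diag (I := ∀ i : Fin q, Fin (n i.succ)))
      (fun a b a' b' => crossKer_nonneg _ _ _ _ _) zero_le_one
    have hC := hA.add hB
    have e : (1 + 2 / m : ℝ) * ((1 + 2 / m) ^ q - 1) + 2 / m * 1 = (1 + 2 / m) ^ (q + 1) - 1 := by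
      ring
    rw [e] at hC
    refine KerBound.of_equiv (Fin.consEquiv fun i => Fin (n i)) ?_
    convert hC using 6 with a b a' b'
    rw [Fin.prod_univ_succ, ← prod_diagKer, Fin.prod_univ_succ]
    simp only [Fin.consEquiv, Equiv.coe_fn_mk, Fin.cons_zero, Fin.cons_succ, prod_diagKer]
    ring

end Kernels

end KronLRA


namespace KronLRA

/-! ### Second moments of the distortion of a Kronecker sketch. -/

section Moments

open Matrix

variable {q m : ℕ} {n d : Fin q → ℕ}

theorem kron_transpose (A : ∀ i, Matrix (Fin (n i)) (Fin (d i)) ℝ) :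
    (kron A)ᵀ = kron fun i => (A i)ᵀ := rfl

theorem kron_mul_kron {l : Fin q → ℕ} (A : ∀ i, Matrix (Fin (n i)) (Fin (l i)) ℝ)
    (B : ∀ i, Matrix (Fin (l i)) (Fin (d i)) ℝ) : kron A * kron B = kron fun i => A i * B i := by
  ext x y
  simp only [kron, mul_apply, of_apply]
  rw [Finset.prod_univ_sum, Fintype.piFinset_univ]
  exact Finset.sum_congr rfl fun z _ => by rw [Finset.prod_mul_distrib]

/-- The distortion `Sᵀ S - 1` of a Kronecker product of count-sketches. -/
noncomputable def distortion (s : ∀ i, Seed m (n i)) : Matrix (∀ i, Fin (n i)) (∀ i, Fin (n i)) ℝ :=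
  (kron fun i => countSketch (s i))ᵀ * (kron fun i => countSketch (s i)) - 1

theorem distortion_apply (s : ∀ i, Seed m (n i)) (a b : ∀ i, Fin (n i)) :
    distortion s a b = ∏ i, gram (s i) (a i) (b i) - if a = b then 1 else 0 := by
  rw [distortion, Matrix.sub_apply, one_apply, kron_transpose, kron_mul_kron]
  rfl

theorem distortion_transpose (s : ∀ i, Seed m (n i)) : (distortion s)ᵀ = distortion s := by
  simp [distortion]

variable [NeZero m]

/-- Since `Sᵀ S` has mean `1`, this is a covariance; independence turns the mixed moment into a
product over the factors. -/
theorem avg_distortion_mul (a b a' b' : ∀ i, Fin (n i)) :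
    avg (fun s : ∀ i, Seed m (n i) => distortion s a b * distortion s a' b')
      = ∏ i, avg (fun s : Seed m (n i) => gram s (a i) (b i) * gram s (a' i) (b' i))
        - diagKer a b a' b' := by
  have h1 : ∀ a b : ∀ i, Fin (n i), avg (fun s : ∀ i, Seed m (n i) => ∏ i, gram (s i) (a i) (b i))
      = if a = b then 1 else 0 := fun a b => by
    rw [avg_prod fun i (s : Seed m (n i)) => gram s (a i) (b i)]
    simp only [avg_gram]
    split_ifs with h
    · exact Finset.prod_eq_one fun i _ => by simp [h]
    · obtain ⟨i, hi⟩ := Function.ne_iff.1 h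
      exact Finset.prod_eq_zero (Finset.mem_univ i) (if_neg hi)
  have h2 := avg_prod fun i (s : Seed m (n i)) => gram s (a i) (b i) * gram s (a' i) (b' i)
  rw [← h2]
  have h3 : ∀ s : ∀ i, Seed m (n i), distortion s a b * distortion s a' b'
      = ∏ i, gram (s i) (a i) (b i) * gram (s i) (a' i) (b' i)
        - (if a = b then 1 else 0) * ∏ i, gram (s i) (a' i) (b' i)
        - (if a' = b' then 1 else 0) * ∏ i, gram (s i) (a i) (b i)
        + (if a = b then 1 else 0) * (if a' = b' then 1 else 0) := fun s => by
    rw [distortion_apply, distortion_apply, Finset.prod_mul_distrib]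
    ring
  simp only [h3]
  rw [avg_add, avg_sub, avg_sub, avg_mul_left, avg_mul_left, avg_const, h1, h1]
  simp only [diagKer, ite_and]
  split_ifs <;> ring

/-- The second moment constant. -/
noncomputable def momentBound (q m : ℕ) : ℝ := (1 + 2 / m) ^ q - 1

theorem momentBound_nonneg (q m : ℕ) : 0 ≤ momentBound q m := by
  have : (0 : ℝ) ≤ 2 / m := by positivity
  exact sub_nonneg.2 (one_le_pow₀ (by linarith))

/-- The covariance is nonnegative by the lower estimate for each factor, so the absolute value costs
nothing and the upper estimates can be multiplied. -/
theorem avg_distortion_mul_le (a b a' b' : ∀ i, Fin (n i)) :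
    |avg (fun s : ∀ i, Seed m (n i) => distortion s a b * distortion s a' b')|
      ≤ ∏ i, (diagKer (a i) (b i) (a' i) (b' i) + crossKer m (a i) (b i) (a' i) (b' i))
        - diagKer a b a' b' := by
  rw [avg_distortion_mul, abs_of_nonneg]
  · refine sub_le_sub_right (Finset.prod_le_prod (fun i _ => ?_) fun i _ => ?_) _
    · exact (diagKer_nonneg _ _ _ _).trans (avg_gram_mul_gram _ _ _ _).1
    · exact (avg_gram_mul_gram _ _ _ _).2
  · rw [← prod_diagKer, sub_nonneg]
    exact Finset.prod_le_prod (fun i _ => diagKer_nonneg _ _ _ _)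
      fun i _ => (avg_gram_mul_gram _ _ _ _).1

/-- The expanded square is a form in four variables whose kernel is the covariance. Passing to
absolute values of `x` and `y` makes the kernel bound applicable. -/
theorem avg_sq_form_le (x y : (∀ i, Fin (n i)) → ℝ) :
    avg (fun s : ∀ i, Seed m (n i) => (∑ a, ∑ b, distortion s a b * (x a * y b)) ^ 2)
      ≤ momentBound q m * ((∑ a, x a ^ 2) * ∑ b, y b ^ 2) := by
  have h1 : ∀ s : ∀ i, Seed m (n i), (∑ a, ∑ b, distortion s a b * (x a * y b)) ^ 2
      = ∑ a, ∑ b, ∑ a', ∑ b', (x a * y b * x a' * y b')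
        * (distortion s a b * distortion s a' b') := fun s => by
    rw [sq, Finset.sum_mul]
    refine Finset.sum_congr rfl fun a _ => ?_
    rw [Finset.sum_mul]
    refine Finset.sum_congr rfl fun b _ => ?_
    rw [Finset.mul_sum]
    refine Finset.sum_congr rfl fun a' _ => ?_
    rw [Finset.mul_sum]
    exact Finset.sum_congr rfl fun b' _ => by ring
  simp only [h1, avg_sum, avg_mul_left]
  have h2 := kerBound_pi m q n (fun a => |x a|) (fun b => |y b|) (fun a => |x a|) (fun b => |y b|)
    (fun _ => abs_nonneg _) (fun _ => abs_nonneg _) (fun _ => abs_nonneg _)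
    (fun _ => abs_nonneg _)
  have h3 : ∀ x : (∀ i, Fin (n i)) → ℝ, nrm (fun a => |x a|) ^ 2 = ∑ a, x a ^ 2 := fun x => by
    rw [nrm_sq]; simp only [sq_abs]
  calc _ ≤ _ := ?_
    _ ≤ _ := h2
    _ = _ := by rw [← h3 x, ← h3 y, momentBound]; ring
  refine Finset.sum_le_sum fun a _ => Finset.sum_le_sum fun b _ => Finset.sum_le_sum fun a' _ =>
    Finset.sum_le_sum fun b' _ => ?_
  refine (le_abs_self _).trans ?_
  rw [abs_mul, abs_mul, abs_mul, abs_mul, mul_comm]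
  exact mul_le_mul_of_nonneg_right (avg_distortion_mul_le a b a' b') (by positivity)

theorem mul_mul_apply {I J K : Type*} [Fintype I] (X : Matrix I J ℝ) (D : Matrix I I ℝ)
    (Y : Matrix I K ℝ) (j : J) (k : K) :
    (Xᵀ * D * Y) j k = ∑ a, ∑ b, D a b * (X a j * Y b k) := by
  simp only [mul_apply, transpose_apply, Finset.sum_mul]
  rw [Finset.sum_comm]
  exact Finset.sum_congr rfl fun a _ => Finset.sum_congr rfl fun b _ => by ring

variable {J K : Type*} [Fintype J] [Fintype K]

theorem avg_frobSq_le (X : Matrix (∀ i, Fin (n i)) J ℝ) (Y : Matrix (∀ i, Fin (n i)) K ℝ) :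
    avg (fun s : ∀ i, Seed m (n i) => frobSq (Xᵀ * distortion s * Y))
      ≤ momentBound q m * (frobSq X * frobSq Y) := by
  simp only [frobSq, mul_mul_apply, avg_sum]
  calc _ ≤ ∑ j, ∑ k, momentBound q m * ((∑ a, X a j ^ 2) * ∑ b, Y b k ^ 2) :=
        Finset.sum_le_sum fun j _ => Finset.sum_le_sum fun k _ => avg_sq_form_le _ _
    _ = _ := by
        simp only [← Finset.mul_sum]
        rw [← Finset.sum_mul]
        rw [Finset.sum_comm (f := fun j a => X a j ^ 2), Finset.sum_comm (f := fun j a => Y a j ^ 2)]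

/-- Cauchy–Schwarz on the diagonal, weighted by the squared column lengths `w j`, avoids a factor
equal to the number of columns. A column with `w j = 0` is zero, so the convention `0⁻¹ = 0` does no
harm. -/
theorem avg_trace_sq_le (X : Matrix (∀ i, Fin (n i)) J ℝ) :
    avg (fun s : ∀ i, Seed m (n i) => trace (Xᵀ * distortion s * X) ^ 2)
      ≤ momentBound q m * frobSq X ^ 2 := by
  set w : J → ℝ := fun j => ∑ a, X a j ^ 2 with hw
  have hw0 : ∀ j, 0 ≤ w j := fun j => Finset.sum_nonneg fun _ _ => sq_nonneg _
  have hF : frobSq X = ∑ j, w j := by rw [frobSq, Finset.sum_comm]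
  have h1 : ∀ s : ∀ i, Seed m (n i), trace (Xᵀ * distortion s * X) ^ 2
      ≤ frobSq X * ∑ j, (w j)⁻¹ * ((Xᵀ * distortion s * X) j j) ^ 2 := fun s => by
    rw [hF]
    refine Finset.sum_sq_le_sum_mul_sum_of_sq_le_mul _ (fun j _ => hw0 j)
      (fun j _ => mul_nonneg (inv_nonneg.2 (hw0 j)) (sq_nonneg _)) fun j _ => ?_
    rcases eq_or_ne (w j) 0 with h | h
    · have : ∀ a, X a j = 0 := fun a => by
        have := (Finset.sum_eq_zero_iff_of_nonneg fun a _ => sq_nonneg (X a j)).1 h a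
          (Finset.mem_univ _)
        simpa using this
      simp [mul_mul_apply, this, h]
    · rw [diag_apply, mul_inv_cancel_left₀ h]
  calc _ ≤ avg (fun s : ∀ i, Seed m (n i) =>
        frobSq X * ∑ j, (w j)⁻¹ * ((Xᵀ * distortion s * X) j j) ^ 2) := avg_mono h1
    _ = frobSq X * ∑ j, (w j)⁻¹
        * avg (fun s : ∀ i, Seed m (n i) => ((Xᵀ * distortion s * X) j j) ^ 2) := by
        rw [avg_mul_left, avg_sum]
        simp only [avg_mul_left]
    _ ≤ frobSq X * ∑ j, momentBound q m * w j := by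
        refine mul_le_mul_of_nonneg_left (Finset.sum_le_sum fun j _ => ?_) (frobSq_nonneg X)
        have h2 := avg_sq_form_le (m := m) (fun a => X a j) fun a => X a j
        simp only [mul_mul_apply]
        refine (mul_le_mul_of_nonneg_left h2 (inv_nonneg.2 (hw0 j))).trans (le_of_eq ?_)
        change (w j)⁻¹ * (momentBound q m * (w j * w j)) = momentBound q m * w j
        rcases eq_or_ne (w j) 0 with h | h
        · simp [h]
        · field_simp
    _ = _ := by rw [← Finset.mul_sum, ← hF]; ring

/-- With `t = 2q/m ≤ 1`, the power is at most `exp t`, and `exp t - 1 ≤ t + t² ≤ 2t`. -/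
theorem momentBound_le {q m : ℕ} (h : 2 * (q : ℝ) / m ≤ 1) : momentBound q m ≤ 4 * q / m := by
  have h1 : (1 + 2 / m : ℝ) ^ q ≤ Real.exp (2 * q / m) := by
    have := Real.add_one_le_exp (2 / m : ℝ)
    calc (1 + 2 / m : ℝ) ^ q ≤ Real.exp (2 / m) ^ q :=
          pow_le_pow_left₀ (by positivity) (by linarith) q
      _ = Real.exp (2 * q / m) := by rw [← Real.exp_nat_mul]; congr 1; ring
  have h0 : (0 : ℝ) ≤ 2 * q / m := by positivity
  have h2 := Real.abs_exp_sub_one_sub_id_le (x := 2 * q / m) (by rwa [abs_of_nonneg h0])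
  have h3 := (abs_le.1 h2).2
  rw [momentBound]
  have h4 : (4 * q / m : ℝ) = 2 * (2 * q / m) := by ring
  rw [h4]
  nlinarith

end Moments

/-! ### Cost preservation with probability at least 9/10. -/

section SketchCost

open Matrix

variable {q m : ℕ} {n : Fin q → ℕ} {J : Type*} [Fintype J]

theorem frobSq_sketch_sub (s : ∀ i, Seed m (n i)) (B : Matrix (∀ i, Fin (n i)) J ℝ) :
    frobSq (kron (fun i => countSketch (s i)) * B) - frobSq B = trace (Bᵀ * distortion s * B) := by
  rw [frobSq_eq_trace, frobSq_eq_trace, ← trace_sub, distortion]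
  congr 1
  rw [transpose_mul, Matrix.mul_sub, Matrix.sub_mul, Matrix.mul_one]
  simp only [Matrix.mul_assoc]

/-- The seeds for which the sketch of `A` preserves the cost of all projections of rank `k`
up to a factor `1 ± x`. -/
def PreservesCost (k : ℕ) (x : ℝ) (A : Matrix (∀ i, Fin (n i)) J ℝ) (s : ∀ i, Seed m (n i)) : Prop :=
  ∀ W : Matrix (Fin k) J ℝ, W * Wᵀ = 1 →
    |frobSq (kron (fun i => countSketch (s i)) * A - kron (fun i => countSketch (s i)) * A * Wᵀ * W)
      - frobSq (A - A * Wᵀ * W)| ≤ x * frobSq (A - A * Wᵀ * W)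

theorem OPT_le {I : Type*} [Fintype I] (A A' : Matrix I J ℝ) {k : ℕ} (h : A'.rank ≤ k) :
    OPT k A ≤ frob (A' - A) :=
  ciInf_le (f := fun A' : {A' : Matrix I J ℝ // A'.rank ≤ k} => frob (A'.1 - A))
    ⟨0, by rintro _ ⟨a, rfl⟩; exact frob_nonneg _⟩ ⟨A', h⟩

/-- An orthonormal basis of the column space of an optimal approximation. -/
theorem exists_left_factor {I : Type*} [Fintype I] [DecidableEq J] (A : Matrix I J ℝ) {k : ℕ}
    (hkJ : k ≤ Fintype.card J) :
    ∃ r ≤ k, ∃ U : Matrix I (Fin r) ℝ, Uᵀ * U = 1 ∧ frob (A - U * (Uᵀ * A)) ≤ OPT k A := by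
  classical
  obtain ⟨V, hV⟩ := exists_isTop A hkJ
  -- A row basis of the transpose is a column basis of the best approximation; its size is the rank,
  -- which may be smaller than `k`.
  obtain ⟨U, hU1, hU2⟩ := exists_row_basis (A * Vᵀ * V)ᵀ
  refine ⟨_, by rw [rank_transpose]; exact rank_mul_mul_le A V, Uᵀ,
    by rw [transpose_transpose]; exact hU1, ?_⟩
  rw [OPT_eq A hV, frob_eq_sqrt, frob_eq_sqrt]
  apply Real.sqrt_le_sqrt
  have h2 := frobSq_sub_proj (A - A * Vᵀ * V)ᵀ hU1
  -- The projection onto the column space fixes the best approximation, so `R` is also what remains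
  -- of its error after projecting; hence `R` is no longer than that error.
  have h3 : ((A - A * Vᵀ * V)ᵀ - (A - A * Vᵀ * V)ᵀ * Uᵀ * U)ᵀ = A - Uᵀ * (Uᵀᵀ * A) := by
    have h4 := congrArg transpose hU2
    simp only [transpose_mul, transpose_transpose] at h4
    simp only [transpose_sub, transpose_mul, transpose_transpose, Matrix.mul_sub] at h4 ⊢
    rw [h4]; abel
  rw [← h3, frobSq_transpose, h2, frobSq_transpose]
  linarith [frobSq_nonneg ((A - A * Vᵀ * V)ᵀ * Uᵀ)]

/-- Here the seed is fixed and no probability is left: four moment bounds supply the hypotheses of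
`abs_trace_cost_le` for every `W`, with `κ = √k`. That `‖R‖` is at most the cost of `W` follows from
the minimality of `OPT`. -/
theorem preservesCost_of_bounds {r k : ℕ} {A R : Matrix (∀ i, Fin (n i)) J ℝ}
    {U : Matrix (∀ i, Fin (n i)) (Fin r) ℝ} (hU : Uᵀ * U = 1) (hR : A - U * (Uᵀ * A) = R)
    (hf : frob R ≤ OPT k A) {η δ : ℝ} (hη : 0 ≤ η) (hδ0 : 0 ≤ δ) (hk : 1 ≤ (k : ℝ))
    (hδη : 40 * (δ * (k : ℝ) ^ 2) ≤ η ^ 2) (s : ∀ i, Seed m (n i))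
    (c1 : frobSq (Uᵀ * distortion s * U) ≤ 40 * (δ * (k * k)))
    (c2 : frobSq (Uᵀ * distortion s * R) ≤ 40 * (δ * (k * frob R ^ 2)))
    (c3 : frobSq (Rᵀ * distortion s * R) ≤ 40 * (δ * (frob R ^ 2 * frob R ^ 2)))
    (c4 : trace (Rᵀ * distortion s * R) ^ 2 ≤ 40 * (δ * (frob R ^ 2) ^ 2)) :
    PreservesCost k (5 * η) A s := by
  intro W hW
  rw [Matrix.mul_assoc (kron _ * A), Matrix.mul_assoc (kron _) A, ← Matrix.mul_sub,
    ← Matrix.mul_assoc A, frobSq_sketch_sub, ← frob_sq]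
  have hfg : frob R ≤ frob (A - A * Wᵀ * W) := by
    rw [frob_sub_comm A (A * Wᵀ * W)]
    exact hf.trans (OPT_le A _ (rank_mul_mul_le A W))
  have hf0 := frob_nonneg R
  have hk2 : (1 : ℝ) ≤ (k : ℝ) ^ 2 := one_le_pow₀ hk
  have hδ1 : 40 * δ ≤ η ^ 2 := by nlinarith
  have hδk : 40 * (δ * k) ≤ η ^ 2 := by
    have : δ * k ≤ δ * (k : ℝ) ^ 2 := mul_le_mul_of_nonneg_left (by nlinarith) hδ0
    linarith
  subst hR
  set R := A - U * (Uᵀ * A) with hR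
  set f := frob R with hf'
  refine abs_trace_cost_le (distortion s) (distortion_transpose s) A hU hW hη hf0 hfg
    (κ := Real.sqrt k) (by simp) rfl ?_ ?_ ?_ ?_
  · rw [frob_eq_sqrt]
    refine Real.sqrt_le_iff.2 ⟨hη, c1.trans ?_⟩
    rw [← sq]; exact hδη
  · rw [frob_eq_sqrt]
    refine Real.sqrt_le_iff.2 ⟨by positivity, c2.trans ?_⟩
    have h6 := mul_le_mul_of_nonneg_right hδk (sq_nonneg f)
    linarith
  · rw [frob_eq_sqrt, ← Real.sqrt_mul (frobSq_nonneg _)]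
    refine Real.sqrt_le_iff.2 ⟨by positivity, ?_⟩
    have h6 := mul_le_mul_of_nonneg_right hδk (sq_nonneg (f ^ 2))
    have h7 := mul_le_mul_of_nonneg_right c3 (zero_le_one.trans hk)
    calc _ ≤ _ := h7
      _ = 40 * (δ * k) * (f ^ 2) ^ 2 := by ring
      _ ≤ _ := h6
      _ = _ := by ring
  · apply abs_le_of_sq_le_sq _ (by positivity)
    refine c4.trans ?_
    have h6 := mul_le_mul_of_nonneg_right hδ1 (sq_nonneg (f ^ 2))
    calc _ = 40 * δ * (f ^ 2) ^ 2 := by ring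
      _ ≤ _ := h6
      _ = _ := by ring

/-- A Kronecker product of count-sketches preserves costs with probability at least `9 / 10`. -/
theorem card_not_preservesCost_le [DecidableEq J] [NeZero m] (A : Matrix (∀ i, Fin (n i)) J ℝ)
    {k : ℕ} (hk : 0 < k) (hkJ : k ≤ Fintype.card J) (hq : 0 < q) {ε : ℝ} (hε : 0 < ε) (hε1 : ε < 1)
    (hm : 64000 * q * (k : ℝ) ^ 2 / ε ^ 2 ≤ m) :
    (Nat.card {s : ∀ i, Seed m (n i) // ¬ PreservesCost k (ε / 4) A s} : ℝ)
      ≤ Fintype.card (∀ i, Seed m (n i)) / 10 := by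
  classical
  obtain ⟨r, hrk, U, hU, hf⟩ := exists_left_factor A hkJ
  obtain ⟨R, hR⟩ : ∃ R, A - U * (Uᵀ * A) = R := ⟨_, rfl⟩
  rw [hR] at hf
  have hf0 : 0 ≤ frob R := frob_nonneg _
  have hmpos : (0 : ℝ) < m := by exact_mod_cast NeZero.pos m
  have hkpos : (0 : ℝ) < k := by exact_mod_cast hk
  have hk1 : (1 : ℝ) ≤ k := by exact_mod_cast hk
  have hq1 : (1 : ℝ) ≤ q := by exact_mod_cast hq
  have hm' : 64000 * q * (k : ℝ) ^ 2 ≤ m * ε ^ 2 := by rwa [div_le_iff₀ (by positivity)] at hm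
  have hε2 : ε ^ 2 ≤ 1 := pow_le_one₀ hε.le hε1.le
  have hk2 : (1 : ℝ) ≤ (k : ℝ) ^ 2 := one_le_pow₀ hk1
  have hδ : momentBound q m ≤ 4 * q / m := by
    apply momentBound_le
    rw [div_le_one hmpos]
    nlinarith
  have hδ0 := momentBound_nonneg q m
  obtain ⟨δ, hδ'⟩ : ∃ δ, momentBound q m = δ := ⟨_, rfl⟩
  rw [hδ'] at hδ hδ0
  -- With `δ ≤ 4q/m` this asks for `m ≥ 40 · 4 · 20² · q k²/ε²`, the origin of `64000`. The choice
  -- `η = ε/20` gives `5η = ε/4`.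
  have hδη : 40 * (δ * (k : ℝ) ^ 2) ≤ (ε / 20) ^ 2 := by
    have h1 : δ * m ≤ 4 * q := by rwa [le_div_iff₀ hmpos] at hδ
    have h2 : 40 * (δ * (k : ℝ) ^ 2) * m ≤ (ε / 20) ^ 2 * m := by nlinarith
    exact le_of_mul_le_mul_right h2 hmpos
  have hFU : frobSq U ≤ k := by
    rw [← frobSq_transpose, frobSq_coisometry (V := Uᵀ) (by rwa [transpose_transpose])]
    simpa using hrk
  have e1 := avg_frobSq_le (m := m) U U
  have e2 := avg_frobSq_le (m := m) U R
  have e3 := avg_frobSq_le (m := m) R R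
  have e4 := avg_trace_sq_le (m := m) R
  rw [hδ', ← frob_sq R] at e2 e3 e4
  rw [hδ'] at e1
  -- Each of the four events has probability at most `1/40`, hence their union at most `1/10`.
  have b1 := card_gt_le (fun s => frobSq_nonneg _) (b := δ * (k * k)) (c := 40) (by norm_num)
    (e1.trans (mul_le_mul_of_nonneg_left
      (mul_le_mul hFU hFU (frobSq_nonneg _) hkpos.le) hδ0))
  have b2 := card_gt_le (fun s => frobSq_nonneg _) (b := δ * (k * frob R ^ 2)) (c := 40)
    (by norm_num) (e2.trans (mul_le_mul_of_nonneg_left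
      (mul_le_mul_of_nonneg_right hFU (sq_nonneg _)) hδ0))
  have b3 := card_gt_le (fun s => frobSq_nonneg _) (c := 40) (by norm_num) e3
  have b4 := card_gt_le (fun s => sq_nonneg _) (c := 40) (by norm_num) e4
  set P1 : (∀ i, Seed m (n i)) → Prop := fun s => 40 * (δ * (k * k)) < frobSq (Uᵀ * distortion s * U)
    with hP1
  set P2 : (∀ i, Seed m (n i)) → Prop := fun s =>
    40 * (δ * (k * frob R ^ 2)) < frobSq (Uᵀ * distortion s * R) with hP2
  set P3 : (∀ i, Seed m (n i)) → Prop := fun s =>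
    40 * (δ * (frob R ^ 2 * frob R ^ 2)) < frobSq (Rᵀ * distortion s * R) with hP3
  set P4 : (∀ i, Seed m (n i)) → Prop := fun s =>
    40 * (δ * (frob R ^ 2) ^ 2) < trace (Rᵀ * distortion s * R) ^ 2 with hP4
  have hsub : ∀ s : ∀ i, Seed m (n i), ¬ PreservesCost k (ε / 4) A s →
      P1 s ∨ P2 s ∨ P3 s ∨ P4 s := by
    intro s hs
    by_contra hc
    simp only [hP1, hP2, hP3, hP4, not_or, not_lt] at hc
    obtain ⟨c1, c2, c3, c4⟩ := hc
    apply hs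
    have := preservesCost_of_bounds hU hR hf (by positivity : 0 ≤ ε / 20) hδ0 hk1 hδη s c1 c2 c3 c4
    convert this using 1
    ring
  have hcard : Nat.card {s : ∀ i, Seed m (n i) // ¬ PreservesCost k (ε / 4) A s}
      ≤ Nat.card {s // P1 s} + (Nat.card {s // P2 s} + (Nat.card {s // P3 s}
        + Nat.card {s // P4 s})) := by
    simp only [Nat.card_eq_fintype_card, Fintype.card_subtype]
    calc _ ≤ ((Finset.univ.filter P1) ∪ ((Finset.univ.filter P2) ∪ ((Finset.univ.filter P3)
          ∪ (Finset.univ.filter P4)))).card := by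
          apply Finset.card_le_card
          intro s hs
          have := hsub s (Finset.mem_filter.1 hs).2
          simpa using this
      _ ≤ _ := by
          refine (Finset.card_union_le _ _).trans (add_le_add le_rfl ?_)
          refine (Finset.card_union_le _ _).trans (add_le_add le_rfl ?_)
          exact Finset.card_union_le _ _
  have hcard' : (Nat.card {s : ∀ i, Seed m (n i) // ¬ PreservesCost k (ε / 4) A s} : ℝ)
      ≤ Nat.card {s // P1 s} + (Nat.card {s // P2 s} + (Nat.card {s // P3 s}
        + Nat.card {s // P4 s})) := by exact_mod_cast hcard
  linarith

end SketchCost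

/-- Projecting onto top right singular vectors of the sketch is nearly optimal. -/
theorem sketch_top_singular {q : ℕ} (n d : Fin q → ℕ)
    (A : ∀ i, Matrix (Fin (n i)) (Fin (d i)) ℝ) (k : ℕ) (ε : ℝ) (m : ℕ) [NeZero m]
    (hq : 0 < q) (hk : 0 < k) (hkd : k ≤ ∏ i, d i) (hε : 0 < ε) (hε1 : ε < 1)
    (hm : 64000 * q * (k : ℝ) ^ 2 / ε ^ 2 ≤ m) :
    9 / 10 ≤ (PMF.uniformOfFintype (∀ i, Seed m (n i))).toOuterMeasure
      {s | ∀ U : Matrix (Fin k) (∀ i, Fin (d i)) ℝ,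
        IsTopRightSingular (kron (fun i => countSketch (s i)) * kron A) U →
        (kron A * U.transpose * U).rank ≤ k ∧
        frob (kron A * U.transpose * U - kron A) ≤ (1 + ε) * OPT k (kron A)} := by
  have hcard : k ≤ Fintype.card (∀ i, Fin (d i)) := by simpa using hkd
  refine le_trans (toOuterMeasure_uniform_ge (S := {s | PreservesCost k (ε / 4) (kron A) s})
    (card_not_preservesCost_le (kron A) hk hcard hq hε hε1 hm)) ?_
  refine MeasureTheory.OuterMeasure.mono _ fun s hs U hU => ⟨rank_mul_mul_le _ _, ?_⟩
  obtain ⟨V, hV⟩ := exists_isTop (kron A) hcard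
  have h := frob_le_of_cost_preserved (x := ε / 4) (by positivity) (by linarith) hV hU.1 hs ?_
  · rwa [mul_div_cancel₀ ε (by norm_num : (4 : ℝ) ≠ 0)] at h
  -- Exact singular vectors attain the tail of the sketch, so the slack `1 + ε/4` is not used here;
  -- it is there for the approximate vectors of the algorithm.
  · rw [frobSq_sub_proj _ hU.1, frobSq_mul_of_isTop hU]
    have h1 : 0 ≤ frobSq (kron (fun i => countSketch (s i)) * kron A)
        - ∑ i ∈ Finset.range k, sval (kron (fun i => countSketch (s i)) * kron A) i ^ 2 := by
      rw [← frobSq_mul_of_isTop hU, ← frobSq_sub_proj _ hU.1]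
      exact frobSq_nonneg _
    nlinarith

end KronLRA


namespace KronLRA

/-! ### Pivoted Gram–Schmidt on a high power of the Gram matrix. -/

section Greedy

open Matrix

variable {I J : Type*} [Fintype I] [Fintype J]

/-- The residual of a vector after the Gram–Schmidt steps with the first `j` of the vectors `u`. -/
def residual (u : ℕ → J → ℝ) : ℕ → (J → ℝ) → J → ℝ
  | 0, v => v
  | j + 1, v => residual u j v - (residual u j v ⬝ᵥ u j) • u j

/-- A step of Gram–Schmidt orthogonalization: `w` is the normalized residual of `v`. -/
def IsStep (u : ℕ → J → ℝ) (j : ℕ) (v : J → ℝ) : Prop :=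
  0 < residual u j v ⬝ᵥ residual u j v ∧
    u j = (Real.sqrt (residual u j v ⬝ᵥ residual u j v))⁻¹ • residual u j v

/-- A Gram–Schmidt step with a row of `W` whose residual is largest. -/
def IsPivot (W : Matrix I J ℝ) (u : ℕ → J → ℝ) (j : ℕ) (a : I) : Prop :=
  IsStep u j (W a) ∧
    ∀ b, residual u j (W b) ⬝ᵥ residual u j (W b) ≤ residual u j (W a) ⬝ᵥ residual u j (W a)

/-- Pivoted Gram–Schmidt orthogonalization of the rows of `W`, with arbitrary steps
once all residuals vanish. -/
def IsGreedy (W : Matrix I J ℝ) (u : ℕ → J → ℝ) (k : ℕ) : Prop :=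
  ∀ j < k, (∃ a, IsPivot W u j a) ∨ ((∀ b, residual u j (W b) = 0) ∧ ∃ v, IsStep u j v)

/-- The first `k` of the vectors `u` are orthonormal. -/
def OrthoUpTo (u : ℕ → J → ℝ) (k : ℕ) : Prop :=
  ∀ i < k, ∀ j < k, u i ⬝ᵥ u j = if i = j then 1 else 0

theorem OrthoUpTo.mono {u : ℕ → J → ℝ} {j k : ℕ} (h : OrthoUpTo u k) (hjk : j ≤ k) :
    OrthoUpTo u j := fun i hi l hl => h i (hi.trans_le hjk) l (hl.trans_le hjk)

theorem residual_congr {u v : ℕ → J → ℝ} {j : ℕ} (h : ∀ i < j, u i = v i) (w : J → ℝ) :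
    residual u j w = residual v j w := by
  induction j with
  | zero => rfl
  | succ j ih =>
    rw [residual, residual, ih fun i hi => h i (by omega), h j (by omega)]

/-- Orthonormality makes the successive subtractions, which the program performs, agree with the
one-shot orthogonal projection. -/
theorem residual_eq {u : ℕ → J → ℝ} {j : ℕ} (h : OrthoUpTo u j) (v : J → ℝ) :
    residual u j v = v - ∑ l ∈ Finset.range j, (v ⬝ᵥ u l) • u l := by
  induction j with
  | zero => simp [residual]
  | succ j ih =>
    rw [residual, ih (h.mono (by omega)), Finset.sum_range_succ, sub_dotProduct, sum_dotProduct]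
    have : ∑ l ∈ Finset.range j, (v ⬝ᵥ u l) • u l ⬝ᵥ u j = 0 := by
      refine Finset.sum_eq_zero fun l hl => ?_
      have hl := Finset.mem_range.1 hl
      rw [smul_dotProduct, h l (by omega) j (by omega), if_neg hl.ne, smul_zero]
    rw [this, sub_zero, sub_sub]

theorem residual_dotProduct {u : ℕ → J → ℝ} {j i : ℕ} (h : OrthoUpTo u j) (hi : i < j)
    (v : J → ℝ) : residual u j v ⬝ᵥ u i = 0 := by
  rw [residual_eq h, sub_dotProduct, sum_dotProduct, Finset.sum_eq_single i]
  · rw [smul_dotProduct, h i hi i hi, if_pos rfl]; simp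
  · intro l hl hli
    rw [smul_dotProduct, h l (Finset.mem_range.1 hl) i hi, if_neg hli, smul_zero]
  · intro hl; exact absurd (Finset.mem_range.2 hi) hl

theorem IsStep.orthoUpTo_succ {u : ℕ → J → ℝ} {j : ℕ} {v : J → ℝ} (hs : IsStep u j v)
    (h : OrthoUpTo u j) : OrthoUpTo u (j + 1) := by
  obtain ⟨h1, h2⟩ := hs
  have h3 : u j ⬝ᵥ u j = 1 := by
    rw [h2, smul_dotProduct, dotProduct_smul, smul_eq_mul, smul_eq_mul, ← mul_assoc, ← mul_inv,
      Real.mul_self_sqrt h1.le, inv_mul_cancel₀ h1.ne']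
  have h4 : ∀ i < j, u j ⬝ᵥ u i = 0 := fun i hi => by
    rw [h2, smul_dotProduct, residual_dotProduct h hi, smul_zero]
  intro i hi l hl
  rcases Nat.lt_succ_iff_lt_or_eq.1 hi with hi | rfl <;>
    rcases Nat.lt_succ_iff_lt_or_eq.1 hl with hl | rfl
  · exact h i hi l hl
  · rw [dotProduct_comm, h4 i hi, if_neg hi.ne]
  · rw [h4 l hl, if_neg hl.ne']
  · rw [h3, if_pos rfl]

theorem orthoUpTo_of_steps {u : ℕ → J → ℝ} {k : ℕ} (h : ∀ j < k, ∃ v, IsStep u j v) :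
    OrthoUpTo u k := by
  induction k with
  | zero => intro i hi; omega
  | succ k ih =>
    obtain ⟨v, hv⟩ := h k (by omega)
    exact hv.orthoUpTo_succ (ih fun j hj => h j (by omega))

theorem IsGreedy.steps {W : Matrix I J ℝ} {u : ℕ → J → ℝ} {k : ℕ} (h : IsGreedy W u k) :
    ∀ j < k, ∃ v, IsStep u j v := fun j hj => by
  rcases h j hj with ⟨a, ha, -⟩ | ⟨-, hv⟩
  exacts [⟨_, ha⟩, hv]

/-- The matrix whose rows are the first `k` of the vectors `u`. -/
def rowsOf (u : ℕ → J → ℝ) (k : ℕ) : Matrix (Fin k) J ℝ := Matrix.of fun r => u r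

theorem OrthoUpTo.rows_mul_transpose {u : ℕ → J → ℝ} {k : ℕ} (h : OrthoUpTo u k) :
    rowsOf u k * (rowsOf u k)ᵀ = 1 := by
  ext i j
  have h1 := h i i.2 j j.2
  rw [one_apply]
  simp only [Fin.ext_iff]
  exact h1

theorem sub_mul_rowsOf {u : ℕ → J → ℝ} {k : ℕ} (h : OrthoUpTo u k) (W : Matrix I J ℝ) (a : I) :
    (W - W * (rowsOf u k)ᵀ * rowsOf u k) a = residual u k (W a) := by
  rw [residual_eq h, Finset.sum_range]
  ext j
  rw [Matrix.sub_apply, mul_apply]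
  simp [rowsOf, mul_apply, dotProduct]

theorem frobSq_sub_rowsOf {u : ℕ → J → ℝ} {k : ℕ} (h : OrthoUpTo u k) (W : Matrix I J ℝ) :
    frobSq (W - W * (rowsOf u k)ᵀ * rowsOf u k)
      = ∑ a, residual u k (W a) ⬝ᵥ residual u k (W a) := by
  refine Finset.sum_congr rfl fun a _ => ?_
  rw [sub_mul_rowsOf h, dotProduct]
  exact Finset.sum_congr rfl fun j _ => sq _

theorem residual_dot_self_succ_le {u : ℕ → J → ℝ} {j k : ℕ} (h : OrthoUpTo u k) (hjk : j ≤ k)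
    (v : J → ℝ) :
    residual u k v ⬝ᵥ residual u k v ≤ residual u j v ⬝ᵥ residual u j v := by
  induction k, hjk using Nat.le_induction with
  | base => exact le_rfl
  | succ k hjk ih =>
    refine le_trans ?_ (ih (h.mono (by omega)))
    set r := residual u k v with hr
    have h1 : u k ⬝ᵥ u k = 1 := by rw [h k (by omega) k (by omega), if_pos rfl]
    rw [residual, ← hr]
    simp only [sub_dotProduct, dotProduct_sub, smul_dotProduct, dotProduct_smul, smul_eq_mul, h1]
    rw [dotProduct_comm (u k) r]
    nlinarith [sq_nonneg (r ⬝ᵥ u k)]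

theorem residual_zero {u : ℕ → J → ℝ} {j k : ℕ} (hjk : j ≤ k) {v : J → ℝ}
    (h : residual u j v = 0) : residual u k v = 0 := by
  induction k, hjk using Nat.le_induction with
  | base => exact h
  | succ k hjk ih => rw [residual, ih]; simp

theorem dotProduct_sq_le (v w : J → ℝ) : (v ⬝ᵥ w) ^ 2 ≤ (v ⬝ᵥ v) * (w ⬝ᵥ w) := by
  have := Finset.sum_mul_sq_le_sq_mul_sq Finset.univ v w
  simpa [dotProduct, sq] using this

theorem nrm_sq_eq (v : J → ℝ) : nrm v ^ 2 = v ⬝ᵥ v := by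
  rw [nrm_sq, dotProduct]
  exact Finset.sum_congr rfl fun _ _ => sq _

theorem nrm_sub_le (v w : J → ℝ) : nrm (v - w) ≤ nrm v + nrm w := by
  refine Real.sqrt_le_iff.2 ⟨add_nonneg (nrm_nonneg _) (nrm_nonneg _), ?_⟩
  have h := sum_mul_le_nrm (fun i => -v i) w
  have e : nrm (fun i => -v i) = nrm v := by simp [nrm]
  rw [e] at h
  rw [add_sq, nrm_sq, nrm_sq]
  have h2 : ∑ a, (v - w) a ^ 2 = ∑ a, v a ^ 2 + 2 * ∑ a, -v a * w a + ∑ a, w a ^ 2 := by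
    rw [Finset.mul_sum, ← Finset.sum_add_distrib, ← Finset.sum_add_distrib]
    exact Finset.sum_congr rfl fun a _ => by simp; ring
  rw [h2]
  nlinarith

theorem nrm_smul (c : ℝ) (v : J → ℝ) : nrm (c • v) = |c| * nrm v := by
  rw [nrm, nrm, ← Real.sqrt_sq_eq_abs, ← Real.sqrt_mul (sq_nonneg c), Finset.mul_sum]
  congr 1
  exact Finset.sum_congr rfl fun a _ => by simp [mul_pow]

theorem nrm_sum_le {ι : Type*} (s : Finset ι) (f : ι → J → ℝ) :
    nrm (∑ l ∈ s, f l) ≤ ∑ l ∈ s, nrm (f l) := by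
  classical
  induction s using Finset.induction_on with
  | empty => simp [nrm]
  | insert a s ha ih =>
    rw [Finset.sum_insert ha, Finset.sum_insert ha]
    have h := nrm_sub_le (f a) (-∑ l ∈ s, f l)
    have e : nrm (-∑ l ∈ s, f l) = nrm (∑ l ∈ s, f l) := by simp [nrm]
    rw [sub_neg_eq_add, e] at h
    linarith

/-- In a run of pivot steps the vectors are combinations of rows of `W` with
controlled coefficients. -/
theorem exists_coeff [DecidableEq I] {W : Matrix I J ℝ} {u : ℕ → J → ℝ} {k : ℕ} {a : ℕ → I}
    (ha : ∀ j < k, IsPivot W u j (a j)) :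
    ∃ c : ℕ → I → ℝ, ∀ j < k, u j = c j ᵥ* W ∧
      nrm (residual u j (W (a j))) * nrm (c j) ≤ 2 ^ j := by
  have ho : OrthoUpTo u k := orthoUpTo_of_steps fun j hj => ⟨_, (ha j hj).1⟩
  induction k with
  | zero => exact ⟨0, fun j hj => by omega⟩
  | succ k ih =>
    obtain ⟨c, hc⟩ := ih (fun j hj => ha j (by omega)) (ho.mono (by omega))
    set r : ℕ → ℝ := fun j => nrm (residual u j (W (a j))) with hr
    have hr0 : ∀ j, 0 ≤ r j := fun j => nrm_nonneg _
    obtain ⟨⟨h1, h2⟩, h3⟩ := ha k (by omega)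
    have hrk : Real.sqrt (residual u k (W (a k)) ⬝ᵥ residual u k (W (a k))) = r k := by
      rw [← nrm_sq_eq, Real.sqrt_sq (nrm_nonneg _)]
    have hrk0 : 0 < r k := by rw [← hrk]; exact Real.sqrt_pos.2 h1
    rw [hrk] at h2
    -- These are the coefficients of the unnormalized residual of the pivot row in terms of the rows
    -- of `W`.
    set y : I → ℝ := Pi.single (a k) 1 - ∑ l ∈ Finset.range k, (W (a k) ⬝ᵥ u l) • c l with hy
    refine ⟨Function.update c k ((r k)⁻¹ • y), fun j hj => ?_⟩
    rcases Nat.lt_succ_iff_lt_or_eq.1 hj with hj | rfl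
    · rw [Function.update_of_ne hj.ne]
      exact hc j hj
    · rw [Function.update_self]
      constructor
      · rw [smul_vecMul, h2, residual_eq (ho.mono (by omega)), hy, sub_vecMul, single_one_vecMul,
          sum_vecMul]
        congr 2
        refine Finset.sum_congr rfl fun l hl => ?_
        rw [smul_vecMul, ← (hc l (Finset.mem_range.1 hl)).1]
      · change r j * _ ≤ _
        rw [nrm_smul, abs_of_pos (inv_pos.2 hrk0), mul_inv_cancel_left₀ hrk0.ne']
        -- Row `a j` was available at step `l` but not longer than the pivot, so its component along
        -- `u l` is at most the pivot's residual length. The bounds then add up as `1 + ∑ l < j, 2^l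
        -- = 2^j`.
        have hb : ∀ l ∈ Finset.range j, nrm ((W (a j) ⬝ᵥ u l) • c l) ≤ 2 ^ l := fun l hl => by
          have hl := Finset.mem_range.1 hl
          rw [nrm_smul]
          refine le_trans (mul_le_mul_of_nonneg_right ?_ (nrm_nonneg _)) (hc l hl).2
          have e1 : W (a j) ⬝ᵥ u l = residual u l (W (a j)) ⬝ᵥ u l := by
            rw [residual_eq (ho.mono (by omega)), sub_dotProduct, sum_dotProduct,
              Finset.sum_eq_zero, sub_zero]
            intro i hi
            have hi := Finset.mem_range.1 hi
            rw [smul_dotProduct, ho i (by omega) l (by omega), if_neg hi.ne, smul_zero]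
          rw [e1]
          apply abs_le_of_sq_le_sq _ (nrm_nonneg _)
          have e2 := dotProduct_sq_le (residual u l (W (a j))) (u l)
          rw [ho l (by omega) l (by omega), if_pos rfl, mul_one] at e2
          rw [nrm_sq_eq]
          exact e2.trans ((ha l (by omega)).2 (a j))
        have hs : nrm (Pi.single (a j) 1 : I → ℝ) = 1 := by
          rw [nrm, Finset.sum_eq_single (a j)]
          · simp
          · intro b _ hb; simp [hb]
          · simp
        calc nrm y ≤ 1 + ∑ l ∈ Finset.range j, nrm ((W (a j) ⬝ᵥ u l) • c l) := by
              rw [← hs]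
              exact (nrm_sub_le _ _).trans (add_le_add le_rfl (nrm_sum_le _ _))
          _ ≤ 1 + ∑ l ∈ Finset.range j, (2 : ℝ) ^ l := by
              have := Finset.sum_le_sum hb
              linarith
          _ = 2 ^ j := by
              rw [geom_sum_eq (by norm_num)]; ring

/-- By Bernoulli, `(l/t)^T ≥ 1 + T (l/t - 1)`: a loss factor `F` for `T`-th powers becomes a
relative loss `F/T` for the numbers themselves. It is applied to the missing weight `w` on
eigenvalues `l` above the threshold `t`. -/
theorem mul_sub_le_of_power {l t w F : ℝ} {T : ℕ} (hT : 0 < T) (ht : 0 ≤ t) (hl : t ≤ l)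
    (hw : 0 ≤ w) (h : w * l ^ T ≤ F * t ^ T) : T * ((l - t) * w) ≤ F * t := by
  rcases ht.eq_or_lt with rfl | ht
  · rw [zero_pow hT.ne', mul_zero] at h
    have : w * l ^ T = 0 := le_antisymm h (mul_nonneg hw (pow_nonneg hl T))
    rcases mul_eq_zero.1 this with h1 | h1
    · simp [h1]
    · simp [pow_eq_zero_iff hT.ne' |>.1 h1]
  · have h1 := one_add_mul_le_pow (a := l / t - 1)
      (by have : 0 ≤ l / t := div_nonneg (ht.le.trans hl) ht.le
          linarith) T
    rw [add_sub_cancel, div_pow] at h1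
    have h2 : T * ((l - t) * w) = t * (w * (T * (l / t - 1))) := by field_simp
    rw [h2]
    have h3 : w * (T * (l / t - 1)) ≤ w * (l ^ T / t ^ T) :=
      mul_le_mul_of_nonneg_left (by linarith) hw
    have h4 : w * (l ^ T / t ^ T) ≤ F := by
      rw [← mul_div_assoc, div_le_iff₀ (by positivity)]
      exact h
    calc _ ≤ t * F := mul_le_mul_of_nonneg_left (h3.trans h4) ht.le
      _ = _ := mul_comm _ _

/-- The counterpart for superfluous weight `c` below the threshold. It rests on `T x^T (1 - x) ≤ 1`
for `0 ≤ x ≤ 1`, since `x^T` is at most each term of the geometric sum `∑ i < T, x^i`. -/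
theorem mul_sub_le_of_power' {l t c F : ℝ} {T : ℕ} (hl : 0 ≤ l) (hlt : l ≤ t)
    (hF : 0 ≤ F) (h : c * t ^ T ≤ F * l ^ T) : T * ((t - l) * c) ≤ F * t := by
  rcases (hl.trans hlt).eq_or_lt with rfl | ht
  · have : l = 0 := le_antisymm hlt hl
    simp [this]
  · set x := l / t with hx
    have hx0 : 0 ≤ x := by positivity
    have hx1 : x ≤ 1 := (div_le_one ht).2 hlt
    have hc : c ≤ F * x ^ T := by
      rw [hx, div_pow, ← mul_div_assoc, le_div_iff₀ (by positivity)]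
      exact h
    have h1 : (T : ℝ) * (x ^ T * (1 - x)) ≤ 1 := by
      have h2 := geom_sum_mul_neg x T
      have h3 : (T : ℝ) * x ^ T ≤ ∑ i ∈ Finset.range T, x ^ i := by
        calc (T : ℝ) * x ^ T = ∑ i ∈ Finset.range T, x ^ T := by simp
          _ ≤ _ := Finset.sum_le_sum fun i hi =>
            pow_le_pow_of_le_one hx0 hx1 (Finset.mem_range.1 hi).le
      have h4 := mul_le_mul_of_nonneg_right h3 (sub_nonneg.2 hx1)
      have h5 : 0 ≤ x ^ T := by positivity
      nlinarith
    have e : (T : ℝ) * ((t - l) * c) = t * (T * ((1 - x) * c)) := by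
      rw [hx]; field_simp
    rw [e]
    have h6 : (T : ℝ) * ((1 - x) * c) ≤ F := by
      calc (T : ℝ) * ((1 - x) * c) ≤ T * ((1 - x) * (F * x ^ T)) :=
            mul_le_mul_of_nonneg_left (mul_le_mul_of_nonneg_left hc (sub_nonneg.2 hx1))
              (Nat.cast_nonneg _)
        _ = F * (T * (x ^ T * (1 - x))) := by ring
        _ ≤ F * 1 := mul_le_mul_of_nonneg_left h1 hF
        _ = F := mul_one F
    calc _ ≤ t * F := mul_le_mul_of_nonneg_left h6 ht.le
      _ = _ := mul_comm _ _

variable [DecidableEq I] [DecidableEq J] {n : ℕ}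

theorem mulVec_dot_eigenvector {W : Matrix I J ℝ} {μ : ℕ → ℝ} {X : Matrix (Fin n) J ℝ}
    (hX : Wᵀ * W = Xᵀ * diagonal (fun i : Fin n => μ i) * X) (hX1 : X * Xᵀ = 1) (i : Fin n) :
    (W *ᵥ X i) ⬝ᵥ (W *ᵥ X i) = μ i := by
  have h1 : (X * (Wᵀ * W) * Xᵀ) i i = μ i := by
    rw [hX]
    have : X * (Xᵀ * diagonal (fun i : Fin n => μ i) * X) * Xᵀ
        = (X * Xᵀ) * diagonal (fun i : Fin n => μ i) * (X * Xᵀ) := by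
      simp only [Matrix.mul_assoc]
    rw [this, hX1, Matrix.one_mul, Matrix.mul_one, diagonal_apply_eq]
  rw [← h1]
  have h2 : X * (Wᵀ * W) * Xᵀ = (W * Xᵀ)ᵀ * (W * Xᵀ) := by
    simp only [transpose_mul, transpose_transpose, Matrix.mul_assoc]
  rw [h2, mul_apply]
  rfl

/-- A pivot direction has small components along eigenvectors with small eigenvalues. -/
theorem IsPivot.sq_dot_le {W : Matrix I J ℝ} {μ : ℕ → ℝ} {X : Matrix (Fin n) J ℝ}
    (hX : Wᵀ * W = Xᵀ * diagonal (fun i : Fin n => μ i) * X) (hX1 : X * Xᵀ = 1)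
    {u : ℕ → J → ℝ} {k : ℕ} {a : ℕ → I} (ha : ∀ j < k, IsPivot W u j (a j)) {j : ℕ} (hj : j < k)
    (i : Fin n) :
    (u j ⬝ᵥ X i) ^ 2 * (residual u j (W (a j)) ⬝ᵥ residual u j (W (a j))) ≤ 4 ^ j * μ i := by
  obtain ⟨c, hc⟩ := exists_coeff ha
  obtain ⟨h1, h2⟩ := hc j hj
  -- As `u j` combines rows of `W` with coefficients `c j`, its component along `X i` is `c j ⬝ᵥ W X
  -- i`, and `W X i` has squared length `μ i`.
  have h3 : (u j ⬝ᵥ X i) ^ 2 ≤ (c j ⬝ᵥ c j) * μ i := by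
    rw [h1, ← dotProduct_mulVec, ← mulVec_dot_eigenvector hX hX1 i]
    exact dotProduct_sq_le _ _
  have hμ : 0 ≤ μ i := by
    rw [← mulVec_dot_eigenvector hX hX1 i, ← nrm_sq_eq]; exact sq_nonneg _
  rw [← nrm_sq_eq]
  rw [← nrm_sq_eq] at h3
  have h4 : (nrm (residual u j (W (a j))) * nrm (c j)) ^ 2 ≤ 4 ^ j := by
    calc _ ≤ ((2 : ℝ) ^ j) ^ 2 :=
          pow_le_pow_left₀ (mul_nonneg (nrm_nonneg _) (nrm_nonneg _)) h2 2
      _ = 4 ^ j := by rw [← pow_mul, mul_comm, pow_mul]; norm_num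
  calc _ ≤ nrm (c j) ^ 2 * μ i * nrm (residual u j (W (a j))) ^ 2 :=
        mul_le_mul_of_nonneg_right h3 (sq_nonneg _)
    _ = (nrm (residual u j (W (a j))) * nrm (c j)) ^ 2 * μ i := by ring
    _ ≤ _ := mul_le_mul_of_nonneg_right h4 hμ

/-- The weight of the projection onto the first `k` of the vectors `u` on an eigenvector. -/
theorem rowsOf_mul_apply (u : ℕ → J → ℝ) (k : ℕ) (X : Matrix (Fin n) J ℝ) (r : Fin k) (i : Fin n) :
    (rowsOf u k * Xᵀ) r i = u r ⬝ᵥ X i := rfl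

theorem frobSq_sub_rowsOf_eq {W : Matrix I J ℝ} {μ : ℕ → ℝ} {X : Matrix (Fin n) J ℝ}
    (hX : Wᵀ * W = Xᵀ * diagonal (fun i : Fin n => μ i) * X) (hX1 : X * Xᵀ = 1)
    {u : ℕ → J → ℝ} {k : ℕ} (h : OrthoUpTo u k) :
    frobSq (W - W * (rowsOf u k)ᵀ * rowsOf u k)
      = ∑ i : Fin n, μ i * (1 - ∑ r, (rowsOf u k * Xᵀ) r i ^ 2) := by
  rw [frobSq_sub_proj _ h.rows_mul_transpose, frobSq_mul_transpose_eq W hX, frobSq_eq_sum W hX hX1,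
    Finset.sum_range]
  simp only [mul_sub, mul_one, Finset.sum_sub_distrib]

/-- The residual after `k` pivot steps is comparable with the `k`-th eigenvalue. -/
theorem frobSq_residual_le {W : Matrix I J ℝ} {μ : ℕ → ℝ} {X : Matrix (Fin n) J ℝ}
    (hX : Wᵀ * W = Xᵀ * diagonal (fun i : Fin n => μ i) * X) (hX1 : X * Xᵀ = 1)
    (hX2 : Xᵀ * X = 1) (hμ : Antitone μ) (hμ0 : ∀ i, 0 ≤ μ i)
    {u : ℕ → J → ℝ} {k : ℕ} {a : ℕ → I} (ha : ∀ j < k, IsPivot W u j (a j)) :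
    frobSq (W - W * (rowsOf u k)ᵀ * rowsOf u k)
      ≤ Fintype.card I * (k + 1) * n * 4 ^ k * μ k := by
  have ho : OrthoUpTo u k := orthoUpTo_of_steps fun j hj => ⟨_, (ha j hj).1⟩
  rw [frobSq_sub_rowsOf ho]
  rcases isEmpty_or_nonempty I with hI | hI
  · simp
  obtain ⟨b, -, hb⟩ := Finset.exists_max_image Finset.univ
    (fun b => residual u k (W b) ⬝ᵥ residual u k (W b)) Finset.univ_nonempty
  set ρ := residual u k (W b) ⬝ᵥ residual u k (W b) with hρ
  have h1 : ∑ a, residual u k (W a) ⬝ᵥ residual u k (W a) ≤ Fintype.card I * ρ := by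
    calc _ ≤ ∑ a : I, ρ := Finset.sum_le_sum fun a _ => hb a (Finset.mem_univ _)
      _ = _ := by simp
  have hρ0 : 0 ≤ ρ := by rw [hρ, ← nrm_sq_eq]; exact sq_nonneg _
  suffices h2 : ρ ≤ (k + 1) * n * 4 ^ k * μ k by
    calc _ ≤ _ := h1
      _ ≤ Fintype.card I * ((k + 1) * n * 4 ^ k * μ k) := by gcongr
      _ = _ := by ring
  rcases hρ0.eq_or_lt with h0 | h0
  · rw [← h0]
    have := hμ0 k
    positivity
  -- The run is prolonged by one pivot step. Among `k + 1` orthonormal vectors, total weight at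
  -- least `1` must fall on eigenvectors with index `≥ k`, and a large residual `ρ` limits that
  -- weight in terms of `μ k`.
  set u' : ℕ → J → ℝ := Function.update u k ((Real.sqrt ρ)⁻¹ • residual u k (W b)) with hu'
  set a' : ℕ → I := Function.update a k b with ha'
  have hres : ∀ j ≤ k, ∀ v, residual u' j v = residual u j v := fun j hj v =>
    residual_congr (fun i hi => by rw [hu', Function.update_of_ne (by omega)]) v
  have hpiv : ∀ j < k + 1, IsPivot W u' j (a' j) := by
    intro j hj
    have hr := hres j (by omega)
    rcases Nat.lt_succ_iff_lt_or_eq.1 hj with hj | rfl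
    · have e1 : u' j = u j := Function.update_of_ne hj.ne _ _
      have e2 : a' j = a j := Function.update_of_ne hj.ne _ _
      simp only [IsPivot, IsStep, hr, e1, e2]
      exact ha j hj
    · have e1 : u' j = (Real.sqrt ρ)⁻¹ • residual u j (W b) := Function.update_self _ _ _
      have e2 : a' j = b := Function.update_self _ _ _
      simp only [IsPivot, IsStep, hr, e1, e2]
      exact ⟨⟨h0, rfl⟩, fun c => hb c (Finset.mem_univ _)⟩
  have ho' : OrthoUpTo u' (k + 1) := orthoUpTo_of_steps fun j hj => ⟨_, (hpiv j hj).1⟩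
  set c : Fin n → ℝ := fun i => ∑ r, (rowsOf u' (k + 1) * Xᵀ) r i ^ 2 with hc
  have hc1 : ∀ i, c i ≤ 1 :=
    sum_sq_col_le_one (mul_transpose_coisometry hX2 ho'.rows_mul_transpose)
  have hcs : ∑ i, c i = k + 1 := by
    have := sum_sum_sq_eq_card hX2 ho'.rows_mul_transpose
    simpa [hc] using this
  have hcρ : ∀ i : Fin n, k ≤ (i : ℕ) → c i * ρ ≤ (k + 1) * 4 ^ k * μ k := fun i hi => by
    have h3 : ∀ r : Fin (k + 1), (rowsOf u' (k + 1) * Xᵀ) r i ^ 2 * ρ ≤ 4 ^ k * μ k := fun r => by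
      have h4 := IsPivot.sq_dot_le hX hX1 hpiv r.2 i
      rw [rowsOf_mul_apply]
      -- Residuals only shrink along the run, so `ρ` is at most the residual of row `b` at step `r`,
      -- hence at most that of the pivot.
      have h5 : ρ ≤ residual u' r (W (a' r)) ⬝ᵥ residual u' r (W (a' r)) := by
        refine le_trans ?_ ((hpiv r r.2).2 b)
        have := residual_dot_self_succ_le (ho'.mono (Nat.le_succ k)) (Nat.lt_succ_iff.1 r.2) (W b)
        rwa [hres k le_rfl] at this
      calc _ ≤ _ := mul_le_mul_of_nonneg_left h5 (sq_nonneg _)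
        _ ≤ _ := h4
        _ ≤ _ := mul_le_mul (pow_le_pow_right₀ (by norm_num) (Nat.lt_succ_iff.1 r.2)) (hμ hi)
          (hμ0 _) (by positivity)
    rw [hc, Finset.sum_mul]
    calc _ ≤ ∑ r : Fin (k + 1), 4 ^ k * μ k := Finset.sum_le_sum fun r _ => h3 r
      _ = _ := by simp; ring
  have h6 : (1 : ℝ) ≤ ∑ i : Fin n, if k ≤ (i : ℕ) then c i else 0 := by
    have h7 : ∑ i : Fin n, (if (i : ℕ) < k then c i else 0) ≤ k := by
      calc _ ≤ ∑ i : Fin n, (if (i : ℕ) < k then (1 : ℝ) else 0) :=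
            Finset.sum_le_sum fun i _ => by split_ifs; exacts [hc1 i, le_rfl]
        _ = ∑ i ∈ Finset.range n, (if i < k then (1 : ℝ) else 0) :=
            (Finset.sum_range fun i => if i < k then (1 : ℝ) else 0).symm
        _ ≤ k := by
            rw [Finset.sum_ite, Finset.sum_const_zero, add_zero, Finset.sum_const, nsmul_one]
            have : (Finset.filter (fun i => i < k) (Finset.range n)).card ≤ k := by
              calc _ ≤ (Finset.range k).card := Finset.card_le_card fun i hi => by
                    simpa using (Finset.mem_filter.1 hi).2
                _ = k := Finset.card_range k
            exact_mod_cast this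
    have h8 : ∑ i, c i = ∑ i : Fin n, (if (i : ℕ) < k then c i else 0)
        + ∑ i : Fin n, (if k ≤ (i : ℕ) then c i else 0) := by
      rw [← Finset.sum_add_distrib]
      refine Finset.sum_congr rfl fun i _ => ?_
      by_cases h : (i : ℕ) < k
      · simp [h]
      · simp [h, not_lt.1 h]
    linarith
  calc ρ = 1 * ρ := (one_mul ρ).symm
    _ ≤ (∑ i : Fin n, if k ≤ (i : ℕ) then c i else 0) * ρ := mul_le_mul_of_nonneg_right h6 hρ0
    _ = ∑ i : Fin n, (if k ≤ (i : ℕ) then c i else 0) * ρ := Finset.sum_mul _ _ _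
    _ ≤ ∑ i : Fin n, (k + 1) * 4 ^ k * μ k := Finset.sum_le_sum fun i _ => by
        split_ifs with h
        · exact hcρ i h
        · have := hμ0 k
          rw [zero_mul]; positivity
    _ = _ := by simp; ring

/-- The projection of a run of pivot steps has small weight on eigenvectors with
small eigenvalues. -/
theorem weight_mul_le {W : Matrix I J ℝ} {μ : ℕ → ℝ} {X : Matrix (Fin n) J ℝ}
    (hX : Wᵀ * W = Xᵀ * diagonal (fun i : Fin n => μ i) * X) (hX1 : X * Xᵀ = 1)
    (hX2 : Xᵀ * X = 1) (hμ : Antitone μ) (hμ0 : ∀ i, 0 ≤ μ i) (hμn : ∀ i, n ≤ i → μ i = 0)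
    {u : ℕ → J → ℝ} {k : ℕ} {a : ℕ → I} (ha : ∀ j < k, IsPivot W u j (a j)) (i : Fin n) :
    (∑ r, (rowsOf u k * Xᵀ) r i ^ 2) * μ k ≤ Fintype.card I * k * 4 ^ k * μ i := by
  have ho : OrthoUpTo u k := orthoUpTo_of_steps fun j hj => ⟨_, (ha j hj).1⟩
  rw [Finset.sum_mul]
  have h : ∀ r : Fin k, (rowsOf u k * Xᵀ) r i ^ 2 * μ k ≤ Fintype.card I * (4 ^ k * μ i) := by
    intro r
    set ρ := residual u r (W (a r)) ⬝ᵥ residual u r (W (a r)) with hρ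
    -- Before step `r < k` the run has projected onto only `r` dimensions, so the total squared
    -- residual is at least the tail of the spectrum from `r` on. That tail contains `μ k`, and the
    -- pivot row has at least the average share.
    have h1 : μ k ≤ Fintype.card I * ρ := by
      have hor := ho.mono r.2.le
      have h2 : frobSq (W - W * (rowsOf u r)ᵀ * rowsOf u r) ≤ Fintype.card I * ρ := by
        rw [frobSq_sub_rowsOf hor]
        calc _ ≤ ∑ a : I, ρ := Finset.sum_le_sum fun b _ => (ha r r.2).2 b
          _ = _ := by simp
      refine le_trans ?_ h2
      rw [frobSq_sub_proj _ hor.rows_mul_transpose]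
      have h3 := frobSq_mul_le_sum W hX hX2 hμ hμ0 hor.rows_mul_transpose (k := r) (by simp)
      rw [frobSq_eq_sum W hX hX1]
      rcases lt_or_ge k n with hk | hk
      · have h4 : μ k ≤ ∑ i ∈ Finset.Ico (r : ℕ) n, μ i :=
          Finset.single_le_sum (fun i _ => hμ0 i) (Finset.mem_Ico.2 ⟨r.2.le, hk⟩)
        rw [← Finset.sum_range_add_sum_Ico μ (r.2.le.trans hk.le)]
        linarith
      · rw [hμn k hk]
        have h4 := frobSq_mul_coisometry_le W hor.rows_mul_transpose
        rw [frobSq_eq_sum W hX hX1] at h4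
        linarith
    have h5 := IsPivot.sq_dot_le hX hX1 ha r.2 i
    rw [rowsOf_mul_apply]
    calc _ ≤ (u r ⬝ᵥ X i) ^ 2 * (Fintype.card I * ρ) :=
          mul_le_mul_of_nonneg_left h1 (sq_nonneg _)
      _ = Fintype.card I * ((u r ⬝ᵥ X i) ^ 2 * ρ) := by ring
      _ ≤ Fintype.card I * (4 ^ (r : ℕ) * μ i) :=
          mul_le_mul_of_nonneg_left h5 (Nat.cast_nonneg _)
      _ ≤ _ := by
          have := hμ0 i
          have h6 : (4 : ℝ) ^ (r : ℕ) ≤ 4 ^ k := pow_le_pow_right₀ (by norm_num) r.2.le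
          gcongr
  calc _ ≤ ∑ r : Fin k, Fintype.card I * (4 ^ k * μ i) := Finset.sum_le_sum fun r _ => h r
    _ = _ := by simp; ring

/-- Pivoted Gram–Schmidt on the rows of a high power finds a nearly optimal projection. -/
theorem IsGreedy.frobSq_le {M W : Matrix I J ℝ} {T : ℕ} (hT : 0 < T)
    (hW : Wᵀ * W = (Mᵀ * M) ^ T) {u : ℕ → J → ℝ} {k : ℕ} (hg : IsGreedy W u k)
    (hk0 : 0 < k) (hk : k ≤ Fintype.card J) {x : ℝ} (hx : 0 ≤ x)
    (hxT : Fintype.card J * (Fintype.card I * (k + 1) * Fintype.card J * 4 ^ k) ≤ x * T) :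
    rowsOf u k * (rowsOf u k)ᵀ = 1 ∧
    frobSq (M - M * (rowsOf u k)ᵀ * rowsOf u k)
      ≤ (1 + x) * (frobSq M - ∑ i ∈ Finset.range k, sval M i ^ 2) := by
  have ho : OrthoUpTo u k := orthoUpTo_of_steps hg.steps
  refine ⟨ho.rows_mul_transpose, ?_⟩
  obtain ⟨n, hn, X, hX1, hX2, hX⟩ : ∃ n, Fintype.card J = n ∧ ∃ X : Matrix (Fin n) J ℝ,
      X * Xᵀ = 1 ∧ Xᵀ * X = 1 ∧ Mᵀ * M = Xᵀ * diagonal (fun i : Fin n => sval M i ^ 2) * X :=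
    ⟨_, rfl, exists_spectral M⟩
  have htail := tail_eq M k
  rw [hn] at hk hxT htail
  set l : ℕ → ℝ := fun i => sval M i ^ 2 with hl
  have hl0 : ∀ i, 0 ≤ l i := fun i => sq_nonneg _
  have hla : Antitone l := sq_sval_antitone M
  set μ : ℕ → ℝ := fun i => l i ^ T with hμ
  have hμ0 : ∀ i, 0 ≤ μ i := fun i => pow_nonneg (hl0 i) T
  have hμa : Antitone μ := fun i j h => pow_le_pow_left₀ (hl0 j) (hla h) T
  have hln : ∀ i, n ≤ i → l i = 0 := fun i hi => by
    simp [hl, sval_eq_zero_of_card_le M (hn.trans_le hi)]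
  have hμn : ∀ i, n ≤ i → μ i = 0 := fun i hi => by simp [hμ, hln i hi, hT.ne']
  have hXW : Wᵀ * W = Xᵀ * diagonal (fun i : Fin n => μ i) * X := by
    rw [hW, hX]
    have : ∀ t : ℕ, (Xᵀ * diagonal (fun i : Fin n => l i) * X) ^ t
        = Xᵀ * diagonal (fun i : Fin n => l i ^ t) * X := fun t => by
      induction t with
      | zero => simp [hX2]
      | succ t ih =>
        rw [pow_succ, ih]
        have e : Xᵀ * diagonal (fun i : Fin n => l i ^ t) * X
            * (Xᵀ * diagonal (fun i : Fin n => l i) * X)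
            = Xᵀ * (diagonal (fun i : Fin n => l i ^ t) * (X * Xᵀ)
              * diagonal (fun i : Fin n => l i)) * X := by
          simp only [Matrix.mul_assoc]
        rw [e, hX1, Matrix.mul_one, diagonal_mul_diagonal]
        simp only [← pow_succ]
    exact this T
  set c : Fin n → ℝ := fun i => ∑ r, (rowsOf u k * Xᵀ) r i ^ 2 with hc
  have hc0 : ∀ i, 0 ≤ c i := fun i => Finset.sum_nonneg fun _ _ => sq_nonneg _
  have hc1 : ∀ i, c i ≤ 1 :=
    sum_sq_col_le_one (mul_transpose_coisometry hX2 ho.rows_mul_transpose)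
  have hcs : ∑ i, c i = k := by
    have := sum_sum_sq_eq_card hX2 ho.rows_mul_transpose
    simpa [hc] using this
  have eW : frobSq (W - W * (rowsOf u k)ᵀ * rowsOf u k) = ∑ i : Fin n, μ i * (1 - c i) :=
    frobSq_sub_rowsOf_eq hXW hX1 ho
  have eM : frobSq (M - M * (rowsOf u k)ᵀ * rowsOf u k) = ∑ i : Fin n, l i * (1 - c i) :=
    frobSq_sub_rowsOf_eq (μ := l) hX hX1 ho
  have htail0 : 0 ≤ ∑ i ∈ Finset.Ico k n, l i := Finset.sum_nonneg fun i _ => hl0 i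
  rw [htail]
  change _ ≤ (1 + x) * ∑ i ∈ Finset.Ico k n, l i
  have hterm : ∀ i : Fin n, μ i * (1 - c i) ≤ frobSq (W - W * (rowsOf u k)ᵀ * rowsOf u k) :=
    fun i => by
      rw [eW]
      exact Finset.single_le_sum (f := fun i : Fin n => μ i * (1 - c i))
        (fun i _ => mul_nonneg (hμ0 i) (sub_nonneg.2 (hc1 i))) (Finset.mem_univ i)
  -- If the residuals vanish early, every eigenvector with positive eigenvalue is captured fully,
  -- and the arbitrary steps afterwards cannot spoil this. Otherwise all `k` steps are pivot steps.
  by_cases hdeg : ∃ j < k, ∀ b, residual u j (W b) = 0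
  · obtain ⟨j, hj, hz⟩ := hdeg
    have h0 : frobSq (W - W * (rowsOf u k)ᵀ * rowsOf u k) = 0 := by
      rw [frobSq_sub_rowsOf ho]
      exact Finset.sum_eq_zero fun a _ => by rw [residual_zero hj.le (hz a), zero_dotProduct]
    have h1 : frobSq (M - M * (rowsOf u k)ᵀ * rowsOf u k) = 0 := by
      rw [eM]
      refine Finset.sum_eq_zero fun i _ => ?_
      have h2 := hterm i
      rw [h0] at h2
      have h3 : μ i * (1 - c i) = 0 :=
        le_antisymm h2 (mul_nonneg (hμ0 i) (sub_nonneg.2 (hc1 i)))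
      rcases mul_eq_zero.1 h3 with h4 | h4
      · rw [pow_eq_zero_iff hT.ne' |>.1 h4, zero_mul]
      · rw [h4, mul_zero]
    rw [h1]
    positivity
  · push Not at hdeg
    have hpiv : ∀ j : ℕ, ∃ a : I, j < k → IsPivot W u j a := fun j => by
      by_cases hj : j < k
      · rcases hg j hj with ⟨a, ha⟩ | ⟨h0, -⟩
        · exact ⟨a, fun _ => ha⟩
        · obtain ⟨b, hb⟩ := hdeg j hj
          exact absurd (h0 b) hb
      · obtain ⟨b, -⟩ := hdeg 0 hk0
        exact ⟨b, fun h => absurd h hj⟩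
    choose a ha using hpiv
    set F : ℝ := Fintype.card I * (k + 1) * n * 4 ^ k with hF
    have hF0 : 0 ≤ F := by positivity
    have hE := frobSq_residual_le hXW hX1 hX2 hμa hμ0 ha
    have hC := weight_mul_le hXW hX1 hX2 hμa hμ0 hμn ha
    set w : Fin n → ℝ := fun i => if (i : ℕ) < k then 1 else 0 with hw
    have hws : ∑ i, w i = k := by
      rw [hw, ← Finset.sum_range fun i => if i < k then (1 : ℝ) else 0, Finset.sum_ite,
        Finset.sum_const_zero, add_zero, Finset.sum_const, nsmul_one]
      congr 1
      have : Finset.filter (fun i => i < k) (Finset.range n) = Finset.range k := by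
        ext i; simp; omega
      rw [this, Finset.card_range]
    -- The weight `w` is that of the ideal projection. Below `k` the pivot run lacks weight `1 - c
    -- i`, and from `k` on it has superfluous weight `c i`.
    have hterm2 : ∀ i : Fin n, T * ((l i - l k) * (w i - c i)) ≤ F * l k := by
      intro i
      by_cases hi : (i : ℕ) < k
      · have e : w i = 1 := if_pos hi
        rw [e]
        refine mul_sub_le_of_power hT (hl0 k) (hla hi.le) (sub_nonneg.2 (hc1 i)) ?_
        rw [mul_comm]
        exact (hterm i).trans hE
      · have e : w i = 0 := if_neg hi
        have e2 : (l i - l k) * (w i - c i) = (l k - l i) * c i := by rw [e]; ring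
        rw [e2]
        refine mul_sub_le_of_power' (hl0 i) (hla (not_lt.1 hi)) hF0 ((hC i).trans ?_)
        have hn1 : (1 : ℝ) ≤ n := by
          have := i.2
          exact_mod_cast (by omega : 1 ≤ n)
        have : (Fintype.card I * k * 4 ^ k : ℝ) ≤ F := by
          rw [hF]
          have h1 : (k : ℝ) ≤ (k + 1) * n := by nlinarith [(Nat.cast_nonneg k : (0 : ℝ) ≤ k)]
          calc (Fintype.card I * k * 4 ^ k : ℝ) ≤ Fintype.card I * ((k + 1) * n) * 4 ^ k := by
                gcongr
            _ = _ := by ring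
        exact mul_le_mul_of_nonneg_right this (hμ0 i)
    -- Both weights have total `k`, so shifting all eigenvalues by `l k` does not change the excess
    -- over the tail. Each of the `n` terms is then at most `F l k / T`.
    have hdef : frobSq (M - M * (rowsOf u k)ᵀ * rowsOf u k) - ∑ i ∈ Finset.Ico k n, l i
        = ∑ i : Fin n, (l i - l k) * (w i - c i) := by
      have h1 : ∑ i ∈ Finset.range k, l i = ∑ i : Fin n, l i * w i := by
        rw [hw, ← Finset.sum_range fun i => l i * if i < k then (1 : ℝ) else 0]
        simp only [mul_ite, mul_one, mul_zero]
        rw [Finset.sum_ite, Finset.sum_const_zero, add_zero]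
        congr 1
        ext i; simp; omega
      have h2 : frobSq M = ∑ i : Fin n, l i := by
        rw [frobSq_eq_sum M (l := l) hX hX1, Finset.sum_range]
      have htail' : frobSq M - ∑ i ∈ Finset.range k, l i = ∑ i ∈ Finset.Ico k n, l i := htail
      rw [← htail', eM, h1, h2]
      have h3 : ∑ i : Fin n, (l i - l k) * (w i - c i)
          = ∑ i : Fin n, l i * w i - ∑ i : Fin n, l i * c i - l k * (∑ i, w i - ∑ i, c i) := by
        rw [← Finset.sum_sub_distrib, ← Finset.sum_sub_distrib, Finset.mul_sum,
          ← Finset.sum_sub_distrib]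
        exact Finset.sum_congr rfl fun i _ => by ring
      rw [h3, hws, hcs]
      simp only [mul_sub, mul_one, Finset.sum_sub_distrib]
      ring
    have hlk : l k ≤ ∑ i ∈ Finset.Ico k n, l i := by
      rcases lt_or_ge k n with h | h
      · exact Finset.single_le_sum (fun i _ => hl0 i) (Finset.mem_Ico.2 ⟨le_rfl, h⟩)
      · rw [hln k h]; exact htail0
    have hTpos : (0 : ℝ) < T := by exact_mod_cast hT
    have hsum : T * ∑ i : Fin n, (l i - l k) * (w i - c i) ≤ T * (x * l k) := by
      rw [Finset.mul_sum]
      calc _ ≤ ∑ i : Fin n, F * l k := Finset.sum_le_sum fun i _ => hterm2 i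
        _ = n * F * l k := by simp; ring
        _ ≤ x * T * l k := mul_le_mul_of_nonneg_right hxT (hl0 k)
        _ = _ := by ring
    have := le_of_mul_le_mul_left hsum hTpos
    have h4 : x * l k ≤ x * ∑ i ∈ Finset.Ico k n, l i := mul_le_mul_of_nonneg_left hlk hx
    linarith

end Greedy

end KronLRA


namespace KronLRA

/-! ### Memory updates that ignore the clock. -/

section Machine

/-- The same memory with another time. -/
def State.withTime (s : State) (t : ℕ) : State := { s with time := t }

def State.setNv (s : State) (x v : ℕ) : State := { s with nv := Function.update s.nv x v }

noncomputable def State.setRv (s : State) (x : ℕ) (v : ℝ) : State :=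
  { s with rv := Function.update s.rv x v }

def State.putNa (s : State) (a i v : ℕ) : State :=
  { s with na := Function.update s.na a (Function.update (s.na a) i v) }

noncomputable def State.putRa (s : State) (a i : ℕ) (v : ℝ) : State :=
  { s with ra := Function.update s.ra a (Function.update (s.ra a) i v) }

variable (s : State) (x y v a b i j : ℕ) (w : ℝ)

@[simp] theorem setNv_nv : (s.setNv x v).nv y = if y = x then v else s.nv y :=
  Function.update_apply _ _ _ _
@[simp] theorem setNv_rv : (s.setNv x v).rv = s.rv := rfl
@[simp] theorem setNv_na : (s.setNv x v).na = s.na := rfl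
@[simp] theorem setNv_ra : (s.setNv x v).ra = s.ra := rfl
@[simp] theorem setRv_nv : (s.setRv x w).nv = s.nv := rfl
@[simp] theorem setRv_rv : (s.setRv x w).rv y = if y = x then w else s.rv y :=
  Function.update_apply _ _ _ _
@[simp] theorem setRv_na : (s.setRv x w).na = s.na := rfl
@[simp] theorem setRv_ra : (s.setRv x w).ra = s.ra := rfl
@[simp] theorem putNa_nv : (s.putNa a i v).nv = s.nv := rfl
@[simp] theorem putNa_rv : (s.putNa a i v).rv = s.rv := rfl
@[simp] theorem putNa_na : (s.putNa a i v).na b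
    = if b = a then Function.update (s.na a) i v else s.na b := Function.update_apply _ _ _ _
@[simp] theorem putNa_ra : (s.putNa a i v).ra = s.ra := rfl
@[simp] theorem putRa_nv : (s.putRa a i w).nv = s.nv := rfl
@[simp] theorem putRa_rv : (s.putRa a i w).rv = s.rv := rfl
@[simp] theorem putRa_na : (s.putRa a i w).na = s.na := rfl
@[simp] theorem putRa_ra : (s.putRa a i w).ra b
    = if b = a then Function.update (s.ra a) i w else s.ra b := Function.update_apply _ _ _ _

theorem NExp.eval_withTime (e : NExp) : e.eval (s.withTime i) = e.eval s := by
  induction e with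
  | lit c => rfl
  | var x => rfl
  | get a e ih => simp only [NExp.eval, ih]; rfl
  | add e f ihe ihf => simp only [NExp.eval, ihe, ihf]
  | sub e f ihe ihf => simp only [NExp.eval, ihe, ihf]

theorem RExp.eval_withTime (e : RExp) : e.eval (s.withTime i) = e.eval s := by
  induction e with
  | ofNat e => simp only [RExp.eval, NExp.eval_withTime]
  | var x => rfl
  | get a e => simp only [RExp.eval, NExp.eval_withTime]; rfl
  | add e f ihe ihf => simp only [RExp.eval, ihe, ihf]
  | sub e f ihe ihf => simp only [RExp.eval, ihe, ihf]
  | mul e f ihe ihf => simp only [RExp.eval, ihe, ihf]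
  | div e f ihe ihf => simp only [RExp.eval, ihe, ihf]
  | sqrt e ih => simp only [RExp.eval, ih]

theorem Test.eval_withTime (t : Test) : t.eval (s.withTime i) = t.eval s := by
  induction t with
  | ltN e f => simp only [Test.eval, NExp.eval_withTime]
  | ltR e f => simp only [Test.eval, RExp.eval_withTime]
  | not t ih => simp only [Test.eval, ih]
  | and t u iht ihu => simp only [Test.eval, iht, ihu]

end Machine

/-! ### Triples with time bounds for deterministic programs. -/

section Exec

/-- Started in the memory `s`, the program makes no random choices, stops within `T` steps,
and the final memory satisfies `Q`. -/
def Exec (p : Prog) (s : State) (T : ℕ) (Q : State → Prop) : Prop :=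
  ∀ N, T < N → ∀ t, ∃ s' t', p.eval N (s.withTime t) = PMF.pure (some (s'.withTime t')) ∧
    t' ≤ t + T ∧ Q s'

variable {p r : Prog} {s : State} {T T' T₁ T₂ : ℕ} {Q Q' : State → Prop}

theorem Exec.le (h : Exec p s T Q) (hT : T ≤ T') : Exec p s T' Q := fun N hN t => by
  obtain ⟨s', t', h1, h2, h3⟩ := h N (hT.trans_lt hN) t
  exact ⟨s', t', h1, by omega, h3⟩

theorem Exec.mono (h : Exec p s T Q) (hQ : ∀ s', Q s' → Q' s') : Exec p s T Q' := fun N hN t => by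
  obtain ⟨s', t', h1, h2, h3⟩ := h N hN t
  exact ⟨s', t', h1, h2, hQ s' h3⟩

theorem Exec.skip (h : Q s) : Exec .skip s 1 Q := fun _ _ t =>
  ⟨s, t + 1, rfl, le_rfl, h⟩

theorem Exec.setN {x : ℕ} {e : NExp} (h : Q (s.setNv x (e.eval s))) :
    Exec (.setN x e) s (e.cost + 1) Q := fun _ _ t =>
  ⟨_, t + (e.cost + 1), by rw [Prog.eval, NExp.eval_withTime]; rfl, le_rfl, h⟩

theorem Exec.setR {x : ℕ} {e : RExp} (h : Q (s.setRv x (e.eval s))) :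
    Exec (.setR x e) s (e.cost + 1) Q := fun _ _ t =>
  ⟨_, t + (e.cost + 1), by rw [Prog.eval, RExp.eval_withTime]; rfl, le_rfl, h⟩

theorem Exec.putN {a : ℕ} {i e : NExp} (h : Q (s.putNa a (i.eval s) (e.eval s))) :
    Exec (.putN a i e) s (i.cost + e.cost + 1) Q := fun _ _ t =>
  ⟨_, t + (i.cost + e.cost + 1), by rw [Prog.eval, NExp.eval_withTime, NExp.eval_withTime]; rfl,
    le_rfl, h⟩

theorem Exec.putR {a : ℕ} {i : NExp} {e : RExp} (h : Q (s.putRa a (i.eval s) (e.eval s))) :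
    Exec (.putR a i e) s (i.cost + e.cost + 1) Q := fun _ _ t =>
  ⟨_, t + (i.cost + e.cost + 1), by rw [Prog.eval, NExp.eval_withTime, RExp.eval_withTime]; rfl,
    le_rfl, h⟩

theorem Exec.seq (h : Exec p s T₁ fun s' => Exec r s' T₂ Q) : Exec (.seq p r) s (T₁ + T₂) Q :=
  fun N hN t => by
    obtain ⟨s', t', h1, h2, h3⟩ := h N (by omega) t
    obtain ⟨s'', t'', h4, h5, h6⟩ := h3 N (by omega) t'
    refine ⟨s'', t'', ?_, by omega, h6⟩
    rw [Prog.eval, andThen, h1, PMF.pure_bind]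
    exact h4

theorem withTime_tick (s : State) (t c : ℕ) : (s.withTime t).tick c = s.withTime (t + c) := rfl

theorem Exec.ite {t : Test} (h1 : t.eval s = true → Exec p s T Q)
    (h2 : t.eval s = false → Exec r s T Q) : Exec (.ite t p r) s (T + (t.cost + 1)) Q :=
  fun N hN u => by
    rw [Prog.eval, Test.eval_withTime, withTime_tick]
    cases ht : t.eval s with
    | true =>
      obtain ⟨s', t', h3, h4, h5⟩ := h1 ht N (by omega) (u + (t.cost + 1))
      exact ⟨s', t', by rw [if_pos rfl]; exact h3, by omega, h5⟩
    | false =>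
      obtain ⟨s', t', h3, h4, h5⟩ := h2 ht N (by omega) (u + (t.cost + 1))
      exact ⟨s', t', by rw [if_neg (by simp)]; exact h3, by omega, h5⟩

/-- Every round costs at least one unit, so a cut-off `N` above the time bound also exceeds the
number of rounds; one threshold serves both. The last summand is the final, failing test. -/
theorem Exec.loop {t : Test} (n : ℕ) (I : ℕ → State → Prop) (h0 : I 0 s)
    (hstep : ∀ i < n, ∀ s, I i s → t.eval s = true ∧ Exec p s T (I (i + 1)))
    (hend : ∀ s, I n s → t.eval s = false ∧ Q s) :
    Exec (.loop t p) s (n * (T + (t.cost + 1)) + (t.cost + 1)) Q := by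
  intro N hN u
  have key : ∀ r i, i + r = n → ∀ N', r < N' → ∀ s, I i s → ∀ u, ∃ s' t',
      loopEval t (p.eval N) N' (s.withTime u) = PMF.pure (some (s'.withTime t')) ∧
        t' ≤ u + (r * (T + (t.cost + 1)) + (t.cost + 1)) ∧ Q s' := by
    intro r
    induction r with
    | zero =>
      intro i hi N' hN' s hs u
      obtain ⟨N', rfl⟩ := Nat.exists_eq_succ_of_ne_zero hN'.ne'
      obtain rfl : i = n := hi
      obtain ⟨h1, h2⟩ := hend s hs
      refine ⟨s, u + (t.cost + 1), ?_, by omega, h2⟩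
      rw [loopEval, Test.eval_withTime, h1, if_neg (by simp)]
      rfl
    | succ r ih =>
      intro i hi N' hN' s hs u
      obtain ⟨N', rfl⟩ := Nat.exists_eq_succ_of_ne_zero (by omega : N' ≠ 0)
      obtain ⟨h1, h2⟩ := hstep i (by omega) s hs
      have hTN : T < N := by
        refine lt_of_le_of_lt ?_ hN
        have : T ≤ n * (T + (t.cost + 1)) :=
          (Nat.le_add_right _ _).trans (Nat.le_mul_of_pos_left _ (by omega))
        omega
      obtain ⟨s', t', h3, h4, h5⟩ := h2 N hTN (u + (t.cost + 1))
      obtain ⟨s'', t'', h6, h7, h8⟩ := ih (i + 1) (by omega) N' (by omega) s' h5 t'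
      refine ⟨s'', t'', ?_, ?_, h8⟩
      · rw [loopEval, Test.eval_withTime, h1, if_pos rfl, withTime_tick, andThen, h3, PMF.pure_bind]
        exact h6
      · rw [Nat.succ_mul]; omega
  rw [Prog.eval]
  refine key n 0 (by omega) N ?_ s h0 u
  refine lt_of_le_of_lt ?_ hN
  have : n ≤ n * (T + (t.cost + 1)) := Nat.le_mul_of_pos_right _ (by omega)
  omega

/-- `for x < b do body`, where `b` is a register. -/
def forN (x b : ℕ) (body : Prog) : Prog :=
  .seq (.setN x (.lit 0)) (.loop (.ltN (.var x) (.var b))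
    (.seq body (.setN x (.add (.var x) (.lit 1)))))

/-- Per round, `8` covers the test and the increment; the final `6` covers the initialization and
the failing test. The body has to preserve the counter. -/
theorem Exec.forN {x b : ℕ} (n : ℕ) (I : ℕ → State → Prop)
    (hb : ∀ i s, I i s → s.nv b = n)
    (h0 : I 0 (s.setNv x 0))
    (hstep : ∀ i < n, ∀ s, I i s → s.nv x = i →
      Exec p s T fun s' => s'.nv x = i ∧ I (i + 1) (s'.setNv x (i + 1)))
    (hend : ∀ s, I n s → Q s) :
    Exec (forN x b p) s (n * (T + 8) + 6) Q := by
  have h : Exec (KronLRA.forN x b p) s (2 + (n * ((T + 4) + 4) + 4)) Q := by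
    refine Exec.seq (Exec.setN ?_)
    refine Exec.loop n (fun i s => I i s ∧ s.nv x = i) ⟨h0, by simp [NExp.eval]⟩ ?_ ?_
    · intro i hi s ⟨hs, hx⟩
      refine ⟨by simp [Test.eval, NExp.eval, hb i s hs, hx, hi], ?_⟩
      refine Exec.seq ((hstep i hi s hs hx).mono fun s' h => ?_)
      refine Exec.setN ?_
      simp only [NExp.eval, h.1]
      exact ⟨h.2, by simp⟩
    · intro s ⟨hs, hx⟩
      exact ⟨by simp [Test.eval, NExp.eval, hb n s hs, hx], hend s hs⟩
  exact h.le (by ring_nf; omega)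

/-- Memories that agree except for the listed registers and arrays. -/
structure Frame (ns rs as zs : List ℕ) (s s' : State) : Prop where
  nv : ∀ x ∉ ns, s'.nv x = s.nv x
  rv : ∀ x ∉ rs, s'.rv x = s.rv x
  na : ∀ x ∉ as, s'.na x = s.na x
  ra : ∀ x ∉ zs, s'.ra x = s.ra x

variable {ns rs as zs ns' rs' as' zs' : List ℕ} {s' s'' : State}

theorem Frame.refl : Frame ns rs as zs s s :=
  ⟨fun _ _ => rfl, fun _ _ => rfl, fun _ _ => rfl, fun _ _ => rfl⟩

theorem Frame.trans (h : Frame ns rs as zs s s') (h' : Frame ns' rs' as' zs' s' s'')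
    (h1 : ns' ⊆ ns) (h2 : rs' ⊆ rs) (h3 : as' ⊆ as) (h4 : zs' ⊆ zs) :
    Frame ns rs as zs s s'' :=
  ⟨fun x hx => (h'.nv x fun h => hx (h1 h)).trans (h.nv x hx),
    fun x hx => (h'.rv x fun h => hx (h2 h)).trans (h.rv x hx),
    fun x hx => (h'.na x fun h => hx (h3 h)).trans (h.na x hx),
    fun x hx => (h'.ra x fun h => hx (h4 h)).trans (h.ra x hx)⟩

theorem Frame.setNv (h : Frame ns rs as zs s s') {x v : ℕ} (hx : x ∈ ns) :
    Frame ns rs as zs s (s'.setNv x v) :=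
  ⟨fun y hy => by rw [setNv_nv, if_neg (by rintro rfl; exact hy hx), h.nv y hy], h.rv, h.na, h.ra⟩

theorem Frame.setRv (h : Frame ns rs as zs s s') {x : ℕ} {v : ℝ} (hx : x ∈ rs) :
    Frame ns rs as zs s (s'.setRv x v) :=
  ⟨h.nv, fun y hy => by rw [setRv_rv, if_neg (by rintro rfl; exact hy hx), h.rv y hy], h.na, h.ra⟩

theorem Frame.putNa (h : Frame ns rs as zs s s') {a i v : ℕ} (ha : a ∈ as) :
    Frame ns rs as zs s (s'.putNa a i v) :=
  ⟨h.nv, h.rv, fun y hy => by rw [putNa_na, if_neg (by rintro rfl; exact hy ha), h.na y hy], h.ra⟩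

theorem Frame.putRa (h : Frame ns rs as zs s s') {a i : ℕ} {v : ℝ} (ha : a ∈ zs) :
    Frame ns rs as zs s (s'.putRa a i v) :=
  ⟨h.nv, h.rv, h.na, fun y hy => by rw [putRa_ra, if_neg (by rintro rfl; exact hy ha), h.ra y hy]⟩

end Exec

/-! ### Inner products with strides. -/

section Dot

/-- Add up products of entries of the arrays `X`, `Y`, starting at the pointers `B + 20`, `B + 22`
with strides `B + 21`, `B + 23`; the number of terms is in `B + 24`. -/
def dotProg (B X Y : ℕ) : Prog :=
  .seq (.setR 1 (.ofNat (.lit 0))) (forN (B + 25) (B + 24)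
    (.seq (.setR 1 (.add (.var 1) (.mul (.get X (.var (B + 20))) (.get Y (.var (B + 22))))))
      (.seq (.setN (B + 20) (.add (.var (B + 20)) (.var (B + 21))))
        (.setN (B + 22) (.add (.var (B + 22)) (.var (B + 23)))))))

theorem dotProg_spec (B X Y : ℕ) (s : State) :
    Exec (dotProg B X Y) s (s.nv (B + 24) * 24 + 9) fun s' =>
      Frame [B + 20, B + 22, B + 25] [1] [] [] s s' ∧
      s'.rv 1 = ∑ t ∈ Finset.range (s.nv (B + 24)),
        s.ra X (s.nv (B + 20) + t * s.nv (B + 21)) * s.ra Y (s.nv (B + 22) + t * s.nv (B + 23)) := by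
  apply Exec.le
  · apply Exec.seq
    apply Exec.setR
    apply Exec.forN (s.nv (B + 24)) (fun i s' => Frame [B + 20, B + 22, B + 25] [1] [] [] s s' ∧
      s'.nv (B + 20) = s.nv (B + 20) + i * s.nv (B + 21) ∧
      s'.nv (B + 22) = s.nv (B + 22) + i * s.nv (B + 23) ∧
      s'.rv 1 = ∑ t ∈ Finset.range i,
        s.ra X (s.nv (B + 20) + t * s.nv (B + 21)) * s.ra Y (s.nv (B + 22) + t * s.nv (B + 23)))
    · rintro i s' ⟨h, -⟩
      exact h.nv _ (by simp)
    · exact ⟨(Frame.refl.setRv (by simp)).setNv (by simp), by simp, by simp,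
        by simp [RExp.eval, NExp.eval]⟩
    · rintro i hi s' ⟨h, h1, h2, h3⟩ hx
      apply Exec.seq
      apply Exec.setR
      apply Exec.seq
      apply Exec.setN
      apply Exec.setN
      have e1 := h.nv (B + 21) (by simp)
      have e2 := h.nv (B + 23) (by simp)
      have e3 := h.ra X (by simp)
      have e4 := h.ra Y (by simp)
      refine ⟨by simp [hx], ((((h.setRv (by simp)).setNv (by simp)).setNv (by simp)).setNv (by simp)),
        ?_, ?_, ?_⟩
      · simp [NExp.eval, h1, e1]; ring
      · simp [NExp.eval, h2, e2]; ring
      · simp [RExp.eval, NExp.eval, h1, h2, h3, e3, e4, Finset.sum_range_succ]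
    · rintro s' ⟨h, -, -, h3⟩
      exact ⟨h, h3⟩
  · simp only [RExp.cost, NExp.cost]
    ring_nf
    omega

end Dot

end KronLRA


namespace KronLRA

/-! ### Arrays that are filled from the left, and row-major indices. -/

section Fill

/-- The array `g` with its first `n` entries replaced by those of `f`. -/
def fillTo {α : Type*} (f g : ℕ → α) (n : ℕ) : ℕ → α := fun z => if z < n then f z else g z

theorem fillTo_zero {α : Type*} (f g : ℕ → α) : fillTo f g 0 = g := by
  funext z; simp [fillTo]

theorem fillTo_update {α : Type*} (f g : ℕ → α) (n : ℕ) {v : α} (hv : v = f n) :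
    Function.update (fillTo f g n) n v = fillTo f g (n + 1) := by
  funext z
  rcases eq_or_ne z n with rfl | h
  · simp [fillTo, hv]
  · rw [Function.update_of_ne h]
    simp only [fillTo]
    by_cases h1 : z < n
    · rw [if_pos h1, if_pos (by omega)]
    · rw [if_neg h1, if_neg (by omega)]

theorem fillTo_of_lt {α : Type*} {f g : ℕ → α} {n z : ℕ} (h : z < n) : fillTo f g n z = f z :=
  if_pos h

theorem fillTo_of_le {α : Type*} {f g : ℕ → α} {n z : ℕ} (h : n ≤ z) : fillTo f g n z = g z :=
  if_neg (by omega)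

/-- A matrix stored row by row. -/
def arrMat (f : ℕ → ℝ) (a b : ℕ) : Matrix (Fin a) (Fin b) ℝ := Matrix.of fun i j => f (i * b + j)

theorem index_lt {a b i j : ℕ} (hi : i < a) (hj : j < b) : i * b + j < a * b := by
  calc i * b + j < i * b + b := by omega
    _ = (i + 1) * b := by ring
    _ ≤ a * b := Nat.mul_le_mul_right _ hi

theorem index_div {b i j : ℕ} (hj : j < b) : (i * b + j) / b = i := by
  rw [mul_comm, Nat.mul_add_div (by omega), Nat.div_eq_of_lt hj, add_zero]

theorem index_mod {b i j : ℕ} (hj : j < b) : (i * b + j) % b = j := by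
  rw [mul_comm, Nat.mul_add_mod, Nat.mod_eq_of_lt hj]

end Fill

/-! ### Matrix products, copying and integer multiplication. -/

section MatProg

/-- A product of two matrices that are read with strides; `B + 30`, `B + 31`, `B + 24` hold the
number of rows, columns and terms, `B + 32`, `B + 21` the strides of `X`, and
`B + 33`, `B + 23` the strides of `Y`. -/
def matProg (B X Y Z : ℕ) : Prog :=
  .seq (.setN (B + 36) (.lit 0)) (.seq (.setN (B + 38) (.lit 0))
    (forN (B + 34) (B + 30) (.seq (.setN (B + 37) (.lit 0))
      (.seq (forN (B + 35) (B + 31)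
        (.seq (.setN (B + 20) (.var (B + 36))) (.seq (.setN (B + 22) (.var (B + 37)))
          (.seq (dotProg B X Y) (.seq (.putR Z (.var (B + 38)) (.var 1))
            (.seq (.setN (B + 38) (.add (.var (B + 38)) (.lit 1)))
              (.setN (B + 37) (.add (.var (B + 37)) (.var (B + 33))))))))))
        (.setN (B + 36) (.add (.var (B + 36)) (.var (B + 32))))))))

/-- The entries of a product of matrices that are read with strides. -/
noncomputable def strided (x y : ℕ → ℝ) (len xr xi yr yi a b : ℕ) : ℝ :=
  ∑ t ∈ Finset.range len, x (a * xr + t * xi) * y (b * yr + t * yi)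

/-- All addresses come from pointers moved by additions. The final write pointer in `B + 38` is
recorded because it yields products of dimensions for free: the length of later copies, and the
place where unit vectors are appended. -/
theorem matProg_spec {B X Y Z : ℕ} (hX : X ≠ Z) (hY : Y ≠ Z) (s : State) :
    Exec (matProg B X Y Z) s
      (s.nv (B + 30) * (s.nv (B + 31) * (s.nv (B + 24) * 24 + 32) + 21) + 10) fun s' =>
      Frame [B + 20, B + 22, B + 25, B + 34, B + 35, B + 36, B + 37, B + 38] [1] [] [Z] s s' ∧
      s'.nv (B + 38) = s.nv (B + 30) * s.nv (B + 31) ∧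
      s'.ra Z = fillTo (fun z => strided (s.ra X) (s.ra Y) (s.nv (B + 24)) (s.nv (B + 32))
          (s.nv (B + 21)) (s.nv (B + 33)) (s.nv (B + 23)) (z / s.nv (B + 31)) (z % s.nv (B + 31)))
        (s.ra Z) (s.nv (B + 30) * s.nv (B + 31)) := by
  set C := s.nv (B + 31) with hC
  set val : ℕ → ℝ := fun z => strided (s.ra X) (s.ra Y) (s.nv (B + 24)) (s.nv (B + 32))
          (s.nv (B + 21)) (s.nv (B + 33)) (s.nv (B + 23)) (z / C) (z % C) with hval
  apply Exec.le
  · apply Exec.seq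
    apply Exec.setN
    apply Exec.seq
    apply Exec.setN
    apply Exec.forN (s.nv (B + 30)) (fun a s' =>
      Frame [B + 20, B + 22, B + 25, B + 34, B + 35, B + 36, B + 37, B + 38] [1] [] [Z] s s' ∧
      s'.nv (B + 36) = a * s.nv (B + 32) ∧ s'.nv (B + 38) = a * C ∧
      s'.ra Z = fillTo val (s.ra Z) (a * C))
    · rintro i s' ⟨h, -⟩
      exact h.nv _ (by simp)
    · exact ⟨((Frame.refl.setNv (by simp)).setNv (by simp)).setNv (by simp), by simp [NExp.eval],
        by simp [NExp.eval], by simp [fillTo_zero]⟩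
    · rintro a ha s₁ ⟨h, h1, h2, h3⟩ hx
      apply Exec.seq
      apply Exec.setN
      apply Exec.seq
      apply Exec.forN C (fun b s' =>
        Frame [B + 20, B + 22, B + 25, B + 34, B + 35, B + 36, B + 37, B + 38] [1] [] [Z] s s' ∧
        s'.nv (B + 34) = a ∧
        s'.nv (B + 36) = a * s.nv (B + 32) ∧ s'.nv (B + 37) = b * s.nv (B + 33) ∧
        s'.nv (B + 38) = a * C + b ∧ s'.ra Z = fillTo val (s.ra Z) (a * C + b))
      · rintro i s' ⟨h, -⟩
        exact h.nv _ (by simp)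
      · exact ⟨(h.setNv (by simp)).setNv (by simp), by simp [hx], by simp [h1],
          by simp [NExp.eval], by simp [h2], by simp [h3]⟩
      · rintro b hb s₂ ⟨g, g0, g1, g2, g3, g4⟩ hx2
        apply Exec.seq
        apply Exec.setN
        apply Exec.seq
        apply Exec.setN
        apply Exec.seq
        apply Exec.le
        · refine (dotProg_spec B X Y _).mono ?_
          rintro s₃ ⟨f, f1⟩
          apply Exec.seq
          apply Exec.putR
          apply Exec.seq
          apply Exec.setN
          apply Exec.setN
          have f' := ((g.setNv (x := B + 20) (v := (NExp.var (B + 36)).eval s₂) (by simp)).setNv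
            (x := B + 22) (by simp)).trans f (by simp) (by simp) (by simp) (by simp)
          have e0 := f.nv (B + 34) (by simp)
          have e1 := f.nv (B + 35) (by simp)
          have e2 := f.nv (B + 36) (by simp)
          have e3 := f.nv (B + 37) (by simp)
          have e4 := f.nv (B + 38) (by simp)
          have e5 := f.ra Z (by simp)
          have e6 := f'.nv (B + 33) (by simp)
          have c1 := g.nv (B + 24) (by simp)
          have c2 := g.nv (B + 21) (by simp)
          have c3 := g.nv (B + 23) (by simp)
          have c4 := g.ra X (by simp [hX])
          have c5 := g.ra Y (by simp [hY])
          simp only [setNv_nv, setNv_ra] at e0 e1 e2 e3 e4 e5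
          simp at e0 e1 e2 e3 e4
          refine ⟨by simp [e1, hx2], ((((f'.putRa (by simp)).setNv (by simp)).setNv
            (by simp)).setNv (by simp)), by simp [e0, g0], by simp [e2, g1],
            by simp [NExp.eval, e3, e6, g2]; ring, by simp [NExp.eval, e4, g3]; ring, ?_⟩
          simp only [setNv_ra, putRa_ra, if_true, NExp.eval, RExp.eval, e4, e5, g4, g3]
          rw [← add_assoc]
          apply fillTo_update
          rw [f1, hval]
          simp only [index_div hb, index_mod hb, strided]
          simp [NExp.eval, c1, c2, c3, c4, c5, g1, g2]
        · have c1 := g.nv (B + 24) (by simp)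
          simp only [setNv_nv]
          simp only [Nat.add_left_cancel_iff, Nat.reduceEqDiff, if_false, c1]
          exact le_rfl
      · rintro s₂ ⟨g, g0, g1, g2, g3, g4⟩
        apply Exec.setN
        have e6 := g.nv (B + 32) (by simp)
        refine ⟨by simp [g0], (g.setNv (by simp)).setNv (by simp), by simp [NExp.eval, g1, e6]; ring,
          by simp [g3]; ring, ?_⟩
        simp only [setNv_ra, g4]
        rw [add_mul, one_mul]
    · rintro s' ⟨h, -, h2, h3⟩
      exact ⟨h, h2, h3⟩
  · simp only [RExp.cost, NExp.cost]
    ring_nf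
    omega

/-- Copy the array `X` to `Y`; the length is in register `B + 5`. -/
def copyProg (B X Y : ℕ) : Prog :=
  forN (B + 39) (B + 5) (.putR Y (.var (B + 39)) (.get X (.var (B + 39))))

theorem copyProg_spec {B X Y : ℕ} (hXY : X ≠ Y) (s : State) :
    Exec (copyProg B X Y) s (s.nv (B + 5) * 12 + 6) fun s' =>
      Frame [B + 39] [] [] [Y] s s' ∧ s'.ra Y = fillTo (s.ra X) (s.ra Y) (s.nv (B + 5)) := by
  apply Exec.le
  · apply Exec.forN (s.nv (B + 5)) (fun i s' => Frame [B + 39] [] [] [Y] s s' ∧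
      s'.ra Y = fillTo (s.ra X) (s.ra Y) i)
    · rintro i s' ⟨h, -⟩
      exact h.nv _ (by simp)
    · exact ⟨Frame.refl.setNv (by simp), by simp [fillTo_zero]⟩
    · rintro i hi s' ⟨h, h1⟩ hx
      apply Exec.putR
      refine ⟨by simp [hx], (h.putRa (by simp)).setNv (by simp), ?_⟩
      simp only [setNv_ra, putRa_ra, if_true, NExp.eval, RExp.eval, hx, h1]
      exact fillTo_update _ _ _ (by rw [h.ra X (by simpa using hXY)])
    · exact fun s' h => h
  · simp only [RExp.cost, NExp.cost]
    exact le_rfl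

/-- Set register `z` to the product of the registers `x` and `y`. -/
def mulProg (B z x y : ℕ) : Prog :=
  .seq (.setN (B + 26) (.lit 0)) (.seq
    (forN (B + 27) x (.setN (B + 26) (.add (.var (B + 26)) (.var y)))) (.setN z (.var (B + 26))))

/-- Natural numbers have no multiplication on this machine, so it is repeated addition, linear in
the first factor. The sum is kept in a scratch register, which allows `z` to coincide with `x`. -/
theorem mulProg_spec {B z x y : ℕ} (hx1 : x ≠ B + 26) (hx2 : x ≠ B + 27) (hy1 : y ≠ B + 26)
    (hy2 : y ≠ B + 27) (s : State) :
    Exec (mulProg B z x y) s (s.nv x * 12 + 10) fun s' =>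
      Frame [B + 26, B + 27, z] [] [] [] s s' ∧ s'.nv z = s.nv x * s.nv y := by
  apply Exec.le
  · apply Exec.seq
    apply Exec.setN
    apply Exec.seq
    apply Exec.forN (s.nv x) (fun i s' => Frame [B + 26, B + 27] [] [] [] s s' ∧
      s'.nv (B + 26) = i * s.nv y)
    · rintro i s' ⟨h, -⟩
      exact h.nv _ (by simp [hx1, hx2])
    · exact ⟨(Frame.refl.setNv (by simp)).setNv (by simp), by simp [NExp.eval]⟩
    · rintro i hi s' ⟨h, h1⟩ hx
      apply Exec.setN
      have e := h.nv y (by simp [hy1, hy2])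
      refine ⟨by simp [hx], (h.setNv (by simp)).setNv (by simp), ?_⟩
      simp [NExp.eval, h1, e]; ring
    · rintro s' ⟨h, h1⟩
      apply Exec.setN
      exact ⟨(Frame.refl.trans h (by simp) (by simp) (by simp) (by simp)).setNv (by simp),
        by simp [NExp.eval, h1]⟩
  · simp only [NExp.cost]
    ring_nf
    omega

end MatProg

end KronLRA


namespace KronLRA

/-! ### Repeated squaring. -/

section Power

open Matrix

theorem arrMat_fillTo {f g : ℕ → ℝ} {a b : ℕ} : arrMat (fillTo f g (a * b)) a b = arrMat f a b := by
  ext i j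
  simp only [arrMat, of_apply]
  exact fillTo_of_lt (index_lt i.2 j.2)

/-- Depending on the strides, `Y` is read by rows or by columns, so one routine computes both `M Mᵀ`
and ordinary products. -/
theorem arrMat_strided {a b l : ℕ} (F : Fin a → Fin l → ℝ) (G : Fin b → Fin l → ℝ) {x y : ℕ → ℝ}
    {xr xi yr yi : ℕ} (hF : ∀ (i : Fin a) (t : Fin l), x (i * xr + t * xi) = F i t)
    (hG : ∀ (j : Fin b) (t : Fin l), y (j * yr + t * yi) = G j t) :
    arrMat (fun z => strided x y l xr xi yr yi (z / b) (z % b)) a b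
      = Matrix.of F * (Matrix.of G)ᵀ := by
  ext i j
  simp only [arrMat, of_apply, index_div j.2, index_mod j.2, strided, mul_apply, transpose_apply]
  rw [Finset.sum_range]
  exact Finset.sum_congr rfl fun t _ => by rw [hF, hG]

/-- Compute `W = (M Mᵀ) ^ (2 ^ s) M` for the matrix `M` with `B + 1` rows and `B + 2` columns,
where `s` is in register `B + 6`. -/
def powerProg (B R M : ℕ) : Prog :=
  .seq (.setN (B + 30) (.var (B + 1))) (.seq (.setN (B + 31) (.var (B + 1)))
  (.seq (.setN (B + 24) (.var (B + 2))) (.seq (.setN (B + 32) (.var (B + 2)))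
  (.seq (.setN (B + 21) (.lit 1)) (.seq (.setN (B + 33) (.var (B + 2)))
  (.seq (.setN (B + 23) (.lit 1)) (.seq (matProg B M M (R + 1))
  (.seq (.setN (B + 5) (.var (B + 38))) (.seq (.setN (B + 24) (.var (B + 1)))
  (.seq (.setN (B + 32) (.var (B + 1))) (.seq (.setN (B + 33) (.lit 1))
  (.seq (.setN (B + 23) (.var (B + 1)))
  (.seq (forN (B + 40) (B + 6) (.seq (matProg B (R + 1) (R + 1) (R + 2))
    (copyProg B (R + 2) (R + 1))))
  (.seq (.setN (B + 31) (.var (B + 2))) (.seq (.setN (B + 23) (.var (B + 2)))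
    (matProg B (R + 1) M (R + 3)))))))))))))))))

/-- The running time of `matProg`. -/
def matTime (a b l : ℕ) : ℕ := a * (b * (l * 24 + 32) + 21) + 10

def powerTime (P D σ : ℕ) : ℕ :=
  matTime P P D + (σ * (matTime P P P + (P * P * 12 + 6) + 8) + 6 + matTime P D P) + 30

/-- Squaring takes place on the `P × P` side, so `D` enters each outer product only linearly. The
array behind the result is kept unchanged since the unit vectors appended there rely on zeros. -/
theorem powerProg_spec {B R M : ℕ} (hM1 : M ≠ R + 1) (hM2 : M ≠ R + 2) (hM3 : M ≠ R + 3)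
    {P D σ : ℕ} {s : State} (hP : s.nv (B + 1) = P) (hD : s.nv (B + 2) = D)
    (hσ : s.nv (B + 6) = σ) :
    Exec (powerProg B R M) s (powerTime P D σ) fun s' =>
      Frame [B + 5, B + 20, B + 21, B + 22, B + 23, B + 24, B + 25, B + 30, B + 31, B + 32, B + 33,
        B + 34, B + 35, B + 36, B + 37, B + 38, B + 39, B + 40] [1] [] [R + 1, R + 2, R + 3] s s' ∧
      s'.nv (B + 38) = P * D ∧
      arrMat (s'.ra (R + 3)) P D
        = (arrMat (s.ra M) P D * (arrMat (s.ra M) P D)ᵀ) ^ (2 ^ σ) * arrMat (s.ra M) P D ∧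
      ∀ z, P * D ≤ z → s'.ra (R + 3) z = s.ra (R + 3) z := by
  set L := [B + 5, B + 20, B + 21, B + 22, B + 23, B + 24, B + 25, B + 30, B + 31, B + 32, B + 33,
        B + 34, B + 35, B + 36, B + 37, B + 38, B + 39, B + 40] with hL
  have hR12 : R + 1 ≠ R + 2 := by omega
  have hR13 : R + 1 ≠ R + 3 := by omega
  apply Exec.le
  · apply Exec.seq; apply Exec.setN; apply Exec.seq; apply Exec.setN
    apply Exec.seq; apply Exec.setN; apply Exec.seq; apply Exec.setN
    apply Exec.seq; apply Exec.setN; apply Exec.seq; apply Exec.setN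
    apply Exec.seq; apply Exec.setN
    generalize hs1 : (((((((s.setNv _ _).setNv _ _).setNv _ _).setNv _ _).setNv _ _).setNv _
      _).setNv _ _) = s1
    have F1 : Frame L [1] [] [R + 1, R + 2, R + 3] s s1 := by
      rw [← hs1]
      exact ((((((Frame.refl.setNv (by simp [hL])).setNv (by simp [hL])).setNv
        (by simp [hL])).setNv (by simp [hL])).setNv (by simp [hL])).setNv (by simp [hL])).setNv
        (by simp [hL])
    have r1 : s1.nv (B + 30) = P ∧ s1.nv (B + 31) = P ∧ s1.nv (B + 24) = D ∧ s1.nv (B + 32) = D ∧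
      s1.nv (B + 21) = 1 ∧ s1.nv (B + 33) = D ∧ s1.nv (B + 23) = 1 := by
      rw [← hs1]; simp [NExp.eval, hP, hD]
    obtain ⟨a1, a2, a3, a4, a5, a6, a7⟩ := r1
    apply Exec.seq
    have h1 := matProg_spec (B := B) hM1 hM1 s1
    rw [a1, a2, a3, a4, a5, a6, a7] at h1
    refine h1.mono ?_
    rintro s2 ⟨F2, b1, b2⟩
    have F2' : Frame L [1] [] [R + 1, R + 2, R + 3] s s2 :=
      F1.trans F2 (by simp [hL]) (by simp) (by simp) (by simp)
    have G2 : arrMat (s2.ra (R + 1)) P P = arrMat (s.ra M) P D * (arrMat (s.ra M) P D)ᵀ := by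
      rw [b2, arrMat_fillTo, F1.ra M (by simp [hM1, hM2, hM3])]
      exact arrMat_strided (a := P) (b := P) (l := D) _ _ (fun i t => by rw [mul_one])
        (fun i t => by rw [mul_one])
    apply Exec.seq; apply Exec.setN; apply Exec.seq; apply Exec.setN
    apply Exec.seq; apply Exec.setN; apply Exec.seq; apply Exec.setN
    apply Exec.seq; apply Exec.setN
    generalize hs3 : (((((s2.setNv _ _).setNv _ _).setNv _ _).setNv _ _).setNv _ _) = s3
    have F3 : Frame L [1] [] [R + 1, R + 2, R + 3] s s3 := by
      rw [← hs3]
      exact ((((F2'.setNv (by simp [hL])).setNv (by simp [hL])).setNv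
        (by simp [hL])).setNv (by simp [hL])).setNv (by simp [hL])
    have r3 : s3.nv (B + 30) = P ∧ s3.nv (B + 31) = P ∧ s3.nv (B + 24) = P ∧ s3.nv (B + 32) = P ∧
      s3.nv (B + 21) = 1 ∧ s3.nv (B + 33) = 1 ∧ s3.nv (B + 23) = P ∧ s3.nv (B + 5) = P * P := by
      have e1 := F2'.nv (B + 1) (by simp [hL])
      rw [← hs3]
      simp [NExp.eval, e1, hP, b1, F2.nv (B + 30) (by simp), F2.nv (B + 31) (by simp),
        F2.nv (B + 21) (by simp), a1, a2, a5]
    have G3 : arrMat (s3.ra (R + 1)) P P = arrMat (s.ra M) P D * (arrMat (s.ra M) P D)ᵀ := by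
      rw [← G2, ← hs3]; rfl
    have Z3 : s3.ra (R + 3) = s.ra (R + 3) := by
      rw [← F1.ra M (by simp [hM1, hM2, hM3])] at G3
      rw [← hs3]
      simp only [setNv_ra]
      rw [F2.ra (R + 3) (by simp), ← hs1]
      rfl
    set N := arrMat (s.ra M) P D * (arrMat (s.ra M) P D)ᵀ with hN
    -- Strides `1` and `d` run down the columns of the second array, so its transpose cancels the
    -- one in `arrMat_strided`.
    have prodH : ∀ f : ℕ → ℝ, ∀ g : ℕ → ℝ, ∀ d : ℕ,
        arrMat (fun z => strided f g P P 1 1 d (z / d) (z % d)) P d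
          = arrMat f P P * arrMat g P d := fun f g d => by
      rw [arrMat_strided (a := P) (b := d) (l := P) (fun i t => arrMat f P P i t)
        (fun j t => arrMat g P d t j) (fun i t => by rw [mul_one]; rfl)
        (fun j t => by rw [mul_one, add_comm]; rfl)]
      rfl
    apply Exec.seq
    apply Exec.forN σ (fun i s' => Frame L [1] [] [R + 1, R + 2, R + 3] s s' ∧
      (s'.nv (B + 30) = P ∧ s'.nv (B + 31) = P ∧ s'.nv (B + 24) = P ∧ s'.nv (B + 32) = P ∧
      s'.nv (B + 21) = 1 ∧ s'.nv (B + 33) = 1 ∧ s'.nv (B + 23) = P ∧ s'.nv (B + 5) = P * P) ∧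
      s'.ra (R + 3) = s.ra (R + 3) ∧ arrMat (s'.ra (R + 1)) P P = N ^ (2 ^ i))
    · rintro i s' ⟨h, -⟩
      rw [h.nv _ (by simp [hL]), hσ]
    · refine ⟨F3.setNv (by simp [hL]), ?_, Z3, by rw [pow_zero, pow_one]; exact G3⟩
      simpa using r3
    · rintro i hi s4 ⟨F4, ⟨c1, c2, c3, c4, c5, c6, c7, c8⟩, Z4, G4⟩ hx
      apply Exec.seq
      have h1 := matProg_spec (B := B) hR12 hR12 s4
      rw [c1, c2, c3, c4, c5, c6, c7] at h1
      refine h1.mono ?_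
      rintro s5 ⟨F5, -, d2⟩
      have h2 := copyProg_spec (B := B) hR12.symm s5
      rw [F5.nv (B + 5) (by simp), c8] at h2
      refine h2.mono ?_
      rintro s6 ⟨F6, f1⟩
      have F7 : Frame L [1] [] [R + 1, R + 2, R + 3] s s6 :=
        (F4.trans F5 (by simp [hL]) (by simp) (by simp) (by simp)).trans F6 (by simp [hL])
          (by simp) (by simp) (by simp)
      have nvs : ∀ x ∈ [B + 30, B + 31, B + 24, B + 32, B + 21, B + 33, B + 23, B + 5, B + 40],
          s6.nv x = s4.nv x := by
        intro x hx
        rw [F6.nv x, F5.nv x]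
        · simp only [List.mem_cons, List.not_mem_nil, or_false] at hx ⊢; omega
        · simp only [List.mem_cons, List.not_mem_nil, or_false] at hx ⊢; omega
      refine ⟨by rw [nvs _ (by simp), hx], F7.setNv (by simp [hL]), ?_, ?_, ?_⟩
      · simp only [setNv_nv]
        simp [nvs, c1, c2, c3, c4, c5, c6, c7, c8]
      · simp only [setNv_ra]
        rw [F6.ra _ (by simp), F5.ra _ (by simp), Z4]
      · simp only [setNv_ra]
        rw [f1, arrMat_fillTo, d2, arrMat_fillTo, prodH, G4, ← pow_add, pow_succ, mul_two]
    · rintro s4 ⟨F4, ⟨c1, c2, c3, c4, c5, c6, c7, c8⟩, Z4, G4⟩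
      apply Exec.seq; apply Exec.setN; apply Exec.seq; apply Exec.setN
      generalize hs5 : ((s4.setNv _ _).setNv _ _) = s5
      have F5 : Frame L [1] [] [R + 1, R + 2, R + 3] s s5 := by
        rw [← hs5]
        exact (F4.setNv (by simp [hL])).setNv (by simp [hL])
      have r5 : s5.nv (B + 30) = P ∧ s5.nv (B + 31) = D ∧ s5.nv (B + 24) = P ∧ s5.nv (B + 32) = P ∧
        s5.nv (B + 21) = 1 ∧ s5.nv (B + 33) = 1 ∧ s5.nv (B + 23) = D := by
        have e1 := F4.nv (B + 2) (by simp [hL])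
        rw [← hs5]
        simp [NExp.eval, e1, hD, c1, c3, c4, c5, c6]
      obtain ⟨a1, a2, a3, a4, a5, a6, a7⟩ := r5
      have h1 := matProg_spec (B := B) hR13 hM3 s5
      rw [a1, a2, a3, a4, a5, a6, a7] at h1
      refine h1.mono ?_
      rintro s6 ⟨F6, f1, f2⟩
      have e1 : s5.ra (R + 1) = s4.ra (R + 1) := by rw [← hs5]; rfl
      have e3 : s5.ra (R + 3) = s4.ra (R + 3) := by rw [← hs5]; rfl
      refine ⟨F5.trans F6 (by simp [hL]) (by simp) (by simp) (by simp), f1, ?_, ?_⟩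
      · rw [f2, arrMat_fillTo, prodH, e1, G4, F5.ra M (by simp [hM1, hM2, hM3])]
      · intro z hz
        rw [f2, fillTo_of_le hz, e3, Z4]
  · simp only [NExp.cost, powerTime, matTime]
    omega

end Power

end KronLRA


namespace KronLRA

/-! ### One step of Gram–Schmidt: pivot search, normalization, projection. -/

section GramSchmidt

open Matrix

/-- The squared length of a row of a matrix that is stored row by row. -/
noncomputable def rowSq (w : ℕ → ℝ) (D a : ℕ) : ℝ :=
  ∑ t ∈ Finset.range D, w (a * D + t) * w (a * D + t)

/-- Find the longest of the first rows (their number is in `B + 1`) of the array `W` or, if they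
are zero, a nonzero row among the others; the number of rows is in `B + 7`. -/
def scanProg (B W : ℕ) : Prog :=
  .seq (.setR 2 (.ofNat (.lit 0))) (.seq (.setN (B + 43) (.lit 0))
    (forN (B + 44) (B + 7) (.seq (.setN (B + 20) (.var (B + 43)))
      (.seq (.setN (B + 22) (.var (B + 43))) (.seq (dotProg B W W)
        (.seq (.ite (.and (.ltR (.var 2) (.var 1)) (.not (.and
            (.not (.ltN (.var (B + 44)) (.var (B + 1)))) (.ltR (.ofNat (.lit 0)) (.var 2)))))
          (.seq (.setR 2 (.var 1)) (.setN (B + 42) (.var (B + 43)))) .skip)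
          (.setN (B + 43) (.add (.var (B + 43)) (.var (B + 2))))))))))

/-- The best squared length starts at `0` and improves only strictly, so it is positive exactly when
a candidate exists. From row `P` on, a row is accepted only if there is no candidate yet. Thus the
auxiliary rows never displace a genuine pivot. -/
theorem scanProg_spec {B W P D Q : ℕ} {s : State} (hP : s.nv (B + 1) = P) (hD : s.nv (B + 2) = D)
    (hQ : s.nv (B + 7) = Q) (h21 : s.nv (B + 21) = 1) (h23 : s.nv (B + 23) = 1)
    (h24 : s.nv (B + 24) = D) (hPQ : P ≤ Q) (hpos : ∃ a < Q, 0 < rowSq (s.ra W) D a) :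
    Exec (scanProg B W) s (Q * (D * 24 + 50) + 20) fun s' =>
      Frame [B + 20, B + 22, B + 25, B + 42, B + 43, B + 44] [1, 2] [] [] s s' ∧
      ∃ p < Q, s'.nv (B + 42) = p * D ∧ s'.rv 2 = rowSq (s.ra W) D p ∧ 0 < rowSq (s.ra W) D p ∧
        ((p < P ∧ ∀ a < P, rowSq (s.ra W) D a ≤ rowSq (s.ra W) D p) ∨
          ∀ a < P, rowSq (s.ra W) D a ≤ 0) := by
  set n := rowSq (s.ra W) D with hn
  apply Exec.le
  · apply Exec.seq; apply Exec.setR; apply Exec.seq; apply Exec.setN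
    apply Exec.forN Q (fun i s' =>
      Frame [B + 20, B + 22, B + 25, B + 42, B + 43, B + 44] [1, 2] [] [] s s' ∧
      s'.nv (B + 43) = i * D ∧
      ((s'.rv 2 = 0 ∧ ∀ a < i, n a ≤ 0) ∨ ∃ p < i, s'.nv (B + 42) = p * D ∧ s'.rv 2 = n p ∧
        0 < n p ∧ ((p < P ∧ ∀ a < i, a < P → n a ≤ n p) ∨ ∀ a < i, a < P → n a ≤ 0)))
    · rintro i s' ⟨h, -⟩
      rw [h.nv _ (by simp), hQ]
    · exact ⟨((Frame.refl.setRv (by simp)).setNv (by simp)).setNv (by simp), by simp [NExp.eval],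
        Or.inl ⟨by simp [RExp.eval, NExp.eval], by simp⟩⟩
    · rintro i hi s₁ ⟨h, h1, h2⟩ hx
      apply Exec.seq; apply Exec.setN; apply Exec.seq; apply Exec.setN
      obtain ⟨s₂, hs₂⟩ : ∃ s₂, s₂ = (s₁.setNv (B + 20) ((NExp.var (B + 43)).eval s₁)).setNv (B + 22)
        ((NExp.var (B + 43)).eval (s₁.setNv (B + 20) ((NExp.var (B + 43)).eval s₁))) := ⟨_, rfl⟩
      rw [← hs₂]
      have F2 : Frame [B + 20, B + 22, B + 25, B + 42, B + 43, B + 44] [1, 2] [] [] s s₂ := by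
        rw [hs₂]; exact (h.setNv (by simp)).setNv (by simp)
      have g1 : s₂.nv (B + 20) = i * D := by rw [hs₂]; simp [NExp.eval, h1]
      have g2 : s₂.nv (B + 22) = i * D := by rw [hs₂]; simp [NExp.eval, h1]
      have g3 : s₂.nv (B + 43) = i * D := by rw [hs₂]; simp [h1]
      have g4 : s₂.nv (B + 44) = i := by rw [hs₂]; simp [hx]
      have g5 : s₂.nv (B + 42) = s₁.nv (B + 42) := by rw [hs₂]; simp
      have g6 : s₂.rv 2 = s₁.rv 2 := by rw [hs₂]; simp
      clear hs₂
      have hd := dotProg_spec B W W s₂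
      rw [F2.nv _ (by simp : B + 24 ∉ _), F2.nv _ (by simp : B + 21 ∉ _),
        F2.nv _ (by simp : B + 23 ∉ _), h21, h23, h24, F2.ra _ (by simp : W ∉ _), g1, g2] at hd
      apply Exec.seq
      refine hd.mono ?_
      rintro s₃ ⟨f, f1⟩
      have F3 : Frame [B + 20, B + 22, B + 25, B + 42, B + 43, B + 44] [1, 2] [] [] s s₃ :=
        F2.trans f (by simp) (by simp) (by simp) (by simp)
      rw [← f.nv _ (by simp)] at g3 g4 g5
      rw [← f.rv _ (by simp)] at g6
      have f2 : s₃.rv 1 = n i := by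
        rw [f1, hn, rowSq]; simp only [mul_one]
      have e2 := F3.nv (B + 2) (by simp)
      have e1 := F3.nv (B + 1) (by simp)
      clear f f1 hd h1
      rw [← g5, ← g6] at h2
      apply Exec.seq
      apply Exec.ite (T := 4)
      · intro ht
        simp only [Test.eval, RExp.eval, NExp.eval, f2, g4, e1, hP] at ht
        simp at ht
        obtain ⟨ht1, ht2⟩ := ht
        refine Exec.le (T := 2 + 2) ?_ le_rfl
        apply Exec.seq; apply Exec.setR; apply Exec.setN; apply Exec.setN
        refine ⟨by simp [g4], (((F3.setRv (by simp)).setNv (by simp)).setNv (by simp)).setNv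
          (by simp), by simp [NExp.eval, g3, e2, hD]; ring, Or.inr ⟨i, by omega,
          by simp [NExp.eval, g3], by simp [RExp.eval, f2], ?_, ?_⟩⟩
        · rcases h2 with ⟨h2, -⟩ | ⟨p, -, -, h2, h3, -⟩
          · rwa [h2] at ht1
          · rw [h2] at ht1; linarith
        · by_cases hiP : i < P
          · refine Or.inl ⟨hiP, fun a ha haP => ?_⟩
            rcases Nat.lt_succ_iff_lt_or_eq.1 ha with ha | rfl
            · rcases h2 with ⟨h2, h3⟩ | ⟨p, -, -, h2, h3, ⟨-, h4⟩ | h4⟩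
              · rw [h2] at ht1; exact (h3 a ha).trans ht1.le
              · rw [h2] at ht1; exact (h4 a ha haP).trans ht1.le
              · rw [h2] at ht1; linarith [h4 a ha haP]
            · exact le_rfl
          · refine Or.inr fun a ha haP => ?_
            have ha' : a < i := by omega
            rcases h2 with ⟨h2, h3⟩ | ⟨p, -, -, h2, h3, ⟨-, h4⟩ | h4⟩
            · exact h3 a ha'
            · have := ht2.resolve_left hiP; rw [h2] at this; linarith
            · exact h4 a ha' haP
      · intro ht
        simp only [Test.eval, RExp.eval, NExp.eval, f2, g4, e1, hP] at ht
        simp at ht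
        refine Exec.le (Exec.skip ?_) (by omega)
        apply Exec.setN
        refine ⟨by simp [g4], (F3.setNv (by simp)).setNv (by simp),
          by simp [NExp.eval, g3, e2, hD]; ring, ?_⟩
        rcases h2 with ⟨h2, h3⟩ | ⟨p, hp, h2, h3, h4, h5⟩
        · left
          refine ⟨by simpa using h2, fun a ha => ?_⟩
          rcases Nat.lt_succ_iff_lt_or_eq.1 ha with ha | rfl
          · exact h3 a ha
          · by_contra hna
            have := (ht (by rw [h2]; linarith)).2
            rw [h2] at this; exact lt_irrefl _ this
        · right
          refine ⟨p, by omega, by simpa using h2, by simpa using h3, h4, ?_⟩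
          rcases h5 with ⟨h5, h6⟩ | h5
          · refine Or.inl ⟨h5, fun a ha haP => ?_⟩
            rcases Nat.lt_succ_iff_lt_or_eq.1 ha with ha | rfl
            · exact h6 a ha haP
            · by_contra hna
              have := (ht (by rw [h3]; linarith)).1
              omega
          -- While `i < P`, every visited row is among the first `P`, so the candidate `p` itself is
          -- one of them.
          · by_cases hiP : i < P
            · have hle : n i ≤ n p := by
                by_contra hna
                have := (ht (by rw [h3]; linarith)).1
                omega
              refine Or.inl ⟨by omega, fun a ha haP => ?_⟩
              rcases Nat.lt_succ_iff_lt_or_eq.1 ha with ha | rfl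
              · linarith [h5 a ha haP]
              · exact hle
            · exact Or.inr fun a ha haP => h5 a (by omega) haP
    · rintro s' ⟨h, -, h2⟩
      refine ⟨h, ?_⟩
      rcases h2 with ⟨h2, h3⟩ | ⟨p, hp, h2, h3, h4, h5⟩
      · obtain ⟨a, ha, hpos⟩ := hpos
        exact absurd (h3 a ha) (by linarith)
      · refine ⟨p, hp, h2, h3, h4, ?_⟩
        rcases h5 with ⟨h5, h6⟩ | h5
        · exact Or.inl ⟨h5, fun a ha => h6 a (by omega) ha⟩
        · exact Or.inr fun a ha => h5 a (by omega) ha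
  · simp only [RExp.cost, NExp.cost, Test.cost]
    ring_nf
    omega

/-- Divide the row at `B + 42` of the array `W` by the square root of real register `2`, and store
it at `B + 45` in the array `U`. -/
def normProg (B U W : ℕ) : Prog :=
  .seq (.setR 3 (.sqrt (.var 2))) (forN (B + 46) (B + 2)
    (.putR U (.add (.var (B + 45)) (.var (B + 46)))
      (.div (.get W (.add (.var (B + 42)) (.var (B + 46)))) (.var 3))))

theorem normProg_spec {B U W D : ℕ} (hUW : W ≠ U) {s : State} (hD : s.nv (B + 2) = D) :
    Exec (normProg B U W) s (D * 20 + 10) fun s' =>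
      Frame [B + 46] [3] [] [U] s s' ∧
      (∀ z < s.nv (B + 45), s'.ra U z = s.ra U z) ∧
      ∀ c < D, s'.ra U (s.nv (B + 45) + c) = s.ra W (s.nv (B + 42) + c) / √(s.rv 2) := by
  apply Exec.le
  · apply Exec.seq; apply Exec.setR
    apply Exec.forN D (fun i s' => Frame [B + 46] [3] [] [U] s s' ∧
      s'.rv 3 = √(s.rv 2) ∧ (∀ z < s.nv (B + 45), s'.ra U z = s.ra U z) ∧
      ∀ c < i, s'.ra U (s.nv (B + 45) + c) = s.ra W (s.nv (B + 42) + c) / √(s.rv 2))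
    · rintro i s' ⟨h, -⟩
      rw [h.nv _ (by simp), hD]
    · exact ⟨(Frame.refl.setRv (by simp)).setNv (by simp), by simp [RExp.eval], by simp, by simp⟩
    · rintro i hi s' ⟨h, h1, h2, h3⟩ hx
      apply Exec.putR
      have e1 := h.nv (B + 45) (by simp)
      have e2 := h.nv (B + 42) (by simp)
      have e3 := h.ra W (by simp [hUW])
      refine ⟨by simp [hx], (h.putRa (by simp)).setNv (by simp), by simp [h1], ?_, ?_⟩
      · intro z hz
        simp only [setNv_ra, putRa_ra, if_true, NExp.eval, e1]
        rw [Function.update_of_ne (by omega), h2 z hz]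
      · intro c hc
        simp only [setNv_ra, putRa_ra, if_true, NExp.eval, RExp.eval, e1, e2, hx, e3, h1]
        rcases Nat.lt_succ_iff_lt_or_eq.1 hc with hc | rfl
        · rw [Function.update_of_ne (by omega), h3 c hc]
        · rw [Function.update_self]
    · rintro s' ⟨h, -, h2, h3⟩
      exact ⟨h, h2, h3⟩
  · simp only [RExp.cost, NExp.cost]
    ring_nf
    omega

/-- Remove from the rows of the array `W` their components along the unit vector that is stored at
`B + 45` in the array `U`. -/
def projProg (B U W : ℕ) : Prog :=
  .seq (.setN (B + 43) (.lit 0)) (forN (B + 44) (B + 7)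
    (.seq (.setN (B + 20) (.var (B + 43))) (.seq (.setN (B + 22) (.var (B + 45)))
      (.seq (dotProg B W U) (.seq (forN (B + 46) (B + 2)
          (.putR W (.add (.var (B + 43)) (.var (B + 46)))
            (.sub (.get W (.add (.var (B + 43)) (.var (B + 46))))
              (.mul (.var 1) (.get U (.add (.var (B + 45)) (.var (B + 46))))))))
        (.setN (B + 43) (.add (.var (B + 43)) (.var (B + 2)))))))))

/-- This is the modified Gram–Schmidt update: all rows are replaced by their residuals at once, so
the next pivot search can compare plain row lengths. -/
theorem projProg_spec {B U W D Q : ℕ} (hUW : U ≠ W) {s : State} (hD : s.nv (B + 2) = D)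
    (hQ : s.nv (B + 7) = Q) (h21 : s.nv (B + 21) = 1) (h23 : s.nv (B + 23) = 1)
    (h24 : s.nv (B + 24) = D) :
    Exec (projProg B U W) s (Q * (D * 50 + 50) + 20) fun s' =>
      Frame [B + 20, B + 22, B + 25, B + 43, B + 44, B + 46] [1] [] [W] s s' ∧
      ∀ a < Q, ∀ c < D, s'.ra W (a * D + c) = s.ra W (a * D + c) -
        (∑ t ∈ Finset.range D, s.ra W (a * D + t) * s.ra U (s.nv (B + 45) + t)) *
          s.ra U (s.nv (B + 45) + c) := by
  set u := s.nv (B + 45) with hu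
  set f : ℕ → ℝ := fun z => s.ra W z -
    (∑ t ∈ Finset.range D, s.ra W (z / D * D + t) * s.ra U (u + t)) * s.ra U (u + z % D) with hf
  apply Exec.le
  · apply Exec.seq; apply Exec.setN
    apply Exec.forN Q (fun i s' =>
      Frame [B + 20, B + 22, B + 25, B + 43, B + 44, B + 46] [1] [] [W] s s' ∧
      s'.nv (B + 43) = i * D ∧ s'.ra W = fillTo f (s.ra W) (i * D))
    · rintro i s' ⟨h, -⟩
      rw [h.nv _ (by simp), hQ]
    · exact ⟨(Frame.refl.setNv (by simp)).setNv (by simp), by simp [NExp.eval],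
        by simp [fillTo_zero]⟩
    · rintro i hi s₁ ⟨h, h1, h2⟩ hx
      apply Exec.seq; apply Exec.setN; apply Exec.seq; apply Exec.setN
      obtain ⟨s₂, hs₂⟩ : ∃ s₂, s₂ = (s₁.setNv (B + 20) ((NExp.var (B + 43)).eval s₁)).setNv (B + 22)
        ((NExp.var (B + 45)).eval (s₁.setNv (B + 20) ((NExp.var (B + 43)).eval s₁))) := ⟨_, rfl⟩
      rw [← hs₂]
      have F2 : Frame [B + 20, B + 22, B + 25, B + 43, B + 44, B + 46] [1] [] [W] s s₂ := by
        rw [hs₂]; exact (h.setNv (by simp)).setNv (by simp)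
      have g1 : s₂.nv (B + 20) = i * D := by rw [hs₂]; simp [NExp.eval, h1]
      have g2 : s₂.nv (B + 22) = u := by
        rw [hs₂]; simp [NExp.eval, h.nv (B + 45) (by simp), hu]
      have g3 : s₂.nv (B + 43) = i * D := by rw [hs₂]; simp [h1]
      have g4 : s₂.nv (B + 44) = i := by rw [hs₂]; simp [hx]
      have g5 : s₂.ra W = fillTo f (s.ra W) (i * D) := by rw [hs₂]; simp [h2]
      clear hs₂
      have hd := dotProg_spec B W U s₂
      rw [F2.nv _ (by simp : B + 24 ∉ _), F2.nv _ (by simp : B + 21 ∉ _),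
        F2.nv _ (by simp : B + 23 ∉ _), h21, h23, h24, F2.ra _ (by simp [hUW] : U ∉ _), g1, g2,
        g5] at hd
      apply Exec.seq
      refine hd.mono ?_
      rintro s₃ ⟨F3, f1⟩
      have F3' : Frame [B + 20, B + 22, B + 25, B + 43, B + 44, B + 46] [1] [] [W] s s₃ :=
        F2.trans F3 (by simp) (by simp) (by simp) (by simp)
      rw [← F3.nv _ (by simp)] at g3 g4
      rw [← F3.ra _ (by simp)] at g5
      have f2 : s₃.rv 1 = ∑ t ∈ Finset.range D, s.ra W (i * D + t) * s.ra U (u + t) := by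
        rw [f1]
        simp only [mul_one]
        refine Finset.sum_congr rfl fun t _ => ?_
        -- The inner product is formed before row `i` is overwritten, hence from its old entries.
        rw [fillTo_of_le (by omega)]
      apply Exec.seq
      apply Exec.forN D (fun c s' =>
        Frame [B + 20, B + 22, B + 25, B + 43, B + 44, B + 46] [1] [] [W] s s' ∧
        s'.nv (B + 43) = i * D ∧ s'.nv (B + 44) = i ∧ s'.rv 1 = s₃.rv 1 ∧
        s'.ra W = fillTo f (s.ra W) (i * D + c))
      · rintro i s' ⟨h, -⟩
        rw [h.nv _ (by simp), hD]
      · exact ⟨F3'.setNv (by simp), by simp [g3], by simp [g4], by simp, by simp [g5]⟩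
      · rintro c hc s₄ ⟨F4, c1, c2, c3, c4⟩ hx4
        apply Exec.putR
        refine ⟨by simp [hx4], (F4.putRa (by simp)).setNv (by simp), by simp [c1], by simp [c2],
          by simp [c3], ?_⟩
        have e1 := F4.nv (B + 45) (by simp)
        have e2 := F4.ra U (by simp [hUW])
        simp only [setNv_ra, putRa_ra, if_true, NExp.eval, RExp.eval, c1, hx4, c4, e1, e2, c3]
        rw [← add_assoc]
        apply fillTo_update
        rw [fillTo_of_le le_rfl, hf]
        simp only [index_div hc, index_mod hc]
        rw [f2, ← hu]
      · rintro s₄ ⟨F4, c1, c2, -, c4⟩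
        apply Exec.setN
        have e2 := F4.nv (B + 2) (by simp)
        refine ⟨by simp [c2], (F4.setNv (by simp)).setNv (by simp), ?_, ?_⟩
        · simp [NExp.eval, c1, e2, hD]; ring
        · simp only [setNv_ra, c4]
          rw [add_mul, one_mul]
    · rintro s' ⟨h, -, h2⟩
      refine ⟨h, fun a ha c hc => ?_⟩
      rw [h2, fillTo_of_lt (index_lt ha hc), hf]
      simp only [index_div hc, index_mod hc]
  · simp only [RExp.cost, NExp.cost]
    ring_nf
    omega

end GramSchmidt

end KronLRA


namespace KronLRA

/-! ### The complete pivoted orthogonalization. -/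

section GramSchmidtLoop

open Matrix

theorem IsGreedy.succ {I J : Type*} [Fintype I] [Fintype J] {W : Matrix I J ℝ}
    {u v : ℕ → J → ℝ} {j : ℕ} (h : IsGreedy W u j) (huv : ∀ i < j, v i = u i)
    (hv : (∃ a, IsPivot W v j a) ∨ ((∀ b, residual v j (W b) = 0) ∧ ∃ w, IsStep v j w)) :
    IsGreedy W v (j + 1) := by
  intro i hi
  rcases Nat.lt_succ_iff_lt_or_eq.1 hi with hi | rfl
  · have e : ∀ w, residual v i w = residual u i w :=
      residual_congr fun l hl => huv l (hl.trans hi)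
    have := h i hi
    simpa only [IsPivot, IsStep, e, huv i hi] using this
  · exact hv

/-- The squared residuals of the first `k` unit vectors add up to at least `k - j > 0`, because the
`u l` are unit vectors. So `k` appended unit vectors always provide a row that can be normalized,
even if the matrix has low rank. -/
theorem exists_residual_single_pos {D k j : ℕ} (hj : j < k) (hk : k ≤ D) {u : ℕ → Fin D → ℝ}
    (hu : OrthoUpTo u j) : ∃ i : Fin D, (i : ℕ) < k ∧
      0 < residual u j (Pi.single i 1) ⬝ᵥ residual u j (Pi.single i 1) := by
  by_contra! hcon
  have h1 : ∀ i : Fin D, residual u j (Pi.single i 1) ⬝ᵥ residual u j (Pi.single i 1)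
      = 1 - ∑ l ∈ Finset.range j, u l i ^ 2 := by
    intro i
    nth_rewrite 2 [residual_eq hu]
    rw [dotProduct_sub, dotProduct_sum, Finset.sum_eq_zero (s := Finset.range j)
      (f := fun l => residual u j (Pi.single i 1) ⬝ᵥ (Pi.single i 1 ⬝ᵥ u l) • u l), sub_zero,
      residual_eq hu, sub_dotProduct, sum_dotProduct]
    · simp [sq]
    · intro l hl
      rw [dotProduct_smul, residual_dotProduct hu (Finset.mem_range.1 hl), smul_zero]
  have h2 : ∀ i : Fin k, 1 ≤ ∑ l ∈ Finset.range j, u l (Fin.castLE hk i) ^ 2 := fun i => by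
    have := hcon (Fin.castLE hk i) i.2
    rw [h1] at this
    linarith
  have h3 : (k : ℝ) ≤ ∑ i : Fin k, ∑ l ∈ Finset.range j, u l (Fin.castLE hk i) ^ 2 := by
    calc (k : ℝ) = ∑ i : Fin k, 1 := by simp
      _ ≤ _ := Finset.sum_le_sum fun i _ => h2 i
  rw [Finset.sum_comm] at h3
  have h4 : ∀ l ∈ Finset.range j, ∑ i : Fin k, u l (Fin.castLE hk i) ^ 2 ≤ 1 := fun l hl => by
    have hl := Finset.mem_range.1 hl
    have := hu l hl l hl
    rw [if_pos rfl] at this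
    rw [← this, dotProduct, ← Finset.sum_image (s := Finset.univ) (g := Fin.castLE hk)
      (f := fun c => u l c ^ 2) (fun a _ b _ h => Fin.castLE_injective hk h)]
    simp_rw [← sq]
    exact Finset.sum_le_sum_of_subset_of_nonneg (Finset.subset_univ _) fun _ _ _ => sq_nonneg _
  have h5 := h3.trans (Finset.sum_le_sum h4)
  simp at h5
  omega

/-- A row of a matrix that is stored row by row. -/
def rowFn (w : ℕ → ℝ) (D a : ℕ) : Fin D → ℝ := fun c => w (a * D + c)

theorem rowSq_eq (w : ℕ → ℝ) (D a : ℕ) : rowSq w D a = rowFn w D a ⬝ᵥ rowFn w D a :=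
  Finset.sum_range _

/-- Append unit vectors to the rows of the array `W`; register `0` holds their number. -/
def unitProg (B W : ℕ) : Prog :=
  .seq (.setN (B + 41) (.var (B + 38))) (forN (B + 40) 0
    (.seq (.putR W (.var (B + 41)) (.ofNat (.lit 1)))
      (.setN (B + 41) (.add (.var (B + 41)) (.add (.var (B + 2)) (.lit 1))))))

/-- Advancing the pointer by `D + 1` walks down the diagonal of the appended block, which is zero
beforehand. -/
theorem unitProg_spec {B W P D k : ℕ} {s : State} (hk : s.nv 0 = k) (hD : s.nv (B + 2) = D)
    (h38 : s.nv (B + 38) = P * D) (hkD : k ≤ D) (hz : ∀ z, P * D ≤ z → s.ra W z = 0) :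
    Exec (unitProg B W) s (k * 20 + 20) fun s' =>
      Frame [B + 40, B + 41] [] [] [W] s s' ∧
      (∀ z < P * D, s'.ra W z = s.ra W z) ∧
      ∀ i : Fin D, (i : ℕ) < k → rowFn (s'.ra W) D (P + i) = Pi.single i 1 := by
  apply Exec.le
  · apply Exec.seq; apply Exec.setN
    apply Exec.forN k (fun j s' => Frame [B + 40, B + 41] [] [] [W] s s' ∧
      s'.nv (B + 41) = (P + j) * D + j ∧ (∀ z < P * D, s'.ra W z = s.ra W z) ∧
      ∀ i c : ℕ, c < D → s'.ra W ((P + i) * D + c) = if i = c ∧ i < j then 1 else 0)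
    · rintro i s' ⟨h, -⟩
      rw [h.nv _ (by simp), hk]
    · refine ⟨(Frame.refl.setNv (by simp)).setNv (by simp), by simp [NExp.eval, h38], by simp,
        fun i c hc => ?_⟩
      simp only [setNv_ra, Nat.not_lt_zero, and_false, if_false]
      exact hz _ (by nlinarith)
    · rintro j hj s' ⟨h, h1, h2, h3⟩ hx
      apply Exec.seq; apply Exec.putR; apply Exec.setN
      have e1 := h.nv (B + 2) (by simp)
      refine ⟨by simp [hx], ((h.putRa (by simp)).setNv (by simp)).setNv (by simp),
        by simp [NExp.eval, h1, e1, hD]; ring, ?_, ?_⟩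
      · intro z hz
        simp only [setNv_ra, putRa_ra, if_true, NExp.eval, RExp.eval, h1]
        rw [Function.update_of_ne (by nlinarith), h2 z hz]
      · intro i c hc
        simp only [setNv_ra, putRa_ra, if_true, NExp.eval, RExp.eval, h1]
        rw [Function.update_apply, h3 i c hc]
        have key : (P + i) * D + c = (P + j) * D + j ↔ i = j ∧ c = j := by
          constructor
          · intro he
            have h4 := congrArg (· / D) he
            have h5 := congrArg (· % D) he
            simp only [index_div hc, index_mod hc, index_div (show j < D by omega),
              index_mod (show j < D by omega)] at h4 h5
            omega
          · rintro ⟨rfl, rfl⟩; rfl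
        simp only [key]
        by_cases hij : i = j ∧ c = j
        · rw [if_pos hij, if_pos (by omega)]; simp
        · rw [if_neg hij]
          have : (i = c ∧ i < j) ↔ (i = c ∧ i < j + 1) := by omega
          simp only [this]
    · rintro s' ⟨h, -, h2, h3⟩
      refine ⟨h, h2, fun i hi => ?_⟩
      ext c
      rw [rowFn, h3 i c c.2, Pi.single_apply]
      simp only [hi, and_true, Fin.ext_iff, eq_comm]
  · simp only [RExp.cost, NExp.cost]
    ring_nf
    omega

/-- Pivoted Gram–Schmidt orthogonalization of the rows of the array `W`, followed by unit vectors;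
the result is stored in the array `U`. -/
def greedyProg (B U W : ℕ) : Prog :=
  .seq (unitProg B W) (.seq (.setN (B + 7) (.add (.var (B + 1)) (.var 0)))
  (.seq (.setN (B + 24) (.var (B + 2))) (.seq (.setN (B + 21) (.lit 1))
  (.seq (.setN (B + 23) (.lit 1)) (.seq (.setN (B + 45) (.lit 0))
  (forN (B + 40) 0 (.seq (scanProg B W) (.seq (normProg B U W) (.seq (projProg B U W)
    (.setN (B + 45) (.add (.var (B + 45)) (.var (B + 2)))))))))))))

def greedyTime (P D k : ℕ) : ℕ :=
  k * 20 + 60 + k * ((P + k) * (D * 24 + 50) + 20 + (D * 20 + 10) +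
    ((P + k) * (D * 50 + 50) + 20) + 20)

/-- Greediness refers to the original `P` rows only. An auxiliary unit vector is chosen only when
all their residuals vanish, which is the second alternative in `IsGreedy`. -/
theorem greedyProg_spec {B U W P D k : ℕ} (hUW : U ≠ W) {s : State} (hk : s.nv 0 = k)
    (hP : s.nv (B + 1) = P) (hD : s.nv (B + 2) = D) (h38 : s.nv (B + 38) = P * D) (hkD : k ≤ D)
    (hz : ∀ z, P * D ≤ z → s.ra W z = 0) :
    Exec (greedyProg B U W) s (greedyTime P D k) fun s' =>
      IsGreedy (arrMat (s.ra W) P D) (fun i c => s'.ra U (i * D + c)) k := by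
  set L := [B + 7, B + 20, B + 21, B + 22, B + 23, B + 24, B + 25, B + 40, B + 41, B + 42, B + 43,
    B + 44, B + 45, B + 46] with hL
  apply Exec.le
  · apply Exec.seq
    refine (unitProg_spec hk hD h38 hkD hz).mono ?_
    rintro s₁ ⟨F1, h1, h2⟩
    apply Exec.seq; apply Exec.setN; apply Exec.seq; apply Exec.setN; apply Exec.seq
    apply Exec.setN; apply Exec.seq; apply Exec.setN; apply Exec.seq; apply Exec.setN
    set w₀ := s₁.ra W with hw₀
    have e1 : s₁.nv (B + 1) = P := by rw [F1.nv _ (by simp), hP]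
    have e2 : s₁.nv (B + 2) = D := by rw [F1.nv _ (by simp), hD]
    have e0 : s₁.nv 0 = k := by rw [F1.nv _ (by simp), hk]
    have hrow : ∀ a : Fin P, arrMat (s.ra W) P D a = rowFn w₀ D a := by
      intro a; ext c
      simp only [arrMat, of_apply, rowFn]
      rw [h1 _ (index_lt a.2 c.2)]
    -- The invariant says that after `j` steps the array `W` holds the residuals of all `P + k`
    -- initial rows with respect to the vectors found so far.
    apply Exec.forN k (fun j s' => Frame L [1, 2, 3] [] [U, W] s₁ s' ∧
      (s'.nv (B + 7) = P + k ∧ s'.nv (B + 24) = D ∧ s'.nv (B + 21) = 1 ∧ s'.nv (B + 23) = 1 ∧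
        s'.nv (B + 45) = j * D) ∧
      IsGreedy (arrMat (s.ra W) P D) (fun i => rowFn (s'.ra U) D i) j ∧
      ∀ a < P + k, rowFn (s'.ra W) D a = residual (fun i => rowFn (s'.ra U) D i) j (rowFn w₀ D a))
    · rintro i s' ⟨h, -⟩
      rw [h.nv _ (by simp [hL]), e0]
    · refine ⟨(((((Frame.refl.setNv (by simp [hL])).setNv (by simp [hL])).setNv
        (by simp [hL])).setNv (by simp [hL])).setNv (by simp [hL])).setNv (by simp [hL]), ?_, ?_, ?_⟩
      · simp [NExp.eval, e1, e2, e0]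
      · intro i hi; omega
      · intro a ha; rfl
    · rintro j hj s₂ ⟨F2, ⟨g7, g24, g21, g23, g45⟩, hG, hR⟩ hx
      have e1 : s₂.nv (B + 1) = P := by rw [F2.nv _ (by simp [hL]), e1]
      have e2 : s₂.nv (B + 2) = D := by rw [F2.nv _ (by simp [hL]), e2]
      set u : ℕ → Fin D → ℝ := fun i => rowFn (s₂.ra U) D i with hu
      have hO := orthoUpTo_of_steps hG.steps
      apply Exec.seq
      have hsq : ∀ a < P + k, rowSq (s₂.ra W) D a
          = residual u j (rowFn w₀ D a) ⬝ᵥ residual u j (rowFn w₀ D a) := fun a ha => by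
        rw [rowSq_eq, hR a ha]
      have hpos : ∃ a < P + k, 0 < rowSq (s₂.ra W) D a := by
        obtain ⟨i, hi, hp⟩ := exists_residual_single_pos hj hkD hO
        exact ⟨P + i, by omega, by rw [hsq _ (by omega), h2 i hi]; exact hp⟩
      refine (scanProg_spec e1 e2 g7 g21 g23 g24 (by omega) hpos).mono ?_
      rintro s₃ ⟨F3, p, hp, b1, b2, b3, b4⟩
      apply Exec.seq
      have e2' : s₃.nv (B + 2) = D := by rw [F3.nv _ (by simp), e2]
      have g45' : s₃.nv (B + 45) = j * D := by rw [F3.nv _ (by simp), g45]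
      refine (normProg_spec hUW.symm e2').mono ?_
      rintro s₄ ⟨F4, c1, c2⟩
      rw [g45', F3.ra U (by simp)] at c1
      rw [g45', F3.ra W (by simp), b1, b2] at c2
      apply Exec.seq
      have e2'' : s₄.nv (B + 2) = D := by rw [F4.nv _ (by simp), e2']
      have g45'' : s₄.nv (B + 45) = j * D := by rw [F4.nv _ (by simp), g45']
      have g7'' : s₄.nv (B + 7) = P + k := by rw [F4.nv _ (by simp), F3.nv _ (by simp), g7]
      have g21'' : s₄.nv (B + 21) = 1 := by rw [F4.nv _ (by simp), F3.nv _ (by simp), g21]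
      have g23'' : s₄.nv (B + 23) = 1 := by rw [F4.nv _ (by simp), F3.nv _ (by simp), g23]
      have g24'' : s₄.nv (B + 24) = D := by rw [F4.nv _ (by simp), F3.nv _ (by simp), g24]
      have hx4 : s₄.nv (B + 40) = j := by rw [F4.nv _ (by simp), F3.nv _ (by simp), hx]
      refine (projProg_spec hUW e2'' g7'' g21'' g23'' g24'').mono ?_
      rintro s₅ ⟨F5, d1⟩
      rw [g45'', F4.ra W (by simp [hUW.symm]), F3.ra W (by simp)] at d1
      apply Exec.setN
      have F6 : Frame L [1, 2, 3] [] [U, W] s₁ s₅ :=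
        ((F2.trans F3 (by simp [hL]) (by simp) (by simp) (by simp)).trans F4 (by simp [hL])
          (by simp) (by simp) (by simp)).trans F5 (by simp [hL]) (by simp) (by simp) (by simp)
      have hU5 : s₅.ra U = s₄.ra U := F5.ra U (by simp [hUW])
      set v : ℕ → Fin D → ℝ := fun i => rowFn (s₅.ra U) D i with hv
      have huv : ∀ i < j, v i = u i := fun i hi => by
        ext c
        simp only [hv, hu, rowFn]
        rw [hU5, c1 _ (index_lt hi c.2)]
      have hres : ∀ w, residual v j w = residual u j w := residual_congr huv
      have hvj : v j = (√(rowSq (s₂.ra W) D p))⁻¹ • residual u j (rowFn w₀ D p) := by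
        rw [← hR p hp]
        ext c
        simp only [hv, rowFn, Pi.smul_apply, smul_eq_mul]
        rw [hU5, c2 _ c.2, div_eq_inv_mul]
      rw [hsq p hp] at b3 hvj
      have hstep : IsStep v j (rowFn w₀ D p) := by
        rw [IsStep, hres]; exact ⟨b3, hvj⟩
      refine ⟨by simp [F5.nv (B + 40) (by simp), hx4], (F6.setNv (by simp [hL])).setNv
        (by simp [hL]), ?_, ?_, ?_⟩
      · simp [NExp.eval, F5.nv _ (by simp : B + 7 ∉ _), F5.nv _ (by simp : B + 24 ∉ _),
          F5.nv _ (by simp : B + 21 ∉ _), F5.nv _ (by simp : B + 23 ∉ _),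
          F5.nv _ (by simp : B + 45 ∉ _), F5.nv _ (by simp : B + 2 ∉ _), e2'', g7'', g21'', g23'',
          g24'', g45'']
        ring
      · change IsGreedy (arrMat (s.ra W) P D) v (j + 1)
        refine hG.succ huv ?_
        rcases b4 with ⟨hpP, b4⟩ | b4
        · left
          refine ⟨⟨p, hpP⟩, ?_, fun b => ?_⟩
          · rw [hrow]; exact hstep
          · rw [hrow, hrow, hres, hres]
            have := b4 b b.2
            rwa [hsq _ (by omega), hsq _ hp] at this
        · right
          refine ⟨fun b => ?_, _, hstep⟩
          have := b4 b b.2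
          rw [hsq _ (by omega)] at this
          rw [hrow, hres]
          exact dotProduct_self_eq_zero.1 (le_antisymm this (Finset.sum_nonneg fun _ _ => mul_self_nonneg _))
      · intro a ha
        simp only [setNv_ra]
        change rowFn (s₅.ra W) D a = residual v (j + 1) _
        rw [residual, hres, ← hR a ha]
        ext c
        simp only [rowFn, Pi.sub_apply, Pi.smul_apply, smul_eq_mul, hv, dotProduct]
        rw [d1 a ha c c.2, Finset.sum_range, hU5]
    · rintro s' ⟨-, -, h, -⟩
      exact h
  · simp only [NExp.cost, greedyTime]
    ring_nf
    omega

end GramSchmidtLoop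

end KronLRA


namespace KronLRA

/-! ### Hashing sparse factors and forming Kronecker products. -/

section Sketching

/-- Write `f 0, …, f (n - 1)` at the positions `r 0, …, r (n - 1)` of the array `g`. -/
def writeAt (r f g : ℕ → ℕ) : ℕ → ℕ → ℕ
  | 0 => g
  | n + 1 => Function.update (writeAt r f g n) (r n) (f n)

/-- A row index is written once per nonzero entry, and the last write wins. The surviving position
`ι` depends on the row indices alone, not on the values, so the hash value of a row is a fixed cell
of the random tape. -/
theorem exists_last_write (r : ℕ → ℕ) (n : ℕ) : ∃ ι : ℕ → ℕ, ∀ t < n,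
    ι (r t) < n ∧ r (ι (r t)) = r t ∧ ∀ f g, writeAt r f g n (r t) = f (ι (r t)) := by
  induction n with
  | zero => exact ⟨id, fun t ht => absurd ht (by omega)⟩
  | succ n ih =>
    obtain ⟨ι, hι⟩ := ih
    refine ⟨Function.update ι (r n) n, fun t ht => ?_⟩
    by_cases h : r t = r n
    · rw [h]
      simp [writeAt]
    · have htn : t < n := by
        rcases Nat.lt_succ_iff_lt_or_eq.1 ht with ht | rfl
        exacts [ht, absurd rfl h]
      rw [Function.update_of_ne h]
      obtain ⟨h1, h2, h3⟩ := hι t htn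
      refine ⟨by omega, h2, fun f g => ?_⟩
      rw [writeAt, Function.update_of_ne h, h3]

/-- Copy consecutive entries of the array `A`, starting at `B + 10`, to the positions in the array
`X` of the array `H`; their number is in the register `l`. -/
def hashProg (B l X A H : ℕ) : Prog :=
  forN (B + 11) l (.seq (.putN H (.get X (.var (B + 11))) (.get A (.var (B + 10))))
    (.setN (B + 10) (.add (.var (B + 10)) (.lit 1))))

theorem hashProg_spec {B l X A H : ℕ} (hl : l < B) (hX : X ≠ H) (hA : A ≠ H) (s : State) :
    Exec (hashProg B l X A H) s (s.nv l * 20 + 6) fun s' =>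
      Frame [B + 10, B + 11] [] [H] [] s s' ∧ s'.nv (B + 10) = s.nv (B + 10) + s.nv l ∧
      s'.na H = writeAt (s.na X) (fun t => s.na A (s.nv (B + 10) + t)) (s.na H) (s.nv l) := by
  apply Exec.le
  · apply Exec.forN (s.nv l) (fun i s' =>
      Frame [B + 10, B + 11] [] [H] [] s s' ∧ s'.nv (B + 10) = s.nv (B + 10) + i ∧
      s'.na H = writeAt (s.na X) (fun t => s.na A (s.nv (B + 10) + t)) (s.na H) i)
    · rintro i s' ⟨h, -⟩
      exact h.nv _ (by simp; omega)
    · exact ⟨Frame.refl.setNv (by simp), by simp, by simp [writeAt]⟩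
    · rintro i hi s' ⟨h, h1, h2⟩ hx
      apply Exec.seq; apply Exec.putN; apply Exec.setN
      refine ⟨by simp [hx], ((h.putNa (by simp)).setNv (by simp)).setNv (by simp),
        by simp [NExp.eval, h1]; omega, ?_⟩
      simp only [setNv_na, putNa_na, if_true, NExp.eval, hx, h1, h2, h.na X (by simp [hX]),
        h.na A (by simp [hA]), writeAt]
    · exact fun s' h => h
  · simp only [NExp.cost]
    ring_nf
    omega

/-- Tabulate the multiples of the register `d` in the array `O`; their number is in `B`. -/
def tableProg (B d O : ℕ) : Prog :=
  .seq (.setN (B + 12) (.lit 0)) (forN (B + 15) B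
    (.seq (.putN O (.var (B + 15)) (.var (B + 12)))
      (.setN (B + 12) (.add (.var (B + 12)) (.var d)))))

/-- The table stands in for multiplication by `d`, so that each nonzero entry can be placed in
constant time. -/
theorem tableProg_spec {B d O : ℕ} (hd : d < B) (s : State) :
    Exec (tableProg B d O) s (s.nv B * 20 + 10) fun s' =>
      Frame [B + 12, B + 15] [] [O] [] s s' ∧ ∀ x < s.nv B, s'.na O x = x * s.nv d := by
  apply Exec.le
  · apply Exec.seq; apply Exec.setN
    apply Exec.forN (s.nv B) (fun i s' => Frame [B + 12, B + 15] [] [O] [] s s' ∧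
      s'.nv (B + 12) = i * s.nv d ∧ ∀ x < i, s'.na O x = x * s.nv d)
    · rintro i s' ⟨h, -⟩
      exact h.nv _ (by simp)
    · exact ⟨(Frame.refl.setNv (by simp)).setNv (by simp), by simp [NExp.eval], by simp⟩
    · rintro i hi s' ⟨h, h1, h2⟩ hx
      apply Exec.seq; apply Exec.putN; apply Exec.setN
      have e := h.nv d (by simp; omega)
      refine ⟨by simp [hx], ((h.putNa (by simp)).setNv (by simp)).setNv (by simp), ?_, ?_⟩
      · have hd1 : d ≠ B + 12 := by omega
        simp [NExp.eval, h1, e]; ring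
      · intro x hxi
        simp only [setNv_na, putNa_na, if_true, NExp.eval, hx, h1]
        rcases Nat.lt_succ_iff_lt_or_eq.1 hxi with hxi | rfl
        · rw [Function.update_of_ne (by omega), h2 x hxi]
        · rw [Function.update_self]
    · rintro s' ⟨h, -, h2⟩
      exact ⟨h, h2⟩
  · simp only [NExp.cost]
    ring_nf
    omega

/-- The row and the sign that a number below `2 m` stands for. -/
def hashRow (m v : ℕ) : ℕ := if v < m then v else v - m

noncomputable def hashSign (m v : ℕ) : ℝ := if v < m then 1 else -1

theorem hashRow_lt {m v : ℕ} (h : v < 2 * m) : hashRow m v < m := by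
  rw [hashRow]; split_ifs <;> omega

/-- Add up the entries with rows in the array `X`, columns in `Y` and values in `V` after hashing
the rows with `H`, in the array `Z`; the array `O` holds the offsets of the rows of `Z`. -/
def addProg (B l X Y V H O Z : ℕ) : Prog :=
  forN (B + 11) l (.seq (.setN (B + 13) (.get H (.get X (.var (B + 11)))))
    (.ite (.ltN (.var (B + 13)) (.var B))
      (.seq (.setN (B + 14) (.add (.get O (.var (B + 13))) (.get Y (.var (B + 11)))))
        (.putR Z (.var (B + 14)) (.add (.get Z (.var (B + 14))) (.get V (.var (B + 11))))))
      (.seq (.setN (B + 14) (.add (.get O (.sub (.var (B + 13)) (.var B)))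
          (.get Y (.var (B + 11)))))
        (.putR Z (.var (B + 14)) (.sub (.get Z (.var (B + 14))) (.get V (.var (B + 11))))))))

/-- One pass over the nonzero entries suffices because a count-sketch sends each row to a single
row. A hash value below `2m` encodes that row and, by its half, the sign. -/
theorem addProg_spec {B l X Y V H O Z m d : ℕ} (hl : l < B) (hV : V ≠ Z) {s : State}
    (hm : s.nv B = m) (hO : ∀ x < m, s.na O x = x * d)
    (hH : ∀ t < s.nv l, s.na H (s.na X t) < 2 * m) :
    Exec (addProg B l X Y V H O Z) s (s.nv l * 40 + 6) fun s' =>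
      Frame [B + 11, B + 13, B + 14] [] [] [Z] s s' ∧
      ∀ z, s'.ra Z z = s.ra Z z + ∑ t ∈ Finset.range (s.nv l),
        if hashRow m (s.na H (s.na X t)) * d + s.na Y t = z
          then hashSign m (s.na H (s.na X t)) * s.ra V t else 0 := by
  apply Exec.le
  · apply Exec.forN (s.nv l) (fun i s' => Frame [B + 11, B + 13, B + 14] [] [] [Z] s s' ∧
      ∀ z, s'.ra Z z = s.ra Z z + ∑ t ∈ Finset.range i,
        if hashRow m (s.na H (s.na X t)) * d + s.na Y t = z
          then hashSign m (s.na H (s.na X t)) * s.ra V t else 0)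
    · rintro i s' ⟨h, -⟩
      exact h.nv _ (by simp; omega)
    · exact ⟨Frame.refl.setNv (by simp), by simp⟩
    · rintro i hi s' ⟨h, h1⟩ hx
      apply Exec.seq; apply Exec.setN
      have e1 := h.nv B (by simp)
      have e2 := h.na X (by simp)
      have e3 := h.na H (by simp)
      have e4 := h.na O (by simp)
      have e5 := h.na Y (by simp)
      have e6 := h.ra V (by simp [hV])
      have e7 := hH i hi
      obtain ⟨v, hv⟩ : ∃ v, v = s.na H (s.na X i) := ⟨_, rfl⟩
      -- Both branches of the test are instances of this update, with `c = 1` and `c = -1`.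
      have step : ∀ w c : ℝ, ∀ cell, cell = hashRow m v * d + s.na Y i → c = hashSign m v →
          w = s'.ra Z cell + c * s.ra V i → ∀ z, Function.update (s'.ra Z) cell w z
            = s.ra Z z + ∑ t ∈ Finset.range (i + 1),
              if hashRow m (s.na H (s.na X t)) * d + s.na Y t = z
                then hashSign m (s.na H (s.na X t)) * s.ra V t else 0 := by
        rintro w c cell rfl rfl rfl z
        rw [Finset.sum_range_succ, Function.update_apply, ← hv, ← add_assoc, ← h1]
        by_cases hz : z = hashRow m v * d + s.na Y i
        · rw [if_pos hz, if_pos hz.symm, hz]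
        · rw [if_neg hz, if_neg (Ne.symm hz), add_zero]
      rw [← hv] at e7
      apply Exec.ite (T := 15)
      · intro ht
        have hvm : v < m := by
          simpa [Test.eval, NExp.eval, e1, e2, e3, hm, hx, ← hv] using ht
        refine Exec.le (T := 6 + 7) ?_ (by omega)
        apply Exec.seq; apply Exec.setN; apply Exec.putR
        refine ⟨by simp [hx], (((h.setNv (by simp)).setNv (by simp)).putRa (by simp)).setNv
          (by simp), ?_⟩
        simp only [setNv_ra, putRa_ra, if_true]
        refine step _ 1 _ ?_ ?_ ?_
        · simp [NExp.eval, hx, e2, e3, e4, e5, ← hv, hO v hvm, hashRow, hvm]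
        · simp [hashSign, hvm]
        · simp [RExp.eval, NExp.eval, hx, e6]
      · intro ht
        have hvm : m ≤ v := by
          simpa [Test.eval, NExp.eval, e1, e2, e3, hm, hx, ← hv] using ht
        refine Exec.le (T := 8 + 7) ?_ le_rfl
        apply Exec.seq; apply Exec.setN; apply Exec.putR
        refine ⟨by simp [hx], (((h.setNv (by simp)).setNv (by simp)).putRa (by simp)).setNv
          (by simp), ?_⟩
        simp only [setNv_ra, putRa_ra, if_true]
        refine step _ (-1) _ ?_ ?_ ?_
        · simp [NExp.eval, hx, e1, e2, e3, e4, e5, hm, ← hv, hO (v - m) (by omega), hashRow,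
            hvm.not_gt]
        · simp [hashSign, hvm.not_gt]
        · simp [RExp.eval, NExp.eval, hx, e6]; ring
    · exact fun s' h => h
  · simp only [NExp.cost, Test.cost]
    ring_nf
    omega

/-- Store the Kronecker product of two row vectors, starting at `B + 38` in the array `Z`; the
vectors start at `B + 47` in `X` and at `B + 48` in `Y`, and `B + 2` and `d` hold their lengths. -/
def rowKronProg (B d X Y Z : ℕ) : Prog :=
  .seq (.setN (B + 49) (.var (B + 47))) (forN (B + 50) (B + 2)
    (.seq (.setN (B + 51) (.var (B + 48))) (.seq (forN (B + 52) d
        (.seq (.putR Z (.var (B + 38)) (.mul (.get X (.var (B + 49))) (.get Y (.var (B + 51)))))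
          (.seq (.setN (B + 38) (.add (.var (B + 38)) (.lit 1)))
            (.setN (B + 51) (.add (.var (B + 51)) (.lit 1))))))
      (.setN (B + 49) (.add (.var (B + 49)) (.lit 1))))))

theorem rowKronProg_spec {B d X Y Z D e b : ℕ} (hd : d < B) (hX : X ≠ Z) (hY : Y ≠ Z) {s : State}
    {f g : ℕ → ℝ} (hD : s.nv (B + 2) = D) (he : s.nv d = e) (hb : s.nv (B + 38) = b)
    (hZ : s.ra Z = fillTo f g b) (hf : ∀ i < D, ∀ j < e, f (b + (i * e + j))
      = s.ra X (s.nv (B + 47) + i) * s.ra Y (s.nv (B + 48) + j)) :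
    Exec (rowKronProg B d X Y Z) s (D * (e * 30 + 30) + 10) fun s' =>
      Frame [B + 38, B + 49, B + 50, B + 51, B + 52] [] [] [Z] s s' ∧
      s'.nv (B + 38) = b + D * e ∧ s'.ra Z = fillTo f g (b + D * e) := by
  apply Exec.le
  · apply Exec.seq; apply Exec.setN
    apply Exec.forN D (fun i s' => Frame [B + 38, B + 49, B + 50, B + 51, B + 52] [] [] [Z] s s' ∧
      s'.nv (B + 38) = b + i * e ∧ s'.nv (B + 49) = s.nv (B + 47) + i ∧
      s'.ra Z = fillTo f g (b + i * e))
    · rintro i s' ⟨h, -⟩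
      rw [h.nv _ (by simp), hD]
    · exact ⟨(Frame.refl.setNv (by simp)).setNv (by simp), by simp [hb], by simp [NExp.eval],
        by simp [hZ]⟩
    · rintro i hi s₁ ⟨h, h1, h2, h3⟩ hx
      apply Exec.seq; apply Exec.setN; apply Exec.seq
      have e48 := h.nv (B + 48) (by simp)
      apply Exec.forN e (fun j s' =>
        Frame [B + 38, B + 49, B + 50, B + 51, B + 52] [] [] [Z] s s' ∧
        s'.nv (B + 50) = i ∧ s'.nv (B + 38) = b + i * e + j ∧
        s'.nv (B + 49) = s.nv (B + 47) + i ∧ s'.nv (B + 51) = s.nv (B + 48) + j ∧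
        s'.ra Z = fillTo f g (b + i * e + j))
      · rintro i s' ⟨h, -⟩
        rw [h.nv _ (by simp; omega), he]
      · exact ⟨(h.setNv (by simp)).setNv (by simp), by simp [hx], by simp [h1], by simp [h2],
          by simp [NExp.eval, e48], by simp [h3]⟩
      · rintro j hj s₂ ⟨g0, g1, g2, g3, g4, g5⟩ hx2
        apply Exec.seq; apply Exec.putR; apply Exec.seq; apply Exec.setN; apply Exec.setN
        refine ⟨by simp [hx2], (((g0.putRa (by simp)).setNv (by simp)).setNv (by simp)).setNv
          (by simp), by simp [g1], by simp [NExp.eval, g2]; ring, by simp [g3],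
          by simp [NExp.eval, g4]; ring, ?_⟩
        simp only [setNv_ra, putRa_ra, if_true, NExp.eval, RExp.eval, g2, g3, g4, g5]
        rw [← add_assoc]
        apply fillTo_update
        rw [add_assoc b, hf i hi j hj, g0.ra X (by simp [hX]), g0.ra Y (by simp [hY])]
      · rintro s₂ ⟨g0, g1, g2, g3, -, g5⟩
        apply Exec.setN
        refine ⟨by simp [g1], (g0.setNv (by simp)).setNv (by simp), by simp [g2]; ring,
          by simp [NExp.eval, g3]; ring, ?_⟩
        simp only [setNv_ra, g5]
        congr 1; ring
    · rintro s' ⟨h, h1, -, h2⟩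
      exact ⟨h, h1, h2⟩
  · simp only [NExp.cost, RExp.cost]
    ring_nf
    omega

/-- Store the Kronecker product of the arrays `X` and `Y` in the array `Z`; `B + 1`, `B + 2` hold
the dimensions of the first matrix, and `B`, `d` those of the second matrix. -/
def kronProg (B d X Y Z : ℕ) : Prog :=
  .seq (.setN (B + 38) (.lit 0)) (.seq (.setN (B + 47) (.lit 0)) (forN (B + 53) (B + 1)
    (.seq (.setN (B + 48) (.lit 0)) (.seq (forN (B + 54) B
        (.seq (rowKronProg B d X Y Z) (.setN (B + 48) (.add (.var (B + 48)) (.var d)))))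
      (.setN (B + 47) (.add (.var (B + 47)) (.var (B + 2))))))))

/-- The four nested loops produce the entries in the order in which they are stored, so the write
pointer only needs increments. -/
theorem kronProg_spec {B d X Y Z P D m e : ℕ} (hd : d < B) (hX : X ≠ Z) (hY : Y ≠ Z) {s : State}
    (hP : s.nv (B + 1) = P) (hD : s.nv (B + 2) = D) (hm : s.nv B = m) (he : s.nv d = e) :
    Exec (kronProg B d X Y Z) s (P * (m * (D * (e * 30 + 30) + 30) + 30) + 10) fun s' =>
      Frame [B + 38, B + 47, B + 48, B + 49, B + 50, B + 51, B + 52, B + 53, B + 54] [] [] [Z]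
        s s' ∧
      ∀ x < P * m, ∀ y < D * e, s'.ra Z (x * (D * e) + y)
        = s.ra X (x / m * D + y / e) * s.ra Y (x % m * e + y % e) := by
  set f : ℕ → ℝ := fun z => s.ra X (z / (D * e) / m * D + z % (D * e) / e) *
    s.ra Y (z / (D * e) % m * e + z % (D * e) % e) with hf
  set L := [B + 38, B + 47, B + 48, B + 49, B + 50, B + 51, B + 52, B + 53, B + 54] with hL
  apply Exec.le
  · apply Exec.seq; apply Exec.setN; apply Exec.seq; apply Exec.setN
    apply Exec.forN P (fun a s' => Frame L [] [] [Z] s s' ∧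
      s'.nv (B + 38) = a * m * (D * e) ∧ s'.nv (B + 47) = a * D ∧
      s'.ra Z = fillTo f (s.ra Z) (a * m * (D * e)))
    · rintro i s' ⟨h, -⟩
      rw [h.nv _ (by simp [hL]), hP]
    · exact ⟨((Frame.refl.setNv (by simp [hL])).setNv (by simp [hL])).setNv (by simp [hL]),
        by simp [NExp.eval], by simp [NExp.eval], by simp [fillTo_zero]⟩
    · rintro a ha s₁ ⟨h, h1, h2, h3⟩ hx
      apply Exec.seq; apply Exec.setN; apply Exec.seq
      apply Exec.forN m (fun b s' => Frame L [] [] [Z] s s' ∧ s'.nv (B + 53) = a ∧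
        s'.nv (B + 38) = (a * m + b) * (D * e) ∧ s'.nv (B + 47) = a * D ∧ s'.nv (B + 48) = b * e ∧
        s'.ra Z = fillTo f (s.ra Z) ((a * m + b) * (D * e)))
      · rintro i s' ⟨h, -⟩
        rw [h.nv _ (by simp [hL]), hm]
      · exact ⟨(h.setNv (by simp [hL])).setNv (by simp [hL]), by simp [hx], by simp [h1],
          by simp [h2], by simp [NExp.eval], by simp [h3]⟩
      · rintro b hb s₂ ⟨g0, g1, g2, g3, g4, g5⟩ hx2
        apply Exec.seq
        have c1 : s₂.nv (B + 2) = D := by rw [g0.nv _ (by simp [hL]), hD]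
        have c2 : s₂.nv d = e := by rw [g0.nv _ (by simp [hL]; omega), he]
        refine (rowKronProg_spec hd hX hY c1 c2 g2 g5 ?_).mono ?_
        · intro i hi j hj
          rw [hf]
          simp only [index_div (index_lt hi hj), index_mod (index_lt hi hj), index_div hb,
            index_mod hb, index_div hj, index_mod hj, g3, g4]
          rw [g0.ra X (by simp [hX]), g0.ra Y (by simp [hY])]
        · rintro s₃ ⟨F, k1, k2⟩
          apply Exec.setN
          have F' : Frame L [] [] [Z] s s₃ :=
            g0.trans F (by simp [hL]) (by simp) (by simp) (by simp)
          have e1 := F.nv (B + 48) (by simp)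
          have e2 := F.nv (B + 47) (by simp)
          have e3 := F.nv (B + 53) (by simp)
          have e4 := F.nv (B + 54) (by simp)
          have e5 := F.nv d (by simp; omega)
          refine ⟨by simp [e4, hx2], (F'.setNv (by simp [hL])).setNv (by simp [hL]),
            by simp [e3, g1], by simp [k1]; ring, by simp [e2, g3],
            by simp [NExp.eval, e1, g4, e5, c2]; ring, ?_⟩
          simp only [setNv_ra, k2]
          congr 1; ring
      · rintro s₂ ⟨g0, g1, g2, g3, -, g5⟩
        apply Exec.setN
        have c1 : s₂.nv (B + 2) = D := by rw [g0.nv _ (by simp [hL]), hD]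
        refine ⟨by simp [g1], (g0.setNv (by simp [hL])).setNv (by simp [hL]), by
            simp only [setNv_nv, Nat.add_left_cancel_iff, Nat.reduceEqDiff, if_false, g2]; ring,
          by simp [NExp.eval, g3, c1]; ring, ?_⟩
        simp only [setNv_ra, g5]
        congr 1; ring
    · rintro s' ⟨h, -, -, h2⟩
      refine ⟨h, fun x hx y hy => ?_⟩
      rw [h2, fillTo_of_lt (index_lt hx hy), hf]
      simp only [index_div hy, index_mod hy]
  · simp only [NExp.cost]
    ring_nf
    omega

end Sketching

end KronLRA


namespace KronLRA

/-! ### Processing the factors one after another. -/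

section Stages

/-- An entry of a count-sketch of a sparse matrix with `n` nonzero entries, where the row and the
sign for a row `r` are those that `h r` stands for. -/
noncomputable def sketchEntry (m : ℕ) (row col : ℕ → ℕ) (val : ℕ → ℝ) (h : ℕ → ℕ) (n x c : ℕ) : ℝ :=
  ∑ t ∈ Finset.range n,
    if hashRow m (h (row t)) = x ∧ col t = c then hashSign m (h (row t)) * val t else 0

/-- The entries of a Kronecker product of matrices `b 0, …, b (i - 1)`. -/
def kronEntry (m : ℕ) (d : ℕ → ℕ) (b : ℕ → ℕ → ℕ → ℝ) : ℕ → ℕ → ℕ → ℝ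
  | 0, _, _ => 1
  | i + 1, x, y => kronEntry m d b i (x / m) (y / d i) * b i (x % m) (y % d i)

/-- Multiply the matrix that was computed so far by a count-sketch of the next factor. -/
def stageProg (B A R i : ℕ) : Prog :=
  .seq (hashProg B (3 * i + 3) (2 * i) A (A + 2 + i))
  (.seq (tableProg B (3 * i + 2) (A + 1))
  (.seq (addProg B (3 * i + 3) (2 * i) (2 * i + 1) i (A + 2 + i) (A + 1) (R + 11 + 2 * i))
  (.seq (kronProg B (3 * i + 2) (R + 10 + 2 * i) (R + 11 + 2 * i) (R + 12 + 2 * i))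
  (.seq (mulProg B (B + 1) (B + 1) B) (mulProg B (B + 2) (B + 2) (3 * i + 2))))))

def stageTime (m l P D d : ℕ) : ℕ :=
  l * 60 + m * 20 + P * (m * (D * (d * 30 + 30) + 30) + 42) + D * 12 + 60

/-- The memory after the first `i` factors have been processed. -/
structure StageInv (B A R m : ℕ) (b : ℕ → ℕ → ℕ → ℝ) (s₀ : State) (i : ℕ) (s : State) :
    Prop where
  nv : ∀ x ≤ B, s.nv x = s₀.nv x
  na : ∀ x ≤ A, s.na x = s₀.na x
  ra : ∀ x, x < R + 10 ∨ R + 10 + 2 * i < x → s.ra x = s₀.ra x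
  rows : s.nv (B + 1) = m ^ i
  cols : s.nv (B + 2) = ∏ l ∈ Finset.range i, s₀.nv (3 * l + 2)
  ptr : s.nv (B + 10) = ∑ l ∈ Finset.range i, s₀.nv (3 * l + 3)
  mat : ∀ x < m ^ i, ∀ y < ∏ l ∈ Finset.range i, s₀.nv (3 * l + 2),
    s.ra (R + 10 + 2 * i) (x * (∏ l ∈ Finset.range i, s₀.nv (3 * l + 2)) + y)
      = kronEntry m (fun l => s₀.nv (3 * l + 2)) b i x y

/-- By the mixed product rule the sketched Kronecker product is the product of the sketched factors,
so neither `A` nor the full sketch is ever formed. Each stage uses new arrays, whose initial zeros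
are the starting values of the sums. -/
theorem stageProg_spec {B A R m q i : ℕ} {b : ℕ → ℕ → ℕ → ℝ} {s₀ s : State} (hiq : i < q)
    (hB : 3 * q < B) (hA : 2 * q ≤ A) (hR : q ≤ R) (hm : s₀.nv B = m)
    (hz : ∀ x, R ≤ x → s₀.ra x = 0)
    (hcol : ∀ t < s₀.nv (3 * i + 3), s₀.na (2 * i + 1) t < s₀.nv (3 * i + 2))
    {ι : ℕ → ℕ} (hι : ∀ t < s₀.nv (3 * i + 3), ∀ f g,
      writeAt (s₀.na (2 * i)) f g (s₀.nv (3 * i + 3)) (s₀.na (2 * i) t) = f (ι (s₀.na (2 * i) t)))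
    (hτ : ∀ t < s₀.nv (3 * i + 3), s₀.na A ((∑ l ∈ Finset.range i, s₀.nv (3 * l + 3)) +
      ι (s₀.na (2 * i) t)) < 2 * m)
    (hb : b i = sketchEntry m (s₀.na (2 * i)) (s₀.na (2 * i + 1)) (s₀.ra i)
      (fun r => s₀.na A ((∑ l ∈ Finset.range i, s₀.nv (3 * l + 3)) + ι r)) (s₀.nv (3 * i + 3)))
    (hs : StageInv B A R m b s₀ i s) :
    Exec (stageProg B A R i) s (stageTime m (s₀.nv (3 * i + 3)) (m ^ i)
      (∏ l ∈ Finset.range i, s₀.nv (3 * l + 2)) (s₀.nv (3 * i + 2)))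
      (StageInv B A R m b s₀ (i + 1)) := by
  obtain ⟨i1, i2, i3, i4, i5, i6, i7⟩ := hs
  set l := s₀.nv (3 * i + 3) with hl
  set d := s₀.nv (3 * i + 2) with hd
  set D := ∏ l ∈ Finset.range i, s₀.nv (3 * l + 2) with hD
  set o := ∑ l ∈ Finset.range i, s₀.nv (3 * l + 3) with ho
  set row := s₀.na (2 * i) with hrow
  set h : ℕ → ℕ := fun r => s₀.na A (o + ι r) with hh
  have l0 : s.nv (3 * i + 3) = l := i1 _ (by omega)
  have d0 : s.nv (3 * i + 2) = d := i1 _ (by omega)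
  have m0 : s.nv B = m := (i1 _ le_rfl).trans hm
  have r0 : s.na (2 * i) = row := i2 _ (by omega)
  have t0 : s.na A = s₀.na A := i2 _ le_rfl
  have v0 : s.ra i = s₀.ra i := i3 _ (by omega)
  apply Exec.le
  · apply Exec.seq
    have h1 := hashProg_spec (B := B) (l := 3 * i + 3) (X := 2 * i) (A := A) (H := A + 2 + i)
      (by omega) (by omega) (by omega) s
    rw [l0, r0, i6, t0] at h1
    refine h1.mono ?_
    rintro s₁ ⟨F1, a1, a2⟩
    have a3 : ∀ t < l, s₁.na (A + 2 + i) (row t) = h (row t) := fun t ht => by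
      rw [a2, hι t ht]
    apply Exec.seq
    have h2 := tableProg_spec (B := B) (d := 3 * i + 2) (O := A + 1) (by omega) s₁
    rw [F1.nv B (by simp), m0, F1.nv (3 * i + 2)
      (by simp only [List.mem_cons, List.not_mem_nil, or_false]; omega), d0] at h2
    refine h2.mono ?_
    rintro s₂ ⟨F2, b1⟩
    have nv2 : ∀ x, x ≤ B + 9 → s₂.nv x = s.nv x := fun x hx => by
      rw [F2.nv _ (by simp only [List.mem_cons, List.not_mem_nil, or_false]; omega),
        F1.nv _ (by simp only [List.mem_cons, List.not_mem_nil, or_false]; omega)]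
    have na2 : ∀ x, x ≤ A → s₂.na x = s.na x := fun x hx => by
      rw [F2.na _ (by simp only [List.mem_cons, List.not_mem_nil, or_false]; omega),
        F1.na _ (by simp only [List.mem_cons, List.not_mem_nil, or_false]; omega)]
    have ra2 : ∀ x, s₂.ra x = s.ra x := fun x => by
      rw [F2.ra _ (by simp), F1.ra _ (by simp)]
    have c3 : ∀ t < l, s₂.na (A + 2 + i) (row t) = h (row t) := fun t ht => by
      rw [F2.na _ (by simp; omega), a3 t ht]
    have p2 : s₂.nv (B + 10) = o + l := by
      rw [F2.nv _ (by simp), a1]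
    clear F1 F2 a1 a2 a3 h1 h2
    apply Exec.seq
    have h3 := addProg_spec (B := B) (l := 3 * i + 3) (X := 2 * i) (Y := 2 * i + 1) (V := i)
      (H := A + 2 + i) (O := A + 1) (Z := R + 11 + 2 * i) (m := m) (d := d) (by omega) (by omega)
      (s := s₂) (by rw [nv2 _ (by omega), m0]) b1 (by
        rw [nv2 _ (by omega), l0, na2 (2 * i) (by omega), r0]
        intro t ht
        rw [c3 t ht]; exact hτ t ht)
    rw [nv2 (3 * i + 3) (by omega), l0, na2 (2 * i) (by omega), r0, na2 (2 * i + 1) (by omega),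
      i2 _ (by omega), ra2, ra2, v0] at h3
    refine h3.mono ?_
    rintro s₃ ⟨F3, e1⟩
    have e2 : ∀ x c, c < d → s₃.ra (R + 11 + 2 * i) (x * d + c) = b i x c := fun x c hc => by
      rw [e1, i3 _ (by omega), hz _ (by omega), hb, sketchEntry]
      simp only [Pi.zero_apply, zero_add]
      refine Finset.sum_congr rfl fun t ht => ?_
      have ht := Finset.mem_range.1 ht
      rw [c3 t ht]
      -- Column indices are below `d`, so a cell determines its row and column by division with
      -- remainder.
      have : (hashRow m (h (row t)) * d + s₀.na (2 * i + 1) t = x * d + c) ↔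
          (hashRow m (h (row t)) = x ∧ s₀.na (2 * i + 1) t = c) := by
        constructor
        · intro he
          have h4 := congrArg (· / d) he
          have h5 := congrArg (· % d) he
          simp only [index_div hc, index_mod hc, index_div (hcol t ht), index_mod (hcol t ht)]
            at h4 h5
          exact ⟨h4, h5⟩
        · rintro ⟨h4, h5⟩; rw [h4, h5]
      simp only [this]
    have nv3 : ∀ x, x ≤ B + 10 → s₃.nv x = s₂.nv x := fun x hx =>
      F3.nv _ (by simp only [List.mem_cons, List.not_mem_nil, or_false]; omega)
    have na3 : ∀ x, x ≤ A → s₃.na x = s.na x := fun x hx => by rw [F3.na _ (by simp), na2 x hx]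
    have ra3 : ∀ x, x ≠ R + 11 + 2 * i → s₃.ra x = s.ra x := fun x hx => by
      rw [F3.ra _ (by simpa using hx), ra2]
    clear F3 h3 e1
    apply Exec.seq
    have h4 := kronProg_spec (B := B) (d := 3 * i + 2) (X := R + 10 + 2 * i) (Y := R + 11 + 2 * i)
      (Z := R + 12 + 2 * i) (P := m ^ i) (D := D) (m := m) (e := d) (by omega) (by omega)
      (by omega) (s := s₃) (by rw [nv3 _ (by omega), nv2 _ (by omega), i4])
      (by rw [nv3 _ (by omega), nv2 _ (by omega), i5]) (by rw [nv3 _ (by omega), nv2 _ (by omega),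
        m0]) (by rw [nv3 _ (by omega), nv2 _ (by omega), d0])
    refine h4.mono ?_
    rintro s₄ ⟨F4, g1⟩
    have nv4 : ∀ x, x ≤ B + 10 → s₄.nv x = s₂.nv x := fun x hx => by
      rw [F4.nv _ (by simp only [List.mem_cons, List.not_mem_nil, or_false]; omega), nv3 x hx]
    have na4 : ∀ x, x ≤ A → s₄.na x = s.na x := fun x hx => by rw [F4.na _ (by simp), na3 x hx]
    have ra4 : ∀ x, x ≠ R + 11 + 2 * i → x ≠ R + 12 + 2 * i → s₄.ra x = s.ra x :=
      fun x hx hx' => by rw [F4.ra _ (by simpa using hx'), ra3 x hx]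
    clear F4 h4
    apply Exec.seq
    have h5 := mulProg_spec (B := B) (z := B + 1) (x := B + 1) (y := B) (by omega) (by omega)
      (by omega) (by omega) s₄
    rw [nv4 (B + 1) (by omega), nv2 (B + 1) (by omega), nv4 B (by omega), nv2 B (by omega), i4,
      m0] at h5
    refine h5.mono ?_
    rintro s₅ ⟨F5, k1⟩
    have h6 := mulProg_spec (B := B) (z := B + 2) (x := B + 2) (y := 3 * i + 2) (by omega) (by omega)
      (by omega) (by omega) s₅
    rw [F5.nv (B + 2) (by simp), F5.nv (3 * i + 2)
      (by simp only [List.mem_cons, List.not_mem_nil, or_false]; omega), nv4 (B + 2) (by omega),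
      nv2 (B + 2) (by omega), i5, nv4 (3 * i + 2) (by omega), nv2 (3 * i + 2) (by omega), d0] at h6
    refine h6.mono ?_
    rintro s₆ ⟨F6, k2⟩
    have nv6 : ∀ x, x ≤ B + 10 → x ≠ B + 1 → x ≠ B + 2 → s₆.nv x = s₂.nv x := fun x hx h1 h2 => by
      rw [F6.nv _ (by simp only [List.mem_cons, List.not_mem_nil, or_false]; omega),
        F5.nv _ (by simp only [List.mem_cons, List.not_mem_nil, or_false]; omega), nv4 x hx]
    have ra6 : ∀ x, s₆.ra x = s₄.ra x := fun x => by rw [F6.ra _ (by simp), F5.ra _ (by simp)]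
    refine ⟨fun x hx => ?_, fun x hx => ?_, fun x hx => ?_, ?_, ?_, ?_, ?_⟩
    · rw [nv6 x (by omega) (by omega) (by omega), nv2 x (by omega), i1 x hx]
    · rw [F6.na _ (by simp), F5.na _ (by simp), na4 x hx, i2 x hx]
    · rw [ra6, ra4 x (by omega) (by omega), i3 x (by omega)]
    · rw [F6.nv _ (by simp), k1, pow_succ]
    · rw [k2, Finset.prod_range_succ]
    · rw [nv6 _ (by omega) (by omega) (by omega), p2, Finset.sum_range_succ]
    · intro x hx y hy
      rw [Finset.prod_range_succ, ← hD, ← hd] at hy ⊢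
      rw [pow_succ] at hx
      have hd0 : 0 < d := Nat.pos_of_ne_zero (by rintro h0; rw [h0] at hy; omega)
      have hx1 : x / m < m ^ i := Nat.div_lt_of_lt_mul (by rwa [mul_comm])
      have hy1 : y / d < D := Nat.div_lt_of_lt_mul (by rwa [mul_comm])
      rw [ra6, show R + 10 + 2 * (i + 1) = R + 12 + 2 * i by ring, g1 x hx y hy,
        e2 _ _ (Nat.mod_lt _ hd0), ra3 _ (by omega), i7 _ hx1 _ hy1, kronEntry]
  · simp only [stageTime]
    ring_nf
    omega

/-- Compute the Kronecker product of count-sketches of the first factors. -/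
def stagesProg (B A R : ℕ) : ℕ → Prog
  | 0 => .seq (.setN (B + 1) (.lit 1)) (.seq (.setN (B + 2) (.lit 1))
    (.seq (.setN (B + 10) (.lit 0)) (.putR (R + 10) (.lit 0) (.ofNat (.lit 1)))))
  | i + 1 => .seq (stagesProg B A R i) (stageProg B A R i)

def stagesTime (m : ℕ) (l d : ℕ → ℕ) : ℕ → ℕ
  | 0 => 10
  | i + 1 => stagesTime m l d i +
    stageTime m (l i) (m ^ i) (∏ l ∈ Finset.range i, d l) (d i)

theorem stagesProg_spec {B A R m q : ℕ} {b : ℕ → ℕ → ℕ → ℝ} {s₀ : State}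
    (hB : 3 * q < B) (hA : 2 * q ≤ A) (hR : q ≤ R) (hm : s₀.nv B = m)
    (hz : ∀ x, R ≤ x → s₀.ra x = 0)
    (hcol : ∀ i < q, ∀ t < s₀.nv (3 * i + 3), s₀.na (2 * i + 1) t < s₀.nv (3 * i + 2))
    {ι : ℕ → ℕ → ℕ} (hι : ∀ i < q, ∀ t < s₀.nv (3 * i + 3), ∀ f g,
      writeAt (s₀.na (2 * i)) f g (s₀.nv (3 * i + 3)) (s₀.na (2 * i) t) = f (ι i (s₀.na (2 * i) t)))
    (hτ : ∀ i < q, ∀ t < s₀.nv (3 * i + 3), s₀.na A ((∑ l ∈ Finset.range i, s₀.nv (3 * l + 3)) +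
      ι i (s₀.na (2 * i) t)) < 2 * m)
    (hb : ∀ i < q, b i = sketchEntry m (s₀.na (2 * i)) (s₀.na (2 * i + 1)) (s₀.ra i)
      (fun r => s₀.na A ((∑ l ∈ Finset.range i, s₀.nv (3 * l + 3)) + ι i r)) (s₀.nv (3 * i + 3)))
    {i : ℕ} (hi : i ≤ q) :
    Exec (stagesProg B A R i) s₀ (stagesTime m (fun l => s₀.nv (3 * l + 3))
      (fun l => s₀.nv (3 * l + 2)) i) (StageInv B A R m b s₀ i) := by
  induction i with
  | zero =>
    apply Exec.le
    · apply Exec.seq; apply Exec.setN; apply Exec.seq; apply Exec.setN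
      apply Exec.seq; apply Exec.setN; apply Exec.putR
      refine ⟨fun x hx => ?_, fun x hx => rfl, fun x hx => ?_, ?_, ?_, ?_, ?_⟩
      · simp only [putRa_nv, setNv_nv]
        rw [if_neg (by omega), if_neg (by omega), if_neg (by omega)]
      · simp only [putRa_ra, setNv_ra]
        rw [if_neg (by omega)]
      · simp [NExp.eval]
      · simp [NExp.eval]
      · simp [NExp.eval]
      · intro x hx y hy
        rw [pow_zero] at hx
        simp only [Finset.range_zero, Finset.prod_empty] at hy
        obtain rfl : x = 0 := by omega
        obtain rfl : y = 0 := by omega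
        simp [NExp.eval, RExp.eval, kronEntry]
    · simp only [NExp.cost, RExp.cost, stagesTime]
      omega
  | succ i ih =>
    refine Exec.seq ((ih (by omega)).mono fun s hs => ?_)
    exact stageProg_spec (by omega) hB hA hR hm hz (hcol i (by omega)) (hι i (by omega))
      (hτ i (by omega)) (hb i (by omega)) hs

end Stages

end KronLRA


namespace KronLRA

/-! ### Uniform distributions. -/

section Uniform

variable {α β γ : Type*} [Fintype α] [Nonempty α] [Fintype β] [Nonempty β]

theorem uniform_prod : (PMF.uniformOfFintype α).bind (fun a =>
    (PMF.uniformOfFintype β).map (Prod.mk a)) = PMF.uniformOfFintype (α × β) := by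
  classical
  ext ⟨a, b⟩
  simp only [PMF.bind_apply, PMF.map_apply, PMF.uniformOfFintype_apply, tsum_fintype,
    Prod.mk.injEq, Fintype.card_prod, Nat.cast_mul]
  rw [Finset.sum_eq_single a, Finset.sum_eq_single b]
  · simp only [and_self, if_true]
    rw [ENNReal.mul_inv] <;> simp
  · intro c _ hc; rw [if_neg (by simp [hc.symm])]
  · simp
  · intro c _ hc
    rw [Finset.sum_eq_zero, mul_zero]
    intro x _; rw [if_neg (by simp [hc.symm])]
  · simp

theorem uniform_bind_map (F : α → β → γ) : (PMF.uniformOfFintype α).bind (fun a =>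
    (PMF.uniformOfFintype β).map (F a))
      = (PMF.uniformOfFintype (α × β)).map fun p => F p.1 p.2 := by
  rw [← uniform_prod, PMF.map_bind]
  congr 1
  funext a
  rw [PMF.map_comp]
  rfl

theorem uniform_map_equiv (e : α ≃ β) :
    (PMF.uniformOfFintype α).map e = PMF.uniformOfFintype β := by
  classical
  ext b
  simp only [PMF.map_apply, PMF.uniformOfFintype_apply, tsum_fintype]
  rw [Finset.sum_eq_single (e.symm b), if_pos (by simp), Fintype.card_congr e]
  · intro a _ ha
    rw [if_neg]
    rintro rfl; simp at ha
  · simp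

theorem uniform_of_unique [Unique α] (f : α → γ) :
    (PMF.uniformOfFintype α).map f = PMF.pure (f default) := by
  have : PMF.uniformOfFintype α = PMF.pure default := by
    ext a
    rw [Subsingleton.elim a default]
    simp
  rw [this, PMF.pure_map]

/-- Restricting a uniformly random function along an injection gives a uniformly random function:
the values off the range are free. The statement is cross-multiplied to avoid division. -/
theorem card_comp_injective {Z Y : Type*} [Fintype Z] [Fintype Y] {ι : Z → Y}
    (hι : Function.Injective ι) (p : (Z → α) → Prop) :
    (Nat.card {f : Y → α // p (f ∘ ι)} : ℝ) * Nat.card (Z → α)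
      = Nat.card {g : Z → α // p g} * Nat.card (Y → α) := by
  classical
  let e : (Y → α) ≃ (Z → α) × (↥(Set.range ι)ᶜ → α) :=
    (Equiv.arrowCongr ((Equiv.Set.sumCompl (Set.range ι)).symm.trans
      (Equiv.sumCongr (Equiv.ofInjective ι hι).symm (Equiv.refl _))) (Equiv.refl α)).trans
      (Equiv.sumArrowEquivProdArrow _ _ _)
  have he : ∀ f, (e f).1 = f ∘ ι := fun f => by
    funext z
    simp [e, Equiv.sumArrowEquivProdArrow]
  have h1 : Nat.card {f : Y → α // p (f ∘ ι)}
      = Nat.card {g : Z → α // p g} * Nat.card (↥(Set.range ι)ᶜ → α) := by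
    rw [← Nat.card_prod]
    refine Nat.card_congr ((e.subtypeEquiv fun f => ?_).trans
      (Equiv.prodSubtypeFstEquivSubtypeProd (p := p)))
    rw [he]
  rw [Nat.card_congr e, Nat.card_prod, h1]
  push_cast
  ring

end Uniform

/-! ### Triples for randomized programs, and the random tape. -/

section Law

variable {Ω : Type*} [Fintype Ω] [Nonempty Ω] {p r : Prog} {s : State} {T T₁ T₂ : ℕ}
  {Q Q' : Ω → State → Prop}

/-- Started in the memory `s`, the program makes the uniformly random choice of an `ω`, and stops
within `T` steps; the final memory satisfies `Q ω`. -/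
def Law (Ω : Type*) [Fintype Ω] [Nonempty Ω] (p : Prog) (s : State) (T : ℕ)
    (Q : Ω → State → Prop) : Prop :=
  ∀ N, T < N → ∀ t, ∃ (f : Ω → State) (g : Ω → ℕ),
    p.eval N (s.withTime t)
      = (PMF.uniformOfFintype Ω).map (fun ω => some ((f ω).withTime (g ω))) ∧
    ∀ ω, g ω ≤ t + T ∧ Q ω (f ω)

theorem Law.exec_seq (h : Exec p s T₁ fun s' => Law Ω r s' T₂ Q) :
    Law Ω (.seq p r) s (T₁ + T₂) Q := fun N hN t => by
  obtain ⟨s', t', h1, h2, h3⟩ := h N (by omega) t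
  obtain ⟨f, g, h4, h5⟩ := h3 N (by omega) t'
  refine ⟨f, g, ?_, fun ω => ⟨by linarith [(h5 ω).1], (h5 ω).2⟩⟩
  rw [Prog.eval, andThen, h1, PMF.pure_bind]
  exact h4

theorem map_some_andThen_pure (f : Ω → State) (g : State → PMF (Option State)) (k : Ω → State)
    (h : ∀ ω, g (f ω) = PMF.pure (some (k ω))) :
    andThen ((PMF.uniformOfFintype Ω).map fun ω => some (f ω)) g
      = (PMF.uniformOfFintype Ω).map fun ω => some (k ω) := by
  rw [andThen, PMF.bind_map, ← PMF.bind_pure_comp]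
  congr 1
  funext ω
  exact h ω

theorem Law.seq_exec (h : Law Ω p s T₁ fun ω s' => Exec r s' T₂ (Q ω)) :
    Law Ω (.seq p r) s (T₁ + T₂) Q := fun N hN t => by
  obtain ⟨f, g, h4, h5⟩ := h N (by omega) t
  choose s' t' h1 h2 h3 using fun ω => (h5 ω).2 N (by omega) (g ω)
  refine ⟨s', t', ?_, fun ω => ⟨by linarith [(h5 ω).1, h2 ω], h3 ω⟩⟩
  rw [Prog.eval, h4, map_some_andThen_pure _ _ _ h1]

theorem Law.mono (h : Law Ω p s T Q) (hQ : ∀ ω s', Q ω s' → Q' ω s') : Law Ω p s T Q' :=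
  fun N hN t => by
    obtain ⟨f, g, h4, h5⟩ := h N hN t
    exact ⟨f, g, h4, fun ω => ⟨(h5 ω).1, hQ _ _ (h5 ω).2⟩⟩

/-- Fill an array of length `B + 3` with random numbers below `2 * B`. -/
def tapeProg (B A : ℕ) : Prog :=
  .seq (.setN (B + 8) (.lit 0)) (.loop (.ltN (.var (B + 8)) (.var (B + 3)))
    (.seq (.rand (B + 9) (.sub (.add (.var B) (.var B)) (.lit 1)))
      (.seq (.putN A (.var (B + 8)) (.var (B + 9)))
        (.setN (B + 8) (.add (.var (B + 8)) (.lit 1))))))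

theorem rand_eval {x : ℕ} {e : NExp} {M : ℕ} [NeZero M] (N t : ℕ)
    (hM : e.eval (s.withTime t) + 1 = M) :
    (Prog.rand x e).eval N (s.withTime t) = (PMF.uniformOfFintype (Fin M)).map fun v : Fin M =>
      some ((s.setNv x v).withTime (t + (e.cost + 1))) := by
  subst hM
  rw [Prog.eval]
  rfl

/-- All randomness is drawn in advance, so the remainder of the program is deterministic given the
tape. Induction on the number of missing cells combines one draw with a uniform tail through
`Fin.cons`. -/
theorem tapeProg_law {B A m L : ℕ} [NeZero (2 * m)] (hm : s.nv B = m) (hL : s.nv (B + 3) = L) :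
    Law (Fin L → Fin (2 * m)) (tapeProg B A) s (L * 20 + 6) fun ω s' =>
      Frame [B + 8, B + 9] [] [A] [] s s' ∧ ∀ t : Fin L, s'.na A t = ω t := by
  set test : Test := .ltN (.var (B + 8)) (.var (B + 3)) with htest
  set body : Prog := .seq (.rand (B + 9) (.sub (.add (.var B) (.var B)) (.lit 1)))
      (.seq (.putN A (.var (B + 8)) (.var (B + 9)))
        (.setN (B + 8) (.add (.var (B + 8)) (.lit 1)))) with hbody
  have hm0 : 2 * m ≠ 0 := NeZero.ne _
  intro N hN t
  have hstep : ∀ s : State, s.nv B = m → ∀ u, body.eval N (s.withTime u)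
      = (PMF.uniformOfFintype (Fin (2 * m))).map fun v : Fin (2 * m) =>
        some (((((s.setNv (B + 9) v).putNa A (s.nv (B + 8)) v).setNv (B + 8)
          (s.nv (B + 8) + 1))).withTime (u + 13)) := by
    intro s hs u
    rw [hbody, Prog.eval, rand_eval (M := 2 * m) _ _ (by
      rw [NExp.eval_withTime]; simp only [NExp.eval, hs]; omega)]
    apply map_some_andThen_pure
    intro v
    simp only [Prog.eval, andThen, PMF.pure_bind, Option.elim]
    congr 2
    simp [NExp.eval, NExp.cost, State.withTime, State.tick, State.setNv, State.putNa]
  have key : ∀ r i, i + r = L → ∀ N', r < N' → ∀ s : State, s.nv B = m → s.nv (B + 3) = L →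
      s.nv (B + 8) = i → ∀ u, ∃ (f : (Fin r → Fin (2 * m)) → State) (g : _ → ℕ),
      loopEval test (body.eval N) N' (s.withTime u)
        = (PMF.uniformOfFintype (Fin r → Fin (2 * m))).map
          (fun ω => some ((f ω).withTime (g ω))) ∧
      ∀ ω, g ω ≤ u + (r * 20 + 4) ∧ Frame [B + 8, B + 9] [] [A] [] s (f ω) ∧
        (∀ z < i, (f ω).na A z = s.na A z) ∧ ∀ z : Fin r, (f ω).na A (i + z) = ω z := by
    intro r
    induction r with
    | zero =>
      intro i hi N' hN' s h1 h2 h3 u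
      obtain ⟨N', rfl⟩ := Nat.exists_eq_succ_of_ne_zero hN'.ne'
      refine ⟨fun _ => s, fun _ => u + 4, ?_, fun ω => ⟨by dsimp only; omega, Frame.refl, fun _ _ => rfl,
        fun z => z.elim0⟩⟩
      have ht : test.eval s = false := by simp [htest, Test.eval, NExp.eval, h2, h3]; omega
      rw [loopEval, Test.eval_withTime, ht, if_neg (by simp), uniform_of_unique]
      rfl
    | succ r ih =>
      intro i hi N' hN' s h1 h2 h3 u
      obtain ⟨N', rfl⟩ := Nat.exists_eq_succ_of_ne_zero (by omega : N' ≠ 0)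
      have ht : test.eval s = true := by simp [htest, Test.eval, NExp.eval, h2, h3]; omega
      set s' : Fin (2 * m) → State := fun v =>
        (((s.setNv (B + 9) v).putNa A (s.nv (B + 8)) v).setNv (B + 8) (s.nv (B + 8) + 1)) with hs'
      choose f g h4 h5 using fun v => ih (i + 1) (by omega) N' (by omega) (s' v)
        (by simp [hs', h1]) (by simp [hs', h2]) (by simp [hs', h3]) (u + 4 + 13)
      refine ⟨fun ω => f (ω 0) (fun j => ω j.succ), fun ω => g (ω 0) (fun j => ω j.succ), ?_,
        fun ω => ?_⟩
      · rw [loopEval, Test.eval_withTime, ht, if_pos rfl, withTime_tick, andThen, hstep s h1,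
          PMF.bind_map]
        have : (fun o : Option State => o.elim (PMF.pure none)
            (loopEval test (Prog.eval N body) N')) ∘ (fun v => some ((s' v).withTime
              (u + (test.cost + 1) + 13)))
            = fun v => (PMF.uniformOfFintype (Fin r → Fin (2 * m))).map
              (fun ω => some ((f v ω).withTime (g v ω))) := by
          funext v
          exact h4 v
        rw [this, uniform_bind_map (fun v ω => some ((f v ω).withTime (g v ω))),
          ← uniform_map_equiv (Fin.consEquiv (n := r) fun _ => Fin (2 * m)), PMF.map_comp]
        rfl
      · obtain ⟨k1, k2, k3, k4⟩ := h5 (ω 0) (fun j => ω j.succ)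
        have F : Frame [B + 8, B + 9] [] [A] [] s (s' (ω 0)) :=
          ((Frame.refl.setNv (by simp)).putNa (by simp)).setNv (by simp)
        refine ⟨by dsimp only; omega, F.trans k2 (by simp) (by simp) (by simp) (by simp), ?_, ?_⟩
        · intro z hz
          rw [k3 z (by omega)]
          simp only [hs', setNv_na, putNa_na, if_true, h3]
          rw [Function.update_of_ne (by omega)]
        · intro z
          refine Fin.cases ?_ (fun j => ?_) z
          · rw [Fin.val_zero, add_zero, k3 i (by omega)]
            simp [hs', h3]
          · rw [Fin.val_succ, show i + ((j : ℕ) + 1) = i + 1 + j by ring, k4]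
  have hrun : (tapeProg B A).eval N (s.withTime t)
      = loopEval test (body.eval N) N ((s.setNv (B + 8) 0).withTime (t + 2)) := by
    rw [tapeProg, Prog.eval, Prog.eval, andThen, PMF.pure_bind]
    rfl
  obtain ⟨f, g, h4, h5⟩ := key L 0 (by omega) N (by omega) (s.setNv (B + 8) 0) (by simp [hm])
    (by simp [hL]) (by simp) (t + 2)
  refine ⟨f, g, hrun.trans h4, fun ω => ?_⟩
  obtain ⟨k1, k2, -, k4⟩ := h5 ω
  refine ⟨by omega, (Frame.refl.setNv (by simp)).trans k2 (by simp) (by simp) (by simp) (by simp),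
    fun z => ?_⟩
  rw [← k4 z, zero_add]

end Law

end KronLRA


namespace KronLRA

/-! ### The program for a Kronecker product. -/

section Algorithm

open Matrix

/-- The total number of nonzero entries. -/
def sumExp : ℕ → NExp
  | 0 => .lit 0
  | i + 1 => .add (sumExp i) (.var (3 * i + 3))

theorem sumExp_eval (s : State) (q : ℕ) :
    (sumExp q).eval s = ∑ i ∈ Finset.range q, s.nv (3 * i + 3) := by
  induction q with
  | zero => rfl
  | succ q ih => rw [sumExp, NExp.eval, ih, Finset.sum_range_succ]; rfl

theorem sumExp_cost (q : ℕ) : (sumExp q).cost = 2 * q + 1 := by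
  induction q with
  | zero => rfl
  | succ q ih => rw [sumExp, NExp.cost, ih, NExp.cost]; ring

/-- Compute the number of rows of the count-sketches and the total number of nonzero entries. -/
def sizeProg (B q : ℕ) : Prog :=
  .seq (.setN B (.lit 0)) (.seq (.loop (.ltR (.ofNat (.var B))
    (.div (.mul (.ofNat (.lit (64000 * q))) (.mul (.ofNat (.var 0)) (.ofNat (.var 0))))
      (.mul (.var 0) (.var 0)))) (.setN B (.add (.var B) (.lit 1))))
    (.setN (B + 3) (sumExp q)))

/-- The number of rows of the count-sketches. -/
noncomputable def sketchRows (q k : ℕ) (ε : ℝ) : ℕ := ⌈64000 * q * (k : ℝ) ^ 2 / ε ^ 2⌉₊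

/-- Reals cannot be converted to natural numbers, so the ceiling is found by counting up; this is
affordable since the number of sketch rows is polynomial in `k/ε` for fixed `q`. -/
theorem sizeProg_spec {B q k : ℕ} {ε : ℝ} (hB : 3 * q < B) {s : State} (hk : s.nv 0 = k)
    (hε : s.rv 0 = ε) :
    Exec (sizeProg B q) s (sketchRows q k ε * 20 + 2 * q + 20) fun s' =>
      Frame [B, B + 3] [] [] [] s s' ∧ s'.nv B = sketchRows q k ε ∧
      s'.nv (B + 3) = ∑ i ∈ Finset.range q, s.nv (3 * i + 3) := by
  have hB0 : B ≠ 0 := by omega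
  apply Exec.le
  · apply Exec.seq; apply Exec.setN; apply Exec.seq
    have hev : ∀ s' : State, Frame [B, B + 3] [] [] [] s s' →
        (RExp.div (.mul (.ofNat (.lit (64000 * q))) (.mul (.ofNat (.var 0)) (.ofNat (.var 0))))
          (.mul (.var 0) (.var 0))).eval s' = 64000 * q * (k : ℝ) ^ 2 / ε ^ 2 := by
      intro s' h
      simp only [RExp.eval, NExp.eval, h.nv 0 (by simp [hB0.symm]), h.rv 0 (by simp), hk, hε]
      push_cast
      rw [sq, sq]
    apply Exec.loop (sketchRows q k ε)
      (fun i s' => Frame [B, B + 3] [] [] [] s s' ∧ s'.nv B = i)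
    · exact ⟨Frame.refl.setNv (by simp), by simp [NExp.eval]⟩
    · rintro i hi s' ⟨h, h1⟩
      refine ⟨?_, ?_⟩
      · rw [Test.eval, hev s' h]
        simp only [RExp.eval, NExp.eval, h1, decide_eq_true_eq]
        exact Nat.lt_ceil.1 hi
      · apply Exec.setN
        exact ⟨h.setNv (by simp), by simp [NExp.eval, h1]⟩
    · rintro s' ⟨h, h1⟩
      refine ⟨?_, ?_⟩
      · rw [Test.eval, hev s' h]
        simp only [RExp.eval, NExp.eval, h1, decide_eq_false_iff_not, not_lt]
        exact Nat.le_ceil _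
      · apply Exec.setN
        refine ⟨h.setNv (by simp), by simp [h1], ?_⟩
        rw [sumExp_eval]
        simp only [setNv_nv, if_true]
        refine Finset.sum_congr rfl fun i hi => ?_
        have := Finset.mem_range.1 hi
        rw [h.nv _ (by simp only [List.mem_cons, List.not_mem_nil, or_false]; omega)]
  · simp only [NExp.cost, RExp.cost, Test.cost, sumExp_cost]
    omega

/-- The deterministic part of the algorithm. -/
def tailProg (q B A R : ℕ) : Prog :=
  .seq (stagesProg B A R q) (.seq (.setN (B + 6) (.add (.add (.add (.var (B + 2)) (.var (B + 2)))
      (.add (.var 0) (.add (.var 0) (.var 0)))) (.add (.var (B + 1)) (.var B))))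
    (.seq (powerProg B R (R + 10 + 2 * q)) (greedyProg B R (R + 3))))

/-- The number of squarings. -/
def squarings (P D k m : ℕ) : ℕ := D + D + (k + (k + k)) + (P + m)

def tailTime (q m k : ℕ) (l d : ℕ → ℕ) : ℕ :=
  stagesTime m l d q + (14 + (powerTime (m ^ q) (∏ l ∈ Finset.range q, d l)
    (squarings (m ^ q) (∏ l ∈ Finset.range q, d l) k m) +
    greedyTime (m ^ q) (∏ l ∈ Finset.range q, d l) k))

/-- Everything after the tape has been drawn. The sketch is given as `M` in flattened indices, and
the number of squarings uses the dimensions left behind by the stages. -/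
theorem tailProg_spec {B A R m q k : ℕ} {b : ℕ → ℕ → ℕ → ℝ} {s₀ : State}
    (hB : 3 * q < B) (hA : 2 * q ≤ A) (hR : q ≤ R) (hm : s₀.nv B = m) (hk : s₀.nv 0 = k)
    (hkD : k ≤ ∏ l ∈ Finset.range q, s₀.nv (3 * l + 2))
    (hz : ∀ x, R ≤ x → s₀.ra x = 0)
    (hcol : ∀ i < q, ∀ t < s₀.nv (3 * i + 3), s₀.na (2 * i + 1) t < s₀.nv (3 * i + 2))
    {ι : ℕ → ℕ → ℕ} (hι : ∀ i < q, ∀ t < s₀.nv (3 * i + 3), ∀ f g,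
      writeAt (s₀.na (2 * i)) f g (s₀.nv (3 * i + 3)) (s₀.na (2 * i) t) = f (ι i (s₀.na (2 * i) t)))
    (hτ : ∀ i < q, ∀ t < s₀.nv (3 * i + 3), s₀.na A ((∑ l ∈ Finset.range i, s₀.nv (3 * l + 3)) +
      ι i (s₀.na (2 * i) t)) < 2 * m)
    (hb : ∀ i < q, b i = sketchEntry m (s₀.na (2 * i)) (s₀.na (2 * i + 1)) (s₀.ra i)
      (fun r => s₀.na A ((∑ l ∈ Finset.range i, s₀.nv (3 * l + 3)) + ι i r)) (s₀.nv (3 * i + 3)))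
    {D : ℕ} (hD : D = ∏ l ∈ Finset.range q, s₀.nv (3 * l + 2))
    {M : Matrix (Fin (m ^ q)) (Fin D) ℝ}
    (hM : M = Matrix.of fun (x : Fin (m ^ q)) (y : Fin D) => kronEntry m (fun l => s₀.nv (3 * l + 2)) b q x y) :
    Exec (tailProg q B A R) s₀ (tailTime q m k (fun l => s₀.nv (3 * l + 3))
      (fun l => s₀.nv (3 * l + 2))) fun s' =>
      IsGreedy ((M * Mᵀ) ^ (2 ^ squarings (m ^ q) D k m) * M)
        (fun i (c : Fin D) => s'.ra R (i * D + c)) k := by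
  rw [tailTime, ← hD]
  rw [← hD] at hkD
  apply Exec.seq
  refine (stagesProg_spec hB hA hR hm hz hcol hι hτ hb le_rfl).mono ?_
  rintro s₁ ⟨i1, i2, i3, i4, i5, i6, i7⟩
  rw [← hD] at i5 i7
  apply Exec.seq
  refine Exec.le (T := 14) (Exec.setN ?_) le_rfl
  set σ := squarings (m ^ q) D k m with hσ
  have e0 : s₁.nv 0 = k := by rw [i1 0 (by omega), hk]
  have eB : s₁.nv B = m := by rw [i1 B le_rfl, hm]
  obtain ⟨s₂, hs₂⟩ : ∃ s₂, s₂ = s₁.setNv (B + 6) ((NExp.add (.add (.add (.var (B + 2))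
      (.var (B + 2))) (.add (.var 0) (.add (.var 0) (.var 0)))) (.add (.var (B + 1))
      (.var B))).eval s₁) := ⟨_, rfl⟩
  rw [← hs₂]
  have f6 : s₂.nv (B + 6) = σ := by
    rw [hs₂]; simp [NExp.eval, e0, eB, i4, i5, hσ, squarings]
  have f0 : ∀ x, x ≠ B + 6 → s₂.nv x = s₁.nv x := fun x hx => by rw [hs₂]; simp [hx]
  have fr : ∀ x, s₂.ra x = s₁.ra x := fun x => by rw [hs₂]; simp
  clear hs₂
  apply Exec.seq
  refine (powerProg_spec (B := B) (R := R) (M := R + 10 + 2 * q) (by omega) (by omega) (by omega)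
    (s := s₂) (P := m ^ q) (D := D) (σ := σ) (by rw [f0 _ (by omega), i4])
    (by rw [f0 _ (by omega), i5]) f6).mono ?_
  rintro s₃ ⟨F, p1, p2, p3⟩
  have hM' : arrMat (s₂.ra (R + 10 + 2 * q)) (m ^ q) D = M := by
    rw [hM]
    ext x y
    simp only [arrMat, of_apply, fr]
    exact i7 x x.2 y y.2
  rw [hM'] at p2
  rw [← p2]
  refine greedyProg_spec (by omega) ?_ ?_ ?_ p1 hkD ?_
  · rw [F.nv 0 (by simp), f0 _ (by omega), e0]
  · rw [F.nv _ (by simp), f0 _ (by omega), i4]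
  · rw [F.nv _ (by simp), f0 _ (by omega), i5]
  · intro z hzz
    rw [p3 z hzz, fr, i3 _ (by omega), hz _ (by omega)]
    rfl

/-- The randomized algorithm for a Kronecker product of `q` matrices. -/
def kronProgram (q : ℕ) : Prog :=
  .seq (sizeProg (3 * q + 1) q) (.seq (tapeProg (3 * q + 1) (2 * q))
    (tailProg q (3 * q + 1) (2 * q) q))

end Algorithm

/-! ### Running time estimates. -/

section Time

theorem prod_range_le {d : ℕ → ℕ} {i q : ℕ} (hi : i ≤ q) (hd : ∀ l < q, 0 < d l) :
    ∏ l ∈ Finset.range i, d l ≤ ∏ l ∈ Finset.range q, d l := by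
  refine Finset.prod_le_prod_of_subset_of_one_le' (fun x hx => ?_) fun l hl _ => ?_
  · simp only [Finset.mem_range] at hx ⊢; omega
  · exact hd l (Finset.mem_range.1 hl)

/-- Apart from reading the entries, a stage costs a multiple of the size of its output, and the
outputs grow towards size `m^q ∏ d j`. Positivity of the `d j` is what makes the partial products
monotone. -/
theorem stagesTime_le {m q : ℕ} {l d : ℕ → ℕ} (hm : 0 < m) (hd : ∀ i < q, 0 < d i) {i : ℕ}
    (hi : i ≤ q) : stagesTime m l d i ≤ 10 + 60 * ∑ j ∈ Finset.range i, l j +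
      i * (240 * (m ^ q * ∏ j ∈ Finset.range q, d j)) := by
  induction i with
  | zero => simp [stagesTime]
  | succ i ih =>
    have h1 := ih (by omega)
    set D := ∏ j ∈ Finset.range q, d j with hD
    set E := ∏ j ∈ Finset.range i, d j with hE
    have e1 : E * d i ≤ D := by
      rw [hE, ← Finset.prod_range_succ]
      exact prod_range_le hi hd
    have e2 : m ^ i * m ≤ m ^ q := by
      rw [← pow_succ]; exact Nat.pow_le_pow_right hm hi
    have hdi := hd i (by omega)
    have hE0 : 0 < E := Finset.prod_pos fun j hj => hd j (by have := Finset.mem_range.1 hj; omega)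
    have hp0 : 0 < m ^ i := pow_pos hm i
    set p := m ^ i with hp
    have hDp : 0 < E * d i := Nat.mul_pos hE0 hdi
    have a0 : p * m * (E * d i) ≤ m ^ q * D := Nat.mul_le_mul e2 e1
    have a1 : p * m ≤ m ^ q * D := (Nat.le_mul_of_pos_right _ hDp).trans a0
    have a2 : p ≤ m ^ q * D := (Nat.le_mul_of_pos_right _ hm).trans a1
    have a3 : m ≤ m ^ q * D := (Nat.le_mul_of_pos_left _ hp0).trans a1
    have a4 : p * m * E ≤ m ^ q * D :=
      (Nat.mul_le_mul_left _ (Nat.le_mul_of_pos_right _ hdi)).trans a0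
    have a5 : E ≤ m ^ q * D := (Nat.le_mul_of_pos_left _ (Nat.mul_pos hp0 hm)).trans a4
    have a6 : 1 ≤ m ^ q * D := le_trans hm a3
    rw [stagesTime, Finset.sum_range_succ, stageTime, ← hE, ← hp]
    have e3 : p * (m * (E * (d i * 30 + 30) + 30) + 42) = 30 * (p * m * (E * d i)) +
      30 * (p * m * E) + 30 * (p * m) + 42 * p := by ring
    rw [e3]
    have e4 : (i + 1) * (240 * (m ^ q * D)) = i * (240 * (m ^ q * D)) + 240 * (m ^ q * D) := by ring
    rw [e4]
    omega

/-- Linearity in `D` survives although the number of squarings grows with `D`, because each squaring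
costs only a polynomial in `P`. All monomials are compared with `D Z^5` for `Z = P k`. -/
theorem powerTime_add_greedyTime_le {P D k m : ℕ} (hP : 0 < P) (hD : 0 < D) (hk : 0 < k)
    (hm : m ≤ P) : powerTime P D (squarings P D k m) + greedyTime P D k
      ≤ 2000 * (D * (P * k) ^ 5) := by
  set Z := P * k with hZ
  have hPZ : P ≤ Z := Nat.le_mul_of_pos_right _ hk
  have hkZ : k ≤ Z := Nat.le_mul_of_pos_left _ hP
  have hZ0 : 0 < Z := Nat.mul_pos hP hk
  have hσ : squarings P D k m ≤ 7 * (Z * D) := by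
    have h1 : D ≤ Z * D := Nat.le_mul_of_pos_left _ hZ0
    have h2 : Z ≤ Z * D := Nat.le_mul_of_pos_right _ hD
    rw [squarings]; omega
  have h1 : powerTime P D (squarings P D k m) ≤ powerTime Z D (7 * (Z * D)) := by
    simp only [powerTime, matTime]
    gcongr
  have h2 : greedyTime P D k ≤ greedyTime Z D Z := by
    simp only [greedyTime]
    gcongr
  have mono : ∀ a ≤ 5, Z ^ a ≤ D * Z ^ 5 ∧ Z ^ a * D ≤ D * Z ^ 5 := fun a ha => by
    have := Nat.pow_le_pow_right hZ0 ha
    constructor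
    · exact this.trans (Nat.le_mul_of_pos_left _ hD)
    · rw [mul_comm]; exact Nat.mul_le_mul_left _ this
  have m0 := mono 0 (by omega)
  have m1 := mono 1 (by omega)
  have m2 := mono 2 (by omega)
  have m3 := mono 3 (by omega)
  have m4 := mono 4 (by omega)
  refine (Nat.add_le_add h1 h2).trans ?_
  simp only [powerTime, matTime, greedyTime]
  ring_nf at m0 m1 m2 m3 m4 ⊢
  omega

end Time

end KronLRA


namespace KronLRA

/-! ### Lexicographic positions of multi-indices. -/

section Flat

/-- The number with the given digits in a mixed radix system, most significant digit first. -/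
def mixedRadix (d x : ℕ → ℕ) : ℕ → ℕ
  | 0 => 0
  | i + 1 => mixedRadix d x i * d i + x i

theorem mixedRadix_lt {d x : ℕ → ℕ} {i : ℕ} (h : ∀ l < i, x l < d l) :
    mixedRadix d x i < ∏ l ∈ Finset.range i, d l := by
  induction i with
  | zero => simp [mixedRadix]
  | succ i ih =>
    rw [mixedRadix, Finset.prod_range_succ]
    exact index_lt (ih fun l hl => h l (by omega)) (h i (by omega))

theorem mixedRadix_inj {d x y : ℕ → ℕ} {i : ℕ} (hx : ∀ l < i, x l < d l) (hy : ∀ l < i, y l < d l)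
    (h : mixedRadix d x i = mixedRadix d y i) : ∀ l < i, x l = y l := by
  induction i with
  | zero => intro l hl; omega
  | succ i ih =>
    rw [mixedRadix, mixedRadix] at h
    have h1 := congrArg (· / d i) h
    have h2 := congrArg (· % d i) h
    simp only [index_div (hx i (by omega)), index_div (hy i (by omega)), index_mod (hx i (by omega)),
      index_mod (hy i (by omega))] at h1 h2
    intro l hl
    rcases Nat.lt_succ_iff_lt_or_eq.1 hl with hl | rfl
    · exact ih (fun l hl => hx l (by omega)) (fun l hl => hy l (by omega)) h1 l hl
    · exact h2

theorem mixedRadix_eq_sum (d x : ℕ → ℕ) (i : ℕ) : mixedRadix d x i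
    = ∑ l ∈ Finset.range i, x l * ∏ j ∈ Finset.Ico (l + 1) i, d j := by
  induction i with
  | zero => rfl
  | succ i ih =>
    rw [mixedRadix, ih, Finset.sum_range_succ, Finset.sum_mul]
    congr 1
    · refine Finset.sum_congr rfl fun l hl => ?_
      rw [Finset.prod_Ico_succ_top (by have := Finset.mem_range.1 hl; omega), mul_assoc]
    · simp

/-- Quotient and remainder by the last radix peel off the last digit, in step with the recursion of
`kronEntry`. -/
theorem kronEntry_mixedRadix {m : ℕ} {d x y : ℕ → ℕ} (b : ℕ → ℕ → ℕ → ℝ) {i : ℕ}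
    (hx : ∀ l < i, x l < m) (hy : ∀ l < i, y l < d l) :
    kronEntry m d b i (mixedRadix (fun _ => m) x i) (mixedRadix d y i)
      = ∏ l ∈ Finset.range i, b l (x l) (y l) := by
  induction i with
  | zero => rfl
  | succ i ih =>
    rw [mixedRadix, mixedRadix, kronEntry, index_div (hx i (by omega)), index_div (hy i (by omega)),
      index_mod (hx i (by omega)), index_mod (hy i (by omega)), Finset.prod_range_succ,
      ih (fun l hl => hx l (by omega)) (fun l hl => hy l (by omega))]

variable {q : ℕ}

theorem toArr_val {α : Type*} [Zero α] (f : Fin q → α) (i : Fin q) : toArr f i = f i := by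
  simp [toArr]

theorem toArr_lt {α : Type*} [Zero α] (f : Fin q → α) {i : ℕ} (hi : i < q) :
    toArr f i = f ⟨i, hi⟩ := by
  simp [toArr, hi]

/-- A multi-index as a sequence of digits. -/
def digits {d : Fin q → ℕ} (j : ∀ i, Fin (d i)) : ℕ → ℕ := toArr fun i => (j i : ℕ)

theorem digits_lt {d : Fin q → ℕ} (j : ∀ i, Fin (d i)) : ∀ l < q, digits j l < toArr d l := by
  intro l hl
  rw [digits, toArr_lt _ hl, toArr_lt _ hl]
  exact (j _).2

theorem prod_range_toArr (d : Fin q → ℕ) : ∏ l ∈ Finset.range q, toArr d l = ∏ i, d i := by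
  rw [Finset.prod_range]
  exact Finset.prod_congr rfl fun i _ => toArr_val d i

theorem sum_range_toArr (d : Fin q → ℕ) : ∑ l ∈ Finset.range q, toArr d l = ∑ i, d i := by
  rw [Finset.sum_range]
  exact Finset.sum_congr rfl fun i _ => toArr_val d i

theorem flat_eq {d : Fin q → ℕ} (j : ∀ i, Fin (d i)) :
    flat j = mixedRadix (toArr d) (digits j) q := by
  rw [mixedRadix_eq_sum, Finset.sum_range, flat]
  refine Finset.sum_congr rfl fun i _ => ?_
  rw [digits, toArr_val]
  congr 1
  have : Finset.Ico ((i : ℕ) + 1) q = (Finset.Ioi i).map Fin.valEmbedding := by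
    rw [Fin.map_valEmbedding_Ioi]
    ext x; simp [Nat.succ_le_iff]
  rw [this, Finset.prod_map]
  exact Finset.prod_congr rfl fun l _ => (toArr_val d l).symm

/-- The position of a multi-index in lexicographic order, as an equivalence. -/
noncomputable def flatEquiv (d : Fin q → ℕ) : (∀ i, Fin (d i)) ≃ Fin (∏ i, d i) :=
  Equiv.ofBijective (fun j => ⟨flat j, by
    rw [flat_eq, ← prod_range_toArr]; exact mixedRadix_lt (digits_lt j)⟩) <| by
    rw [Fintype.bijective_iff_injective_and_card]
    refine ⟨fun j j' h => ?_, by simp⟩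
    simp only [Fin.mk.injEq, flat_eq] at h
    funext i
    have := mixedRadix_inj (digits_lt j) (digits_lt j') h i i.2
    rw [digits, digits, toArr_val, toArr_val] at this
    exact Fin.ext this

theorem flatEquiv_val {d : Fin q → ℕ} (j : ∀ i, Fin (d i)) : (flatEquiv d j : ℕ) = flat j := rfl

theorem toArr_const (m : ℕ) : ∀ l < q, toArr (fun _ : Fin q => m) l = m := fun l hl => by
  rw [toArr_lt _ hl]

theorem mixedRadix_congr {d d' x : ℕ → ℕ} {i : ℕ} (h : ∀ l < i, d l = d' l) :
    mixedRadix d x i = mixedRadix d' x i := by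
  induction i with
  | zero => rfl
  | succ i ih => rw [mixedRadix, mixedRadix, ih fun l hl => h l (by omega), h i (by omega)]

theorem kronEntry_flat {m : ℕ} {d : Fin q → ℕ} (b : ℕ → ℕ → ℕ → ℝ) (x : Fin q → Fin m)
    (y : ∀ i, Fin (d i)) :
    kronEntry m (toArr d) b q (flat x) (flat y) = ∏ i : Fin q, b i (x i) (y i) := by
  rw [flat_eq, flat_eq, mixedRadix_congr (toArr_const m), kronEntry_mixedRadix b _ (digits_lt y),
    Finset.prod_range]
  · refine Finset.prod_congr rfl fun i _ => ?_
    rw [digits, digits, toArr_val, toArr_val]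
  · intro l hl
    have := digits_lt x l hl
    rwa [toArr_const m l hl] at this

end Flat

/-! ### Tape entries as rows and signs. -/

section Seeds

variable {m : ℕ}

/-- A number below `2 m` as a row and a sign. -/
def decode (m : ℕ) (v : Fin (2 * m)) : Fin m × Bool := (⟨hashRow m v, hashRow_lt v.2⟩, decide (v < m))

theorem decode_bijective (m : ℕ) : Function.Bijective (decode m) := by
  rw [Fintype.bijective_iff_injective_and_card]
  refine ⟨fun v w h => ?_, by simp [mul_comm]⟩
  simp only [decode, Prod.mk.injEq, Fin.mk.injEq, hashRow] at h
  obtain ⟨h1, h2⟩ := h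
  rw [decide_eq_decide] at h2
  ext
  split_ifs at h1 <;> omega

/-- Two sources of randomness, `Y → α` and `X → β`, both restrict to a uniform function on `Z`. An
event that depends on this restriction only has the same probability for both; `Z` will be the
nonzero rows. -/
theorem card_pullback_le {Z Y X α β : Type*} [Fintype Z] [Fintype Y] [Fintype X] [DecidableEq Z]
    [DecidableEq Y] [DecidableEq X] [Fintype α] [Fintype β] [Nonempty α] [Nonempty β] (e : β ≃ α)
    {ι : Z → X} (hι : Function.Injective ι) {κ : Z → Y} (hκ : Function.Injective κ)
    (p : (Z → α) → Prop) (h : (Nat.card {f : Y → α // p (f ∘ κ)} : ℝ) ≤ Nat.card (Y → α) / 10) :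
    (Nat.card {f : X → β // p (e ∘ f ∘ ι)} : ℝ) ≤ Nat.card (X → β) / 10 := by
  have h1 := card_comp_injective hκ p
  have h2 := card_comp_injective (α := β) hι fun g => p (e ∘ g)
  have h3 : Nat.card {g : Z → β // p (e ∘ g)} = Nat.card {g : Z → α // p g} :=
    Nat.card_congr ((Equiv.arrowCongr (Equiv.refl Z) e).subtypeEquiv fun g => Iff.rfl)
  have h4 : Nat.card (Z → β) = Nat.card (Z → α) :=
    Nat.card_congr (Equiv.arrowCongr (Equiv.refl Z) e)
  rw [h3, h4] at h2
  have hZ : (0 : ℝ) < Nat.card (Z → α) := by exact_mod_cast Nat.card_pos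
  have hY : (0 : ℝ) < Nat.card (Y → α) := by exact_mod_cast Nat.card_pos
  have hX : (0 : ℝ) < Nat.card (X → β) := by exact_mod_cast Nat.card_pos
  have h5 : (Nat.card {g : Z → α // p g} : ℝ) ≤ Nat.card (Z → α) / 10 := by
    have := mul_le_mul_of_nonneg_right h hZ.le
    rw [h1] at this
    nlinarith
  have := mul_le_mul_of_nonneg_right h5 hX.le
  rw [← h2] at this
  nlinarith

end Seeds

end KronLRA


namespace KronLRA

/-! ### Relabelling of greedy runs and the accuracy they reach. -/

section Transport

open Matrix

variable {I J I' J' : Type*} [Fintype I] [Fintype J] [Fintype I'] [Fintype J']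

theorem residual_comp (e : J' ≃ J) (u : ℕ → J → ℝ) (j : ℕ) (v : J → ℝ) :
    residual (fun i => u i ∘ e) j (v ∘ e) = residual u j v ∘ e := by
  induction j with
  | zero => rfl
  | succ j ih =>
    rw [residual, residual, ih, comp_equiv_dotProduct_comp_equiv]
    rfl

theorem isStep_comp_iff (e : J' ≃ J) (u : ℕ → J → ℝ) (j : ℕ) (v : J → ℝ) :
    IsStep (fun i => u i ∘ e) j (v ∘ e) ↔ IsStep u j v := by
  rw [IsStep, IsStep, residual_comp, comp_equiv_dotProduct_comp_equiv]
  refine and_congr_right fun _ => ?_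
  constructor
  · intro h
    funext c
    have := congrFun h (e.symm c)
    simpa using this
  · intro h
    rw [h]; rfl

/-- Gram–Schmidt involves only inner products of rows, so it commutes with relabelling rows and
columns. This moves the program's result from flattened indices to multi-indices. -/
theorem IsGreedy.submatrix {W : Matrix I J ℝ} {u : ℕ → J → ℝ} {k : ℕ} (h : IsGreedy W u k)
    (f : I' ≃ I) (e : J' ≃ J) : IsGreedy (W.submatrix f e) (fun i => u i ∘ e) k := by
  have hrow : ∀ a, W.submatrix f e a = W (f a) ∘ e := fun a => rfl
  intro j hj
  rcases h j hj with ⟨a, h1, h2⟩ | ⟨h1, v, hv⟩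
  · refine Or.inl ⟨f.symm a, ?_, fun b => ?_⟩
    · rw [hrow, f.apply_symm_apply, isStep_comp_iff]; exact h1
    · rw [hrow, hrow, f.apply_symm_apply, residual_comp, residual_comp,
        comp_equiv_dotProduct_comp_equiv, comp_equiv_dotProduct_comp_equiv]
      exact h2 _
  · refine Or.inr ⟨fun b => ?_, v ∘ e, (isStep_comp_iff e u j v).2 hv⟩
    rw [hrow, residual_comp, h1]; rfl

variable [DecidableEq I] [DecidableEq J] [DecidableEq I']

theorem submatrix_pow_mul (M : Matrix I J ℝ) (f : I' ≃ I) (e : J' ≃ J) (t : ℕ) :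
    ((M * Mᵀ) ^ t * M).submatrix f e
      = (M.submatrix f e * (M.submatrix f e)ᵀ) ^ t * M.submatrix f e := by
  induction t with
  | zero => simp
  | succ t ih =>
    rw [pow_succ', pow_succ', Matrix.mul_assoc, Matrix.mul_assoc, Matrix.mul_assoc,
      Matrix.mul_assoc, ← ih, transpose_submatrix, submatrix_mul_equiv, submatrix_mul_equiv]

theorem transpose_mul_pow_mul (M : Matrix I J ℝ) (t : ℕ) :
    Mᵀ * (M * Mᵀ) ^ t * M = (Mᵀ * M) ^ (t + 1) := by
  induction t with
  | zero => simp
  | succ t ih =>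
    rw [pow_succ _ (t + 1), ← ih, pow_succ]
    simp only [Matrix.mul_assoc]

/-- Powers taken on the row side become powers of the Gram matrix on the column side; the exponent
is odd because of the extra factor `M` on either side. -/
theorem gram_pow_mul (M : Matrix I J ℝ) (t : ℕ) :
    ((M * Mᵀ) ^ t * M)ᵀ * ((M * Mᵀ) ^ t * M) = (Mᵀ * M) ^ (2 * t + 1) := by
  rw [← transpose_mul_pow_mul, transpose_mul, transpose_pow, transpose_mul, transpose_transpose,
    two_mul, pow_add]
  simp only [Matrix.mul_assoc]

/-- The exponent `T = 2 · 2^σ + 1` has to exceed the pivoting loss divided by `ε/4`. Since `n + 1 ≤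
2^n`, each polynomial factor of the loss is paid for by one summand of `σ`, and `1/ε` by the summand
`m`. -/
theorem IsGreedy.near_optimal {M : Matrix I J ℝ} {u : ℕ → J → ℝ} {k m : ℕ} {ε : ℝ} (hε : 0 < ε)
    (hm : 2 / ε ≤ m) (hk0 : 0 < k) (hk : k ≤ Fintype.card J)
    (h : IsGreedy ((M * Mᵀ) ^ (2 ^ squarings (Fintype.card I) (Fintype.card J) k m) * M) u k) :
    rowsOf u k * (rowsOf u k)ᵀ = 1 ∧ frobSq (M - M * (rowsOf u k)ᵀ * rowsOf u k)
      ≤ (1 + ε / 4) * (frobSq M - ∑ i ∈ Finset.range k, sval M i ^ 2) := by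
  refine h.frobSq_le (by omega) (gram_pow_mul M _) hk0 hk (by positivity) ?_
  set P := Fintype.card I
  set D := Fintype.card J
  have two_pow : ∀ n : ℕ, (n : ℝ) + 1 ≤ 2 ^ n := fun n => by
    exact_mod_cast Nat.lt_two_pow_self (n := n)
  have h1 : (1 : ℝ) ≤ ε / 2 * 2 ^ m := by
    have : 2 / ε ≤ 2 ^ m := hm.trans (by linarith [two_pow m])
    rw [div_le_iff₀ hε] at this
    linarith
  -- The summands `2D + 3k + P + m` of the exponent supply two factors `2^D`, the factors `2^k` and
  -- `4^k`, then `2^P` and `2^m`.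
  have h2 : (2 : ℝ) ^ squarings P D k m
      = 2 ^ D * (2 ^ P * 2 ^ k * 2 ^ D * 4 ^ k) * 2 ^ m := by
    rw [squarings, show (4 : ℝ) = 2 * 2 by norm_num, mul_pow]
    simp only [pow_add]
    ring
  have h3 : (D : ℝ) * (P * (k + 1) * D * 4 ^ k) ≤ 2 ^ D * (2 ^ P * 2 ^ k * 2 ^ D * 4 ^ k) := by
    have := two_pow D
    have := two_pow P
    have := two_pow k
    gcongr <;> linarith
  push_cast
  rw [h2]
  set F : ℝ := 2 ^ D * (2 ^ P * 2 ^ k * 2 ^ D * 4 ^ k) with hF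
  have hF0 : 0 ≤ F := by positivity
  calc (D : ℝ) * (P * (k + 1) * D * 4 ^ k) ≤ F * 1 := by linarith
    _ ≤ F * (ε / 2 * 2 ^ m) := by gcongr
    _ ≤ ε / 4 * (2 * (F * 2 ^ m) + 1) := by nlinarith

end Transport

/-! ### Sketches depend only on the nonzero rows. -/

section SketchMul

open Matrix

/-- Zero entries contribute nothing to the product, and the order of the enumeration is irrelevant
for a sum. Seed and hash values have to agree only at rows that occur in the enumeration. -/
theorem sketchEntry_eq {m a b : ℕ} {A : Matrix (Fin a) (Fin b) ℝ} (e : Enum A) (s : Seed m a)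
    {h : ℕ → ℕ} (hs : ∀ t, ((s (e t).1.1).1 : ℕ) = hashRow m (h (e t).1.1) ∧
      ((s (e t).1.1).2 = true ↔ h (e t).1.1 < m)) (x : Fin m) (c : Fin b) :
    sketchEntry m (toArr fun t => ((e t).1.1 : ℕ)) (toArr fun t => ((e t).1.2 : ℕ))
      (toArr fun t => A (e t).1.1 (e t).1.2) h (nnz A) x c = (countSketch s * A) x c := by
  classical
  set f : Fin a × Fin b → ℝ := fun p => if p.2 = c then countSketch s x p.1 * A p.1 p.2 else 0
    with hf
  have h1 : (countSketch s * A) x c = ∑ p, f p := by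
    rw [Fintype.sum_prod_type, mul_apply]
    exact Finset.sum_congr rfl fun r _ => by simp [hf]
  have h2 : ∑ p, f p = ∑ p : {p : Fin a × Fin b // A p.1 p.2 ≠ 0}, f p.1 := by
    rw [← Finset.sum_subtype (Finset.univ.filter fun p : Fin a × Fin b => A p.1 p.2 ≠ 0)
      (by simp) f]
    symm
    apply Finset.sum_filter_of_ne
    intro p _ hp h0
    exact hp (by simp [hf, h0])
  rw [h1, h2, ← Equiv.sum_comp e, sketchEntry, Finset.sum_range]
  refine Finset.sum_congr rfl fun t _ => ?_
  obtain ⟨h3, h4⟩ := hs t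
  simp only [toArr_val, hf, countSketch, of_apply, Fin.ext_iff, h3, hashSign, h4]
  by_cases hx : hashRow m (h (e t).1.1) = x
  · by_cases hc : ((e t).1.2 : ℕ) = c <;> simp [hx, hc]
  · simp [hx, Ne.symm hx]

variable {q : ℕ} {n d : Fin q → ℕ} {m : ℕ}

/-- The rows of the factors that are not zero. -/
abbrev NonzeroRow (A : ∀ i, Matrix (Fin (n i)) (Fin (d i)) ℝ) : Type :=
  {p : Σ i, Fin (n i) // ∃ c, A p.1 p.2 c ≠ 0}

open Classical in
/-- Seeds with given values at the nonzero rows. -/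
noncomputable def extendSeed [NeZero m] (A : ∀ i, Matrix (Fin (n i)) (Fin (d i)) ℝ)
    (g : NonzeroRow A → Fin m × Bool) : ∀ i, Seed m (n i) := fun i r =>
  if h : ∃ c, A i r c ≠ 0 then g ⟨⟨i, r⟩, h⟩ else (0, true)

theorem countSketch_mul_congr {a b : ℕ} {A : Matrix (Fin a) (Fin b) ℝ} {s s' : Seed m a}
    (h : ∀ r, (∃ c, A r c ≠ 0) → s r = s' r) : countSketch s * A = countSketch s' * A := by
  ext x c
  simp only [mul_apply]
  refine Finset.sum_congr rfl fun r _ => ?_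
  by_cases hr : A r c = 0
  · rw [hr, mul_zero, mul_zero]
  · simp only [countSketch, of_apply, h r ⟨c, hr⟩]

/-- The failure bound for full seeds passes to tapes, since the sketch of `A` sees only the seed at
nonzero rows and these read distinct cells. -/
theorem card_not_preservesCost_tape_le [NeZero m] [NeZero (2 * m)]
    (A : ∀ i, Matrix (Fin (n i)) (Fin (d i)) ℝ)
    {k : ℕ} (hk : 0 < k) (hkd : k ≤ ∏ i, d i) (hq : 0 < q) {ε : ℝ} (hε : 0 < ε) (hε1 : ε < 1)
    (hm : 64000 * q * (k : ℝ) ^ 2 / ε ^ 2 ≤ m) {L : ℕ} {ι : NonzeroRow A → Fin L}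
    (hι : Function.Injective ι) :
    (Nat.card {ω : Fin L → Fin (2 * m) // ¬ PreservesCost k (ε / 4) (kron A)
      (extendSeed A (decode m ∘ ω ∘ ι))} : ℝ) ≤ Nat.card (Fin L → Fin (2 * m)) / 10 := by
  classical
  refine card_pullback_le (Equiv.ofBijective _ (decode_bijective m)) hι
    (κ := (Subtype.val : NonzeroRow A → Σ i, Fin (n i))) Subtype.val_injective
    (fun g => ¬ PreservesCost k (ε / 4) (kron A) (extendSeed A g)) ?_
  have h := card_not_preservesCost_le (kron A) hk (by simpa using hkd) hq hε hε1 hm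
  let e : ((Σ i, Fin (n i)) → Fin m × Bool) ≃ ∀ i, Seed m (n i) :=
    Equiv.piCurry fun _ _ => Fin m × Bool
  rw [← Nat.card_eq_fintype_card, ← Nat.card_congr e] at h
  refine le_trans (le_of_eq ?_) h
  norm_cast
  refine Nat.card_congr (e.subtypeEquiv fun f => not_congr ?_)
  -- Changing the seed at zero rows to the default `(0, true)` leaves the sketched matrix unchanged,
  -- factor by factor.
  have : kron (fun i => countSketch (extendSeed A (f ∘ Subtype.val) i)) * kron A
      = kron (fun i => countSketch (e f i)) * kron A := by
    rw [kron_mul_kron, kron_mul_kron]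
    congr 1
    funext i
    refine countSketch_mul_congr fun r hr => ?_
    rw [extendSeed, dif_pos hr]
    rfl
  rw [PreservesCost, PreservesCost, this]

end SketchMul

end KronLRA


namespace KronLRA

/-! ### The law of the output of the program. -/

section Law

open Matrix

variable {q : ℕ} {n d : Fin q → ℕ} {k : ℕ} {ε : ℝ} {A : ∀ i, Matrix (Fin (n i)) (Fin (d i)) ℝ}
  {e : ∀ i, Enum (A i)}

theorem initial_dim (i : ℕ) : (initial k ε A e).nv (3 * i + 2) = toArr d i := by
  have h1 : (3 * i + 1) % 3 = 1 := by omega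
  have h2 : (3 * i + 1) / 3 = i := by omega
  simp [initial, h1, h2]

theorem initial_nnz (i : ℕ) :
    (initial k ε A e).nv (3 * i + 3) = toArr (fun i => nnz (A i)) i := by
  have h1 : (3 * i + 2) % 3 = 2 := by omega
  have h2 : (3 * i + 2) / 3 = i := by omega
  simp [initial, h1, h2]

theorem initial_row (i : Fin q) :
    (initial k ε A e).na (2 * i) = toArr fun t => ((e i t).1.1 : ℕ) := by
  simp [initial, toArr_val]

theorem initial_col (i : Fin q) :
    (initial k ε A e).na (2 * i + 1) = toArr fun t => ((e i t).1.2 : ℕ) := by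
  have h2 : (2 * (i : ℕ) + 1) / 2 = i := by omega
  simp [initial, h2, toArr_val]

theorem initial_val (i : Fin q) :
    (initial k ε A e).ra i = toArr fun t => A i (e i t).1.1 (e i t).1.2 := by
  simp only [initial]
  exact toArr_val _ i

theorem initial_ra_zero {x : ℕ} (hx : q ≤ x) : (initial k ε A e).ra x = 0 := by
  simp [initial, toArr, hx.not_gt]

/-- The places on the tape where the hash values of the nonzero rows are found. -/
theorem exists_tape_position (e : ∀ i, Enum (A i)) : ∃ (ι : ℕ → ℕ → ℕ)
    (κ : NonzeroRow A → Fin (∑ i, nnz (A i))), Function.Injective κ ∧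
    (∀ p : NonzeroRow A, (κ p : ℕ) = ∑ l ∈ Finset.range p.1.1, toArr (fun i => nnz (A i)) l +
      ι p.1.1 p.1.2) ∧
    ∀ (i : Fin q) (t : Fin (nnz (A i))), ∀ f g,
      writeAt (toArr fun t => ((e i t).1.1 : ℕ)) f g (nnz (A i)) (e i t).1.1
        = f (ι i (e i t).1.1) := by
  have hex : ∀ i : Fin q, ∃ ι : ℕ → ℕ, ∀ t : Fin (nnz (A i)), ι (e i t).1.1 < nnz (A i) ∧
      toArr (fun t => ((e i t).1.1 : ℕ)) (ι (e i t).1.1) = (e i t).1.1 ∧ ∀ f g,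
      writeAt (toArr fun t => ((e i t).1.1 : ℕ)) f g (nnz (A i)) (e i t).1.1
        = f (ι (e i t).1.1) := fun i => by
    obtain ⟨ι, hι⟩ := exists_last_write (toArr fun t => ((e i t).1.1 : ℕ)) (nnz (A i))
    refine ⟨ι, fun t => ?_⟩
    have := hι t t.2
    rwa [toArr_val] at this
  choose ι₀ hι₀ using hex
  set lN : ℕ → ℕ := toArr fun i => nnz (A i) with hlN
  have hrow : ∀ p : NonzeroRow A, ι₀ p.1.1 p.1.2 < nnz (A p.1.1) ∧
      toArr (fun t => ((e p.1.1 t).1.1 : ℕ)) (ι₀ p.1.1 p.1.2) = p.1.2 := by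
    rintro ⟨⟨i, r⟩, c, hc⟩
    have := hι₀ i ((e i).symm ⟨(r, c), hc⟩)
    rw [Equiv.apply_symm_apply] at this
    exact ⟨this.1, this.2.1⟩
  have hmono : Monotone fun i => ∑ l ∈ Finset.range i, lN l := fun i j hij =>
    Finset.sum_le_sum_of_subset (Finset.range_mono hij)
  have hlt : ∀ p : NonzeroRow A, ∑ l ∈ Finset.range p.1.1, lN l + ι₀ p.1.1 p.1.2
      < ∑ l ∈ Finset.range (p.1.1 + 1), lN l := fun p => by
    rw [Finset.sum_range_succ, hlN, toArr_val]
    exact Nat.add_lt_add_left (hrow p).1 _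
  refine ⟨fun i r => if h : i < q then ι₀ ⟨i, h⟩ r else 0,
    fun p => ⟨∑ l ∈ Finset.range p.1.1, lN l + ι₀ p.1.1 p.1.2, ?_⟩, ?_, ?_, ?_⟩
  · refine (hlt p).trans_le ?_
    rw [← sum_range_toArr]
    exact hmono p.1.1.2
  · intro p p' h
    have h := Fin.mk.inj_iff.1 h
    -- Different factors use disjoint segments of the tape, cut out by the partial sums of the
    -- numbers of nonzero entries. Within a segment the position determines the row, as the entry at
    -- that position lies in it.
    have hi : p.1.1 = p'.1.1 := by
      rcases lt_trichotomy p.1.1 p'.1.1 with hl | hl | hl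
      · have h1 := hlt p
        have h2 : _ ≤ _ := hmono (Nat.succ_le_of_lt (Fin.lt_def.1 hl))
        simp only [Nat.succ_eq_add_one] at h2
        omega
      · exact hl
      · have h1 := hlt p'
        have h2 : _ ≤ _ := hmono (Nat.succ_le_of_lt (Fin.lt_def.1 hl))
        simp only [Nat.succ_eq_add_one] at h2
        omega
    have h3 := (hrow p).2
    have h4 := (hrow p').2
    obtain ⟨⟨i, r⟩, hr⟩ := p
    obtain ⟨⟨i', r'⟩, hr'⟩ := p'
    obtain rfl : i = i' := hi
    have h5 : ι₀ i r = ι₀ i r' := Nat.add_left_cancel h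
    simp only at h3 h4
    rw [h5, h4] at h3
    obtain rfl : r' = r := Fin.ext h3
    rfl
  · intro p
    simp
  · intro i t f g
    rw [(hι₀ i t).2.2 f g]
    simp

theorem kronEntry_congr {m : ℕ} {d d' : ℕ → ℕ} {b : ℕ → ℕ → ℕ → ℝ} {i : ℕ}
    (h : ∀ l < i, d l = d' l) (x y : ℕ) : kronEntry m d b i x y = kronEntry m d' b i x y := by
  induction i generalizing x y with
  | zero => rfl
  | succ i ih => rw [kronEntry, kronEntry, h i (by omega), ih fun l hl => h l (by omega)]

/-- A bound for the running time. -/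
def totalTime (q m L D k : ℕ) : ℕ :=
  m * 20 + 2 * q + 20 + (L * 20 + 6 + (10 + 60 * L + q * (240 * (m ^ q * D)) +
    (14 + 2000 * (D * (m ^ q * k) ^ 5))))

theorem tailTime_le {q m k L D : ℕ} {l d : ℕ → ℕ} (hq : 0 < q) (hm : 0 < m) (hk : 0 < k)
    (hd : ∀ i < q, 0 < d i) (hL : ∑ i ∈ Finset.range q, l i = L)
    (hD : ∏ i ∈ Finset.range q, d i = D) : tailTime q m k l d ≤ 10 + 60 * L +
      q * (240 * (m ^ q * D)) + (14 + 2000 * (D * (m ^ q * k) ^ 5)) := by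
  have hD0 : 0 < D := by
    rw [← hD]
    exact Finset.prod_pos fun i hi => hd i (Finset.mem_range.1 hi)
  have h1 := stagesTime_le (l := l) hm hd (le_refl q)
  rw [hL, hD] at h1
  have h2 := powerTime_add_greedyTime_le (pow_pos hm q) hD0 hk
    (Nat.le_self_pow hq.ne' m)
  rw [tailTime, hD]
  omega

/-- The places `κ` are fixed before the tape `ω` is drawn, so the hash values of the nonzero rows
are independent and uniform. The greedy property and the time bound hold for every tape. -/
theorem kronProgram_law (hq : 0 < q) (hd : ∀ i, 0 < d i) (hk : 0 < k) (hkd : k ≤ ∏ i, d i) {m : ℕ}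
    [NeZero m] [NeZero (2 * m)] (hm : m = sketchRows q k ε) : ∃ κ : NonzeroRow A → Fin (∑ i, nnz (A i)),
    Function.Injective κ ∧
    Law (Fin (∑ i, nnz (A i)) → Fin (2 * m)) (kronProgram q) (initial k ε A e)
      (totalTime q m (∑ i, nnz (A i)) (∏ i, d i) k) fun ω s' =>
      ∃ u : ℕ → (∀ i, Fin (d i)) → ℝ, output d k s' = rowsOf u k ∧
      ∀ M : Matrix (Fin q → Fin m) (∀ i, Fin (d i)) ℝ,
      M = kron (fun i => countSketch (extendSeed A (decode m ∘ ω ∘ κ) i)) * kron A →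
      IsGreedy ((M * Mᵀ) ^ (2 ^ squarings (Fintype.card (Fin q → Fin m))
        (Fintype.card (∀ i, Fin (d i))) k m) * M) u k := by
  obtain ⟨ι, κ, hκ, hκv, hι⟩ := exists_tape_position e
  refine ⟨κ, hκ, ?_⟩
  set s := initial k ε A e with hs
  generalize hL : ∑ i, nnz (A i) = L at κ hκ hκv ⊢
  have hm0 : 0 < m := Nat.pos_of_ne_zero (NeZero.ne _)
  rw [kronProgram, totalTime]
  have hsize := sizeProg_spec (B := 3 * q + 1) (q := q) (k := k) (ε := ε) (by omega) (s := s) rfl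
    (by simp [hs, initial])
  rw [← hm] at hsize
  refine Law.exec_seq (hsize.mono ?_)
  rintro s₁ ⟨F1, h1, h2⟩
  have hsum : ∑ i ∈ Finset.range q, s.nv (3 * i + 3) = L := by
    simp only [hs, initial_nnz]
    rw [sum_range_toArr, hL]
  rw [hsum] at h2
  refine Law.seq_exec ((tapeProg_law h1 h2).mono ?_)
  rintro ω s₂ ⟨F2, hω⟩
  have nv2 : ∀ x ≤ 3 * q, s₂.nv x = s.nv x := fun x hx => by
    rw [F2.nv _ (by simp only [List.mem_cons, List.not_mem_nil, or_false]; omega),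
      F1.nv _ (by simp only [List.mem_cons, List.not_mem_nil, or_false]; omega)]
  have na2 : ∀ x < 2 * q, s₂.na x = s.na x := fun x hx => by
    rw [F2.na _ (by simp only [List.mem_cons, List.not_mem_nil, or_false]; omega),
      F1.na _ (by simp)]
  have ra2 : ∀ x, s₂.ra x = s.ra x := fun x => by rw [F2.ra _ (by simp), F1.ra _ (by simp)]
  have hm2 : s₂.nv (3 * q + 1) = m := by rw [F2.nv _ (by simp), h1]
  have hdim : ∀ i < q, s₂.nv (3 * i + 2) = toArr d i := fun i hi => by
    rw [nv2 _ (by omega), hs, initial_dim]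
  have hlen : ∀ i < q, s₂.nv (3 * i + 3) = toArr (fun i => nnz (A i)) i := fun i hi => by
    rw [nv2 _ (by omega), hs, initial_nnz]
  have hD : ∏ i, d i = ∏ l ∈ Finset.range q, s₂.nv (3 * l + 2) := by
    rw [← prod_range_toArr]
    exact Finset.prod_congr rfl fun i hi => (hdim i (Finset.mem_range.1 hi)).symm
  have hLs : ∀ i ≤ q, ∑ l ∈ Finset.range i, s₂.nv (3 * l + 3)
      = ∑ l ∈ Finset.range i, toArr (fun i => nnz (A i)) l := fun i hi =>
    Finset.sum_congr rfl fun l hl => hlen l (by have := Finset.mem_range.1 hl; omega)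
  -- The row of any listed entry is a nonzero row, so the cell the program reads for it is the one
  -- named by `κ`.
  have hpos : ∀ (i : Fin q) (t : Fin (nnz (A i))), ∃ p : NonzeroRow A,
      p.1 = ⟨i, (e i t).1.1⟩ ∧ s₂.na (2 * q) ((∑ l ∈ Finset.range i, s₂.nv (3 * l + 3)) +
        ι i (e i t).1.1) = ω (κ p) := fun i t => by
    refine ⟨⟨⟨i, (e i t).1.1⟩, _, (e i t).2⟩, rfl, ?_⟩
    rw [← hω, hκv, hLs i i.2.le]
  set b : ℕ → ℕ → ℕ → ℝ := fun i => sketchEntry m (s₂.na (2 * i)) (s₂.na (2 * i + 1)) (s₂.ra i)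
    (fun r => s₂.na (2 * q) ((∑ l ∈ Finset.range i, s₂.nv (3 * l + 3)) + ι i r))
    (s₂.nv (3 * i + 3)) with hb
  set M₀ : Matrix (Fin (m ^ q)) (Fin (∏ i, d i)) ℝ := Matrix.of fun x y =>
    kronEntry m (fun l => s₂.nv (3 * l + 2)) b q x y with hM₀
  refine Exec.le (Exec.mono (tailProg_spec (B := 3 * q + 1) (A := 2 * q) (R := q) (m := m) (k := k)
    (b := b) (s₀ := s₂) (by omega) le_rfl le_rfl hm2 (by rw [nv2 0 (by omega)]; rfl)
    (by rw [← hD]; exact hkd) (fun x hx => by rw [ra2, hs, initial_ra_zero hx]) ?_ (ι := ι) ?_ ?_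
    (fun i _ => rfl) hD hM₀) ?_) ?_
  · intro i hi t ht
    rw [hlen i hi, toArr_lt _ hi] at ht
    rw [hdim i hi, toArr_lt _ hi, na2 _ (by omega), hs, initial_col ⟨i, hi⟩, toArr_lt _ ht]
    exact Fin.is_lt _
  · intro i hi t ht f g
    rw [hlen i hi, toArr_lt _ hi] at ht ⊢
    rw [na2 _ (by omega), hs, initial_row ⟨i, hi⟩]
    have := hι ⟨i, hi⟩ ⟨t, ht⟩ f g
    rw [toArr_lt _ ht]
    exact this
  · intro i hi t ht
    rw [hlen i hi, toArr_lt _ hi] at ht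
    rw [na2 (2 * i) (by omega), hs, initial_row ⟨i, hi⟩, toArr_lt _ ht]
    obtain ⟨p, -, hp⟩ := hpos ⟨i, hi⟩ ⟨t, ht⟩
    refine lt_of_eq_of_lt hp (Fin.is_lt _)
  · intro s' hG
    -- The row positions are lexicographic with all radices equal to `m`.
    let fI : (Fin q → Fin m) ≃ Fin (m ^ q) :=
      (flatEquiv fun _ : Fin q => m).trans (finCongr (by simp))
    have hG' := hG.submatrix fI (flatEquiv d)
    refine ⟨fun i y => s'.ra q (i * (∏ i, d i) + flat y), rfl, fun M hM => ?_⟩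
    have hMM : M = M₀.submatrix fI (flatEquiv d) := by
      rw [hM, kron_mul_kron]
      ext x y
      have hx : (fI x : ℕ) = flat x := rfl
      simp only [hM₀, submatrix_apply, of_apply, hx, flatEquiv_val]
      rw [kronEntry_congr hdim, kronEntry_flat]
      simp only [kron, of_apply]
      refine Finset.prod_congr rfl fun i _ => ?_
      rw [hb]
      simp only
      rw [hlen i i.2, na2 (2 * i) (by omega), na2 (2 * i + 1) (by omega), ra2, hs, initial_row,
        initial_col, initial_val, toArr_val]
      symm
      apply sketchEntry_eq (e i)
      intro t
      obtain ⟨p, hp1, hp2⟩ := hpos i t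
      rw [hp2]
      have : extendSeed A (decode m ∘ ω ∘ κ) i (e i t).1.1 = decode m (ω (κ p)) := by
        obtain ⟨p, hp⟩ := p
        subst hp1
        rw [extendSeed, dif_pos hp]
        rfl
      rw [this, decode]
      simp
    have c1 : Fintype.card (Fin q → Fin m) = m ^ q := by simp
    have c2 : Fintype.card (∀ i, Fin (d i)) = ∏ i, d i := by simp
    rw [c1, c2, hMM, ← submatrix_pow_mul]
    exact hG'
  · exact tailTime_le hq hm0 hk (fun i hi => by rw [hdim i hi, toArr_lt _ hi]; exact hd _)
      ((hLs q le_rfl).trans ((sum_range_toArr _).trans hL)) hD.symm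

end Law

end KronLRA


namespace KronLRA

/-! ### Correctness and total running time. -/

section Correctness

open Matrix

theorem totalTime_le_nat {q m L D k : ℕ} (hq : 0 < q) (hm : 0 < m) (hk : 0 < k) (hD : 0 < D) :
    totalTime q m L D k ≤ 80 * L + (2070 + 242 * q) * (D * (m ^ q * k) ^ 5) := by
  have hp : 0 < m ^ q := pow_pos hm q
  have hZ : 0 < m ^ q * k := Nat.mul_pos hp hk
  have a1 : m ^ q * D ≤ D * (m ^ q * k) ^ 5 := by
    rw [mul_comm]
    exact Nat.mul_le_mul_left _ ((Nat.le_mul_of_pos_right _ hk).trans (Nat.le_self_pow (by omega) _))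
  have a2 : m ≤ m ^ q * D := (Nat.le_self_pow hq.ne' m).trans (Nat.le_mul_of_pos_right _ hD)
  set Y := D * (m ^ q * k) ^ 5 with hY
  have a3 : q * (240 * (m ^ q * D)) ≤ 240 * (q * Y) := by
    rw [mul_left_comm]; gcongr
  have a4 : q ≤ q * Y := Nat.le_mul_of_pos_right _ (by omega)
  have a5 : (2070 + 242 * q) * Y = 2070 * Y + 242 * (q * Y) := by ring
  rw [totalTime, a5]
  omega

theorem two_div_le_sketchRows {q k : ℕ} {ε : ℝ} (hq : 0 < q) (hk : 0 < k) (hε : 0 < ε)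
    (hε1 : ε < 1) : 2 / ε ≤ (sketchRows q k ε : ℝ) := by
  refine le_trans ?_ (Nat.le_ceil _)
  have hq' : (1 : ℝ) ≤ q := by exact_mod_cast hq
  have hk' : (1 : ℝ) ≤ k := by exact_mod_cast hk
  rw [div_le_div_iff₀ hε (by positivity)]
  have h1 : (1 : ℝ) ≤ q * (k : ℝ) ^ 2 := one_le_mul_of_one_le_of_one_le hq' (one_le_pow₀ hk')
  nlinarith [mul_le_mul_of_nonneg_right h1 hε.le, mul_pos hε hε]

/-- Rounding up adds less than `1 ≤ q (k/ε)²`, which turns `64000` into `64001`. -/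
theorem sketchRows_le {q k : ℕ} {ε : ℝ} (hq : 0 < q) (hk : 0 < k) (hε : 0 < ε)
    (hε1 : ε < 1) : (sketchRows q k ε : ℝ) ≤ 64001 * q * (k / ε) ^ 2 := by
  have hq' : (1 : ℝ) ≤ q := by exact_mod_cast hq
  have hk' : (1 : ℝ) ≤ k := by exact_mod_cast hk
  have h1 : (1 : ℝ) ≤ k / ε := by rw [le_div_iff₀ hε]; linarith
  have h2 : (1 : ℝ) ≤ q * (k / ε) ^ 2 := one_le_mul_of_one_le_of_one_le hq' (one_le_pow₀ h1)
  have h3 := (Nat.ceil_lt_add_one (a := 64000 * q * (k : ℝ) ^ 2 / ε ^ 2) (by positivity)).le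
  rw [sketchRows]
  refine h3.trans ?_
  rw [mul_div_assoc, ← div_pow]
  linarith

/-- Since `m` is of order `q (k/ε)²`, the factor `(m^q k)^5` is of order `(k/ε)^(10 q + 5)`; the
powers of `q` go into the constant. -/
theorem totalTime_le {q k D L : ℕ} {ε : ℝ} (hq : 0 < q) (hk : 0 < k) (hε : 0 < ε)
    (hε1 : ε < 1) (hD : 0 < D) (hm : 0 < sketchRows q k ε) :
    (totalTime q (sketchRows q k ε) L D k : ℝ)
      ≤ ((80 + (2070 + 242 * q) * (64001 * q) ^ (5 * q) : ℕ) : ℝ) *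
        (L + D * (k / ε) ^ (10 * q + 5)) := by
  set m := sketchRows q k ε with hmdef
  have h1 : (totalTime q m L D k : ℝ)
      ≤ 80 * L + (2070 + 242 * q) * (D * ((m : ℝ) ^ q * k) ^ 5) := by
    exact_mod_cast totalTime_le_nat hq hm hk hD
  have h2 : (m : ℝ) ≤ 64001 * q * (k / ε) ^ 2 := sketchRows_le hq hk hε hε1
  have h3 : (k : ℝ) ≤ k / ε := le_div_self (by positivity) hε hε1.le
  have h4 : ((m : ℝ) ^ q * k) ^ 5 ≤ (64001 * q) ^ (5 * q) * (k / ε) ^ (10 * q + 5) := by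
    calc ((m : ℝ) ^ q * k) ^ 5 ≤ ((64001 * q * (k / ε) ^ 2) ^ q * (k / ε)) ^ 5 := by gcongr
      _ = (64001 * q) ^ (5 * q) * (k / ε) ^ (10 * q + 5) := by
        rw [mul_pow, mul_pow, mul_pow, ← pow_mul, ← pow_mul, ← pow_mul]
        ring
  set E : ℝ := (64001 * q) ^ (5 * q) with hE
  set K : ℝ := (k / ε) ^ (10 * q + 5) with hK
  have hK0 : 0 ≤ K := by positivity
  have hE0 : 0 ≤ E := by positivity
  have hL0 : (0 : ℝ) ≤ L := by positivity
  refine h1.trans ?_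
  push_cast
  rw [← hE]
  have h5 : (2070 + 242 * (q : ℝ)) * (D * ((m : ℝ) ^ q * k) ^ 5)
      ≤ (2070 + 242 * q) * E * (D * K) := by
    calc _ ≤ (2070 + 242 * (q : ℝ)) * (D * (E * K)) := by gcongr
      _ = _ := by ring
  have h6 : 0 ≤ (2070 + 242 * (q : ℝ)) * E * L := by positivity
  have h7 : 0 ≤ 80 * ((D : ℝ) * K) := by positivity
  nlinarith

/-- The cut-off `N` is one more than the time bound, so no run is cut off. Orthonormality and
near-optimality for the sketch hold on every tape, and the tape is unlucky only if the sketch fails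
to preserve costs. -/
theorem kronProgram_correct {q : ℕ} (hq : 0 < q) {n d : Fin q → ℕ}
    (A : ∀ i, Matrix (Fin (n i)) (Fin (d i)) ℝ) (e : ∀ i, Enum (A i)) {k : ℕ} {ε : ℝ}
    (hd : ∀ i, 0 < d i) (hk : 0 < k) (hkd : k ≤ ∏ i, d i) (hε : 0 < ε) (hε1 : ε < 1) :
    ∃ N : ℕ,
      (∀ o ∈ ((kronProgram q).eval N (initial k ε A e)).support, ∃ s, o = some s ∧
        (s.time : ℝ) ≤ ((80 + (2070 + 242 * q) * (64001 * q) ^ (5 * q) : ℕ) : ℝ) *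
          ((∑ i, nnz (A i) : ℕ) + (∏ i, d i : ℕ) * (k / ε) ^ (10 * q + 5)) ∧
        output d k s * (output d k s)ᵀ = 1 ∧
        (kron A * (output d k s)ᵀ * output d k s).rank ≤ k) ∧
      9 / 10 ≤ ((kronProgram q).eval N (initial k ε A e)).toOuterMeasure
        {o | ∃ s, o = some s ∧
          frob (kron A * (output d k s)ᵀ * output d k s - kron A) ≤ (1 + ε) * OPT k (kron A)} := by
  classical
  obtain ⟨m, hm⟩ : ∃ m, m = sketchRows q k ε := ⟨_, rfl⟩
  have h2ε := two_div_le_sketchRows hq hk hε hε1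
  have hm0 : 0 < sketchRows q k ε := by
    have : (0 : ℝ) < sketchRows q k ε := lt_of_lt_of_le (by positivity) h2ε
    exact_mod_cast this
  have htime := totalTime_le (L := ∑ i, nnz (A i)) (D := ∏ i, d i) hq hk hε hε1
    (Finset.prod_pos fun i _ => hd i) hm0
  rw [← hm] at hm0 htime h2ε
  have : NeZero m := ⟨hm0.ne'⟩
  have : NeZero (2 * m) := ⟨by omega⟩
  obtain ⟨κ, hκ, hlaw⟩ := kronProgram_law (A := A) (e := e) hq hd hk hkd hm
  set T := totalTime q m (∑ i, nnz (A i)) (∏ i, d i) k with hT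
  obtain ⟨f, g, h1, h2⟩ := hlaw (T + 1) (Nat.lt_succ_self _) 0
  have hJ : k ≤ Fintype.card (∀ i, Fin (d i)) := by simpa using hkd
  have hU : ∀ ω, output d k (f ω) * (output d k (f ω))ᵀ = 1 ∧
      ∀ M : Matrix (Fin q → Fin m) (∀ i, Fin (d i)) ℝ,
      M = kron (fun i => countSketch (extendSeed A (decode m ∘ ω ∘ κ) i)) * kron A →
      frobSq (M - M * (output d k (f ω))ᵀ * output d k (f ω))
        ≤ (1 + ε / 4) * (frobSq M - ∑ i ∈ Finset.range k, sval M i ^ 2) := by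
    intro ω
    obtain ⟨-, u, hu, hg⟩ := h2 ω
    rw [hu]
    refine ⟨((hg _ rfl).near_optimal hε h2ε hk hJ).1, ?_⟩
    rintro M rfl
    exact ((hg _ rfl).near_optimal hε h2ε hk hJ).2
  refine ⟨T + 1, ?_, ?_⟩
  · intro o ho
    rw [show initial k ε A e = (initial k ε A e).withTime 0 from rfl, h1,
      PMF.mem_support_map_iff] at ho
    obtain ⟨ω, -, rfl⟩ := ho
    refine ⟨_, rfl, le_trans ?_ htime, (hU ω).1, rank_mul_mul_le _ _⟩
    have := (h2 ω).1
    rw [zero_add] at this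
    exact_mod_cast this
  · rw [show initial k ε A e = (initial k ε A e).withTime 0 from rfl, h1,
      PMF.toOuterMeasure_map_apply]
    have hcard := card_not_preservesCost_tape_le (m := m) A hk hkd hq hε hε1
      (by rw [hm]; exact Nat.le_ceil _) hκ
    rw [Nat.card_eq_fintype_card (α := Fin (∑ i, nnz (A i)) → Fin (2 * m))] at hcard
    -- Cost preservation with `x = ε/4` matches the accuracy `1 + ε/4` of the greedy vectors, and
    -- together they give `1 + 4x = 1 + ε`.
    refine (toOuterMeasure_uniform_ge (S := {ω | PreservesCost k (ε / 4) (kron A)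
      (extendSeed A (decode m ∘ ω ∘ κ))}) hcard).trans (MeasureTheory.measure_mono fun ω hω => ?_)
    refine ⟨_, rfl, ?_⟩
    obtain ⟨V, hV⟩ := exists_isTop (kron A) hJ
    have := frob_le_of_cost_preserved (x := ε / 4) (by linarith) (by linarith) hV (hU ω).1 hω
      ((hU ω).2 _ rfl)
    rwa [show 1 + 4 * (ε / 4) = 1 + ε by ring] at this

end Correctness

end KronLRA

theorem mainTheorem4 :
    -- the sketch: projecting `A` onto top-`k` right singular vectors of the sketch
    (∃ C : ℝ, 0 < C ∧
      ∀ (q : ℕ) (n d : Fin q → ℕ) (A : ∀ i, Matrix (Fin (n i)) (Fin (d i)) ℝ)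
        (k : ℕ) (ε : ℝ) (m : ℕ) [NeZero m],
        2 ≤ q → (∀ i, 0 < d i) → 0 < k → k ≤ ∏ i, d i → 0 < ε → ε < 1 →
        C * q * (k : ℝ) ^ 2 / ε ^ 2 ≤ m →
        9 / 10 ≤ (PMF.uniformOfFintype (∀ i, KronLRA.Seed m (n i))).toOuterMeasure
          {s | ∀ U : Matrix (Fin k) (∀ i, Fin (d i)) ℝ,
            KronLRA.IsTopRightSingular
              (KronLRA.kron (fun i => KronLRA.countSketch (s i)) * KronLRA.kron A) U →
            (KronLRA.kron A * U.transpose * U).rank ≤ k ∧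
            KronLRA.frob (KronLRA.kron A * U.transpose * U - KronLRA.kron A)
              ≤ (1 + ε) * KronLRA.OPT k (KronLRA.kron A)}) ∧
    -- the algorithm: for each `q`, a randomized real-RAM program and its running time
    (∀ q : ℕ, 2 ≤ q → ∃ (P : KronLRA.Prog) (C c : ℕ),
      ∀ (n d : Fin q → ℕ) (A : ∀ i, Matrix (Fin (n i)) (Fin (d i)) ℝ)
        (e : ∀ i, KronLRA.Enum (A i)) (k : ℕ) (ε : ℝ),
        (∀ i, 0 < d i) → 0 < k → k ≤ ∏ i, d i → 0 < ε → ε < 1 →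
        ∃ N : ℕ,
          (∀ o ∈ (P.eval N (KronLRA.initial k ε A e)).support, ∃ s, o = some s ∧
            (s.time : ℝ) ≤ C * ((∑ i, KronLRA.nnz (A i) : ℕ) + (∏ i, d i : ℕ) * (k / ε) ^ c) ∧
            KronLRA.output d k s * (KronLRA.output d k s).transpose = 1 ∧
            (KronLRA.kron A * (KronLRA.output d k s).transpose * KronLRA.output d k s).rank ≤ k) ∧
          9 / 10 ≤ (P.eval N (KronLRA.initial k ε A e)).toOuterMeasure
            {o | ∃ s, o = some s ∧
              KronLRA.frob (KronLRA.kron A * (KronLRA.output d k s).transpose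
                  * KronLRA.output d k s - KronLRA.kron A)
                ≤ (1 + ε) * KronLRA.OPT k (KronLRA.kron A)}) := by
  refine ⟨⟨64000, by norm_num, ?_⟩, fun q hq => ?_⟩
  · intro q n d A k ε m _ hq _ hk hkd hε hε1 hm
    exact KronLRA.sketch_top_singular n d A k ε m (by omega) hk hkd hε hε1 hm
  · refine ⟨KronLRA.kronProgram q, 80 + (2070 + 242 * q) * (64001 * q) ^ (5 * q), 10 * q + 5, ?_⟩
    intro n d A e k ε hd hk hkd hε hε1
    exact KronLRA.kronProgram_correct (by omega) A e hd hk hkd hε hε1
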